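/- Model. An LCL problem $\mathcal P$ is given by finite sets of input labels and of output labels, an integer $r\ge 0$, and a finite set $\mathcal C$ of finite graphs, each with one node marked as center and every node labeled by a pair (input label, output label). For a graph whose nodes carry input labels, an output labeling is correct if for every node $v$ the labeled subgraph induced by the nodes at distance at most $r$ from $v$ is isomorphic to an element of $\mathcal C$, with $v$ corresponding to the center. Fix an integer $c\ge 1$. In the deterministic $\mathsf{LOCAL}$ model the nodes of an (undirected) $n$-node graph have pairwise distinct identifiers in $\{0,\dots,n^c-1\}$. An algorithm with running time $T(n)$ chooses the output of each node as a function of $n$, the identifier of the node, and the radius-$T(n)$ neighborhood of the node with its identifiers and input labels; it solves $\mathcal P$ on a graph if its output is correct for all identifier assignments and all input labelings. The complexity of $\mathcal P$ on cycles is the function that maps $n$ to the least number of rounds with which some algorithm solves $\mathcal P$ on the $n$-node cycle ($\infty$ if there is none); the complexity on paths is defined in the same way. The symbols $O$ and $\Omega$ refer to all sufficiently large $n$. Theorem. Consider the deterministic $\mathsf{LOCAL}$ complexity of LCL problems with input labels on cycles. 1. For every LCL problem $\mathcal P$ the complexity is either $\Omega(n)$ or $O(\log^* n)$. 2. There is an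 algorithm (a Turing-computable function) that, given a description of $\mathcal P$, decides which of the two cases holds. If the complexity is $O(\log^* n)$, it also outputs a description of an $O(\log^* n)$-round deterministic $\mathsf{LOCAL}$ algorithm for $\mathcal P$: a program that computes the number of rounds $T(n)=O(\log^* n)$, and a program that computes the output of a node from its radius-$T(n)$ neighborhood. The described algorithm solves $\mathcal P$ on the $n$-node cycle for every $n$ for which $\mathcal P$ can be solved at all on the $n$-node cycle, that is, for which every input labeling has a correct output labeling (in particular for all sufficiently large $n$). The same two statements hold with paths in place of cycles. -/

import Mathlib

/-! ## Locally checkable labeling problems -/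

/-- A finite graph in which every node carries an input label and an output label and one node is
marked as the center. The nodes are `0, …, nodes.length - 1`; entry `i` of `nodes` is the pair
(input label, output label) of node `i`; `edges` lists the (unordered) edges. -/
structure CenteredGraph where
  nodes : List (ℕ × ℕ)
  edges : List (ℕ × ℕ)
  center : ℕ

/-- The underlying simple graph of a centered labeled graph. -/
def CenteredGraph.graph (H : CenteredGraph) : SimpleGraph (Fin H.nodes.length) :=
  SimpleGraph.fromRel fun i j => ((i : ℕ), (j : ℕ)) ∈ H.edges

/-- An LCL problem: input labels `0, …, numIn - 1`, output labels `0, …, numOut - 1`, a checking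
radius, and a finite collection of accepted centered labeled graphs. -/
structure LCL where
  numIn : ℕ
  numOut : ℕ
  radius : ℕ
  accepted : List CenteredGraph

/-- The nodes at distance at most `t` from `v`. -/
def nbhd {V : Type*} (G : SimpleGraph V) (t : ℕ) (v : V) : Set V :=
  {u | G.edist v u ≤ (t : ℕ∞)}

/-- The radius-`r` neighborhood of `v` in the labeled graph `(G, inp, out)` is isomorphic to `H`,
as a labeled graph and with `v` corresponding to the marked center. -/
def CenteredGraph.Matches (H : CenteredGraph) {V : Type*} (G : SimpleGraph V)
    (inp out : V → ℕ) (r : ℕ) (v : V) : Prop :=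
  ∃ e : G.induce (nbhd G r v) ≃g H.graph,
    (∀ u : nbhd G r v, H.nodes.get (e u) = (inp u, out u)) ∧
    (∀ u : nbhd G r v, (u : V) = v → ((e u : ℕ) = H.center))

/-- The output labeling `out` is a correct solution of `P` on `G` with input labeling `inp`. -/
def LCL.Correct (P : LCL) {V : Type*} (G : SimpleGraph V)
    (inp : V → Fin P.numIn) (out : V → Fin P.numOut) : Prop :=
  ∀ v, ∃ H ∈ P.accepted,
    H.Matches G (fun u => (inp u : ℕ)) (fun u => (out u : ℕ)) P.radius v

/-! ## The deterministic LOCAL model -/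

open Classical in
/-- The elements of `S`, in increasing order of identifiers. -/
noncomputable def sortById {n : ℕ} (ids : Fin n → ℕ) (S : Set (Fin n)) : List (Fin n) :=
  ((List.finRange n).filter (fun u => decide (u ∈ S))).mergeSort
    (fun u w => decide (ids u ≤ ids w))

/-- What a node knows: the number of nodes of the input graph, its own identifier, and, for every
node of its neighborhood in increasing order of identifiers, the identifier of that node, its input
label, and the identifiers of its neighbors inside the neighborhood. -/
abbrev View := ℕ × ℕ × List (ℕ × ℕ × List ℕ)

/-- The information contained in the radius-`t` neighborhood of `v`. -/
noncomputable def view {n : ℕ} (G : SimpleGraph (Fin n)) (ids inp : Fin n → ℕ) (t : ℕ)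
    (v : Fin n) : View :=
  (n, ids v, (sortById ids (nbhd G t v)).map fun u =>
    (ids u, inp u, (sortById ids {w | w ∈ nbhd G t v ∧ G.Adj u w}).map ids))

/-- A deterministic LOCAL algorithm: on an `n`-node graph every node gathers its radius-`rounds n`
neighborhood and then chooses its output label from this information alone. -/
structure LocalAlgorithm where
  rounds : ℕ → ℕ
  output : View → ℕ

/-- The algorithm solves `P` on the graph `G`: for all assignments of pairwise distinct identifiers
from `{0, …, n ^ c - 1}` and for all input labelings, the outputs of the nodes form a correct
solution. -/
def LocalAlgorithm.Solves (A : LocalAlgorithm) (P : LCL) (c : ℕ) {n : ℕ}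
    (G : SimpleGraph (Fin n)) : Prop :=
  ∀ ids : Fin n → ℕ, Function.Injective ids → (∀ v, ids v < n ^ c) →
    ∀ inp : Fin n → Fin P.numIn, ∃ out : Fin n → Fin P.numOut,
      (∀ v, (out v : ℕ) = A.output (view G ids (fun u => (inp u : ℕ)) (A.rounds n) v)) ∧
      P.Correct G inp out

/-- The deterministic LOCAL complexity of `P` on `G`: the least number of rounds of an algorithm
that solves `P` on `G`, and `⊤` if there is none. -/
noncomputable def LCL.complexity (P : LCL) (c : ℕ) {n : ℕ} (G : SimpleGraph (Fin n)) : ℕ∞ :=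
  ⨅ (A : LocalAlgorithm) (_ : A.Solves P c G), (A.rounds n : ℕ∞)

/-- The iterated logarithm: how often the binary logarithm has to be applied to `n` until the
result is at most `1`. -/
noncomputable def logStar (n : ℕ) : ℕ :=
  sInf {k : ℕ | (Real.logb 2)^[k] (n : ℝ) ≤ 1}

/-- `T(n) = O(log* n)`. -/
def IsBigOLogStar (T : ℕ → ℕ∞) : Prop :=
  ∃ C : ℕ, ∀ᶠ n : ℕ in Filter.atTop, T n ≤ ((C * logStar n : ℕ) : ℕ∞)

/-- `T(n) = Ω(n)`, i.e. `T n ≥ n / k` for some `k > 0` and all large `n`. -/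
def IsBigOmegaLinear (T : ℕ → ℕ∞) : Prop :=
  ∃ k : ℕ, 0 < k ∧ ∀ᶠ n : ℕ in Filter.atTop, (n : ℕ∞) ≤ (k : ℕ∞) * T n

/-! ## Descriptions as inputs and outputs of Turing-computable functions -/

def CenteredGraph.equivProd : CenteredGraph ≃ List (ℕ × ℕ) × List (ℕ × ℕ) × ℕ where
  toFun H := (H.nodes, H.edges, H.center)
  invFun x := ⟨x.1, x.2.1, x.2.2⟩
  left_inv _ := rfl
  right_inv _ := rfl

instance CenteredGraph.instPrimcodable : Primcodable CenteredGraph :=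
  Primcodable.ofEquiv _ CenteredGraph.equivProd

def LCL.equivProd : LCL ≃ ℕ × ℕ × ℕ × List CenteredGraph where
  toFun P := (P.numIn, P.numOut, P.radius, P.accepted)
  invFun x := ⟨x.1, x.2.1, x.2.2.1, x.2.2.2⟩
  left_inv _ := rfl
  right_inv _ := rfl

instance LCL.instPrimcodable : Primcodable LCL :=
  Primcodable.ofEquiv _ LCL.equivProd

/-- A description of a LOCAL algorithm: a program for the number of rounds and a program for the
output of a node. -/
abbrev AlgorithmDescription := Nat.Partrec.Code × Nat.Partrec.Code

/-- The two programs halt on all inputs and compute the two components of the algorithm `A`. -/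
def Describes (d : AlgorithmDescription) (A : LocalAlgorithm) : Prop :=
  (∀ n, A.rounds n ∈ d.1.eval n) ∧ ∀ w : View, A.output w ∈ d.2.eval (Encodable.encode w)

/-! Everything hinges on one combinatorial property, `LCL.IsFeasible`. Cut the input into blocks by
anchors. A labeling is correct iff the window at every node is accepted and neighboring windows
overlap consistently, so a block acts as a binary relation between the window states at its two ends
(`Chain`). There are finitely many such relations and they are compatible with concatenation; hence,
by pigeonhole, every long block has arbitrarily long substitutes with the same relation
(`exists_pumped`). Feasibility asks for a choice of the state at every anchor from the adjacent
words alone, such that every block can be completed.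

A fast algorithm gives such a choice (`exists_isFeasible`). Suppose that some `t`-round algorithm
works for a single `n` with `4 * (t + P.radius) + 10 ≤ n`. Pump the words next to the anchor beyond
its radius-`t + P.radius` window, assign identifiers, and take the state that the algorithm
produces. Along a pumped block the algorithm itself provides the completion: every window embeds
into an `n`-node graph (`Hostable.exists_host`), although the whole line does not. The relation then
carries this back to the original block.

Conversely, a feasible choice gives an algorithm with `O(log* n)` rounds
(`exists_solves_of_isFeasible`). Iterated color reduction and greedy selection produce anchors with
gaps between `K + 1` and `2 * K + 1`; anchors take the chosen states and blocks are completed. There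
is no common sense of direction: a view determines the window only up to reflection
(`exists_agree_of_isLineView`). Anchors and blocks are therefore oriented by comparing identifiers,
and feasibility has to hold for all orientations of the anchors. Paths are handled like cycles,
after adding empty places with virtual identifiers beyond the ends.

If no feasible choice exists, every algorithm has `n < 4 * (t + P.radius) + 10`, which is linear.
For the decision, the choice function is an infinite object and is never searched for. Instead one
size `testSize c P` is taken, so large that the `log*` algorithm meets the inequality there;
feasibility is then equivalent to the existence of a fast algorithm for this one size, a finite
search over tables of outputs. The same search, run for each `n` with the least possible number of
rounds, is the algorithm that is returned. -/

/-! ## Unrolling cycles and paths on the integer line -/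

/-- The cycle (`cyc = true`) or the path (`cyc = false`) on `n` nodes. -/
def hostGraph (cyc : Bool) (n : ℕ) : SimpleGraph (Fin n) :=
  if cyc then SimpleGraph.cycleGraph n else SimpleGraph.pathGraph n

/-- The node at position `i` of the integer line: the line winds around a cycle, and a path
occupies the positions `0, …, n - 1`. -/
def nodeAt (cyc : Bool) (n : ℕ) (i : ℤ) : Option (Fin n) :=
  if h : 0 < n ∧ (cyc = true ∨ (0 ≤ i ∧ i < n)) then
    some ⟨(i % n).toNat, by
      have := Int.emod_nonneg i (b := n) (by omega)
      have := Int.emod_lt_of_pos i (b := n) (by omega)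
      omega⟩
  else none

theorem nodeAt_eq_some {cyc : Bool} {n : ℕ} {i : ℤ} {u : Fin n} :
    nodeAt cyc n i = some u ↔ (n : ℤ) ∣ i - u ∧ (cyc = true ∨ i = u) := by
  have hu := u.2
  have hn : 0 < n := by omega
  unfold nodeAt
  by_cases hc : cyc = true
  · rw [dif_pos ⟨hn, Or.inl hc⟩]
    simp only [Option.some.injEq, Fin.ext_iff, hc, true_or, and_true]
    have h1 := Int.emod_nonneg i (b := n) (by omega)
    have h2 := Int.emod_lt_of_pos i (b := n) (by omega)
    constructor
    · intro h
      have : i % n = u := by omega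
      rw [← this]
      exact Int.dvd_self_sub_emod
    · intro h
      have : i % n = (u : ℤ) % n := Int.emod_eq_emod_iff_emod_sub_eq_zero.2 (Int.emod_eq_zero_of_dvd h)
      rw [this, Int.emod_eq_of_lt (by omega) (by omega)]
      omega
  · by_cases h : 0 ≤ i ∧ i < n
    · rw [dif_pos ⟨hn, Or.inr h⟩]
      simp only [Option.some.injEq, Fin.ext_iff, hc]
      rw [Int.emod_eq_of_lt h.1 h.2]
      constructor
      · intro h'
        have : i = u := by omega
        simp [this]
      · rintro ⟨-, h'⟩
        simp_all
    · rw [dif_neg (by tauto)]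
      simp only [reduceCtorEq, hc, false_or, false_iff, not_and]
      omega

theorem nodeAt_self {cyc : Bool} {n : ℕ} (v : Fin n) : nodeAt cyc n v = some v := by
  simp [nodeAt_eq_some]

theorem nodeAt_path_isSome {n : ℕ} {i : ℤ} : (nodeAt false n i).isSome ↔ 0 ≤ i ∧ i < n := by
  unfold nodeAt
  by_cases h : 0 ≤ i ∧ i < n
  · rw [dif_pos ⟨by omega, Or.inr h⟩]
    simpa using h
  · rw [dif_neg (by simp; omega)]
    simpa using h

theorem nodeAt_cycle_isSome {n : ℕ} (hn : 0 < n) {i : ℤ} : (nodeAt true n i).isSome := by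
  simp [nodeAt, hn]

theorem eq_of_nodeAt_eq {cyc : Bool} {n : ℕ} {i j : ℤ} {u : Fin n} (hi : nodeAt cyc n i = some u)
    (hj : nodeAt cyc n j = some u) (h : |i - j| < n) : i = j := by
  rw [nodeAt_eq_some] at hi hj
  have h1 : (n : ℤ) ∣ i - j := by
    have := dvd_sub hi.1 hj.1
    simpa using this
  have := Int.eq_zero_of_abs_lt_dvd h1 h
  omega

/-- The condition `u ≠ w` matters only on the one-node cycle, where a step to the right returns to
the same node. -/
theorem hostGraph_adj {cyc : Bool} {n : ℕ} {u w : Fin n} :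
    (hostGraph cyc n).Adj u w ↔
      u ≠ w ∧ (nodeAt cyc n (u + 1) = some w ∨ nodeAt cyc n (w + 1) = some u) := by
  have hu := u.2
  have hw := w.2
  cases cyc with
  | false =>
    simp only [hostGraph, Bool.false_eq_true, if_false, SimpleGraph.pathGraph_adj, nodeAt_eq_some,
      false_or, ne_eq, Fin.ext_iff]
    constructor
    · rintro (h | h)
      · refine ⟨by omega, Or.inl ⟨?_, by omega⟩⟩
        have : (u : ℤ) + 1 - w = 0 := by omega
        simp [this]
      · refine ⟨by omega, Or.inr ⟨?_, by omega⟩⟩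
        have : (w : ℤ) + 1 - u = 0 := by omega
        simp [this]
    · omega
  | true =>
    simp only [hostGraph, if_true, SimpleGraph.cycleGraph_adj', nodeAt_eq_some, true_or, and_true,
      ne_eq, Fin.ext_iff]
    have key : ∀ a b : Fin n, (a - b).val = 1 ↔ (a : ℕ) ≠ b ∧ (n : ℤ) ∣ b + 1 - a := by
      intro a b
      have ha := a.2
      have hb := b.2
      rw [Fin.sub_def]
      simp only
      rcases Nat.lt_or_ge (a : ℕ) b with h | h
      · rw [Nat.mod_eq_of_lt (by omega)]
        constructor
        · intro h'
          refine ⟨by omega, ?_⟩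
          have : (b : ℤ) + 1 - a = n := by omega
          rw [this]
        · rintro ⟨_, k, hk⟩
          have : k = 1 := by
            have h1 : 0 < k := by
              by_contra hc
              have : (n : ℤ) * k ≤ 0 := mul_nonpos_of_nonneg_of_nonpos (by omega) (by omega)
              omega
            have h2 : k < 2 := by
              by_contra hc
              have : (n : ℤ) * 2 ≤ n * k := mul_le_mul_of_nonneg_left (by omega) (by omega)
              omega
            omega
          subst this
          omega
      · have : n - (b : ℕ) + a = (a - b) + n := by omega
        rw [this, Nat.add_mod_right, Nat.mod_eq_of_lt (by omega)]
        constructor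
        · intro h'
          refine ⟨by omega, ?_⟩
          have : (b : ℤ) + 1 - a = 0 := by omega
          simp [this]
        · rintro ⟨h0, hk⟩
          have := Int.eq_zero_of_abs_lt_dvd hk (by rw [abs_lt]; omega)
          omega
    rw [key, key]
    have : (u : ℕ) = w ↔ (w : ℕ) = u := eq_comm
    tauto

theorem nodeAt_add_of_adj {cyc : Bool} {n : ℕ} {i : ℤ} {u w : Fin n}
    (hi : nodeAt cyc n i = some u) (h : (hostGraph cyc n).Adj u w) :
    nodeAt cyc n (i + 1) = some w ∨ nodeAt cyc n (i - 1) = some w := by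
  rw [hostGraph_adj] at h
  simp only [nodeAt_eq_some] at *
  rcases h.2 with h | h
  · left
    refine ⟨?_, ?_⟩
    · have := dvd_add hi.1 h.1
      rwa [show i - (u : ℤ) + (u + 1 - w) = i + 1 - w by ring] at this
    · rcases hi.2 with hc | hc
      · exact Or.inl hc
      · rcases h.2 with hc' | hc'
        · exact Or.inl hc'
        · right; omega
  · right
    refine ⟨?_, ?_⟩
    · have := dvd_sub hi.1 h.1
      rwa [show i - (u : ℤ) - (w + 1 - u) = i - 1 - w by ring] at this
    · rcases hi.2 with hc | hc
      · exact Or.inl hc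
      · rcases h.2 with hc' | hc'
        · exact Or.inl hc'
        · right; omega

theorem adj_or_eq_of_nodeAt {cyc : Bool} {n : ℕ} {i : ℤ} {u w : Fin n}
    (hi : nodeAt cyc n i = some u) (hj : nodeAt cyc n (i + 1) = some w) :
    (hostGraph cyc n).Adj u w ∨ u = w := by
  rw [hostGraph_adj]
  by_cases h : u = w
  · exact Or.inr h
  · refine Or.inl ⟨h, Or.inl ?_⟩
    simp only [nodeAt_eq_some] at *
    refine ⟨?_, ?_⟩
    · have := dvd_sub hj.1 hi.1
      rwa [show i + 1 - (w : ℤ) - (i - u) = u + 1 - w by ring] at this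
    · rcases hi.2 with hc | hc
      · exact Or.inl hc
      · rcases hj.2 with hc' | hc'
        · exact Or.inl hc'
        · right; omega

/-- Positions on a cycle are determined modulo `n`. The bound leaves room for one more step, so the
two nodes cannot be adjacent the other way around the cycle. -/
theorem adj_iff_of_nodeAt {cyc : Bool} {n : ℕ} {i j : ℤ} {u w : Fin n}
    (hi : nodeAt cyc n i = some u) (hj : nodeAt cyc n j = some w) (h : |i - j| + 1 < n) :
    (hostGraph cyc n).Adj u w ↔ |i - j| = 1 := by
  rw [← lt_sub_iff_add_lt, abs_lt] at h
  constructor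
  · intro ha
    rcases nodeAt_add_of_adj hi ha with h' | h'
    · have := eq_of_nodeAt_eq h' hj (by rw [abs_lt]; omega)
      rw [← this]
      norm_num
    · have := eq_of_nodeAt_eq h' hj (by rw [abs_lt]; omega)
      rw [← this]
      norm_num
  · intro ha
    have hne : u ≠ w := by
      rintro rfl
      have := eq_of_nodeAt_eq hi hj (by rw [abs_lt]; omega)
      simp [this] at ha
    rcases (abs_eq (by norm_num)).1 ha with h' | h'
    · have : i = j + 1 := by omega
      subst this
      rcases adj_or_eq_of_nodeAt hj hi with h | h
      · exact h.symm
      · exact absurd h.symm hne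
    · have : j = i + 1 := by omega
      subst this
      rcases adj_or_eq_of_nodeAt hi hj with h | h
      · exact h
      · exact absurd h hne

theorem nodeAt_isSome_between {cyc : Bool} {n : ℕ} {i j k : ℤ} (hi : (nodeAt cyc n i).isSome)
    (hj : (nodeAt cyc n j).isSome) (h1 : i ≤ k) (h2 : k ≤ j) : (nodeAt cyc n k).isSome := by
  cases cyc with
  | true =>
    apply nodeAt_cycle_isSome
    by_contra h
    simp [nodeAt, h] at hi
  | false =>
    rw [nodeAt_path_isSome] at *
    omega

theorem edist_le_of_nodeAt {cyc : Bool} {n : ℕ} (k : ℕ) : ∀ {i : ℤ} {u w : Fin n},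
    nodeAt cyc n i = some u → nodeAt cyc n (i + k) = some w →
    (hostGraph cyc n).edist u w ≤ (k : ℕ∞) := by
  induction k with
  | zero =>
    intro i u w hi hj
    simp only [Nat.cast_zero, add_zero] at hj
    rw [hi] at hj
    simp [Option.some.inj hj]
  | succ k ih =>
    intro i u w hi hj
    have hk : (nodeAt cyc n (i + k)).isSome :=
      nodeAt_isSome_between (i := i) (j := i + (k + 1 : ℕ)) (by simp [hi]) (by rw [hj]; rfl)
        (by omega) (by push_cast; omega)
    obtain ⟨x, hx⟩ := Option.isSome_iff_exists.1 hk
    have h1 := ih hi hx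
    have h2 : (hostGraph cyc n).edist x w ≤ 1 := by
      rw [SimpleGraph.edist_le_one_iff_adj_or_eq]
      refine adj_or_eq_of_nodeAt hx ?_
      rw [← hj]
      push_cast
      ring_nf
    refine (SimpleGraph.edist_triangle (v := x)).trans ?_
    push_cast
    exact add_le_add h1 h2

/-- Walks lift to the integer line as in a covering: each edge moves the position by one to the left
or to the right. -/
theorem exists_nodeAt_of_walk {cyc : Bool} {n : ℕ} {u w : Fin n}
    (p : (hostGraph cyc n).Walk u w) : ∀ {i : ℤ}, nodeAt cyc n i = some u →
      ∃ k : ℤ, |k| ≤ p.length ∧ nodeAt cyc n (i + k) = some w := by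
  induction p with
  | nil => exact fun {i} hi => ⟨0, by simp, by simpa using hi⟩
  | cons h p ih =>
    intro i hi
    rcases nodeAt_add_of_adj hi h with h' | h'
    · obtain ⟨k, hk, hk'⟩ := ih h'
      refine ⟨1 + k, ?_, by rw [← hk']; ring_nf⟩
      simp only [SimpleGraph.Walk.length_cons]
      push_cast
      rw [abs_le] at *
      omega
    · obtain ⟨k, hk, hk'⟩ := ih h'
      refine ⟨-1 + k, ?_, by rw [← hk']; ring_nf⟩
      simp only [SimpleGraph.Walk.length_cons]
      push_cast
      rw [abs_le] at *
      omega

theorem mem_nbhd_hostGraph {cyc : Bool} {n t : ℕ} {i : ℤ} {u w : Fin n}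
    (hi : nodeAt cyc n i = some u) :
    w ∈ nbhd (hostGraph cyc n) t u ↔ ∃ k : ℤ, |k| ≤ t ∧ nodeAt cyc n (i + k) = some w := by
  constructor
  · intro h
    have h' : (hostGraph cyc n).edist u w ≤ (t : ℕ∞) := h
    obtain ⟨p, hp⟩ := SimpleGraph.exists_walk_of_edist_ne_top
      (ne_top_of_le_ne_top (ENat.natCast_ne_top t) h')
    obtain ⟨k, hk, hk'⟩ := exists_nodeAt_of_walk p hi
    refine ⟨k, hk.trans ?_, hk'⟩
    rw [← hp] at h'
    exact_mod_cast h'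
  · rintro ⟨k, hk, hk'⟩
    change (hostGraph cyc n).edist u w ≤ (t : ℕ∞)
    have hle : ((k.natAbs : ℕ) : ℕ∞) ≤ t := by
      have : (k.natAbs : ℤ) ≤ t := by rwa [Int.natCast_natAbs]
      exact_mod_cast this
    refine le_trans ?_ hle
    rcases le_total 0 k with h | h
    · apply edist_le_of_nodeAt k.natAbs hi
      rw [Int.natCast_natAbs, abs_of_nonneg h, hk']
    · rw [SimpleGraph.edist_comm]
      apply edist_le_of_nodeAt k.natAbs hk'
      rw [Int.natCast_natAbs, abs_of_nonpos h, ← hi]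
      ring_nf

/-! ## Views along the integer line -/

/-- The labeling of the integer line obtained by unrolling a labeled cycle or path. -/
def hostLine {α : Type*} (cyc : Bool) {n : ℕ} (l : Fin n → α) (i : ℤ) : Option α :=
  (nodeAt cyc n i).map l

theorem hostLine_eq_some {α : Type*} {cyc : Bool} {n : ℕ} {l : Fin n → α} {i : ℤ} {p : α} :
    hostLine cyc l i = some p ↔ ∃ u, nodeAt cyc n i = some u ∧ l u = p := by
  simp [hostLine]

theorem hostLine_isSome {α : Type*} {cyc : Bool} {n : ℕ} {l : Fin n → α} {i : ℤ} :
    (hostLine cyc l i).isSome = (nodeAt cyc n i).isSome := by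
  simp [hostLine]

/-- `e` describes the node at offset `k` from position `i` in the radius-`t` window around `i`. -/
def IsEntry {s : ℕ} (x : ℤ → Option (ℕ × Fin s)) (t : ℕ) (i k : ℤ) (p : ℕ × Fin s)
    (e : ℕ × ℕ × List ℕ) : Prop :=
  e.1 = p.1 ∧ e.2.1 = p.2 ∧ e.2.2.Pairwise (· < ·) ∧
    ∀ a, a ∈ e.2.2 ↔ ∃ k' : ℤ, |k'| ≤ t ∧ |k - k'| = 1 ∧ ∃ p', x (i + k') = some p' ∧ a = p'.1

/-- `w` is the view of the node at position `i` of a labeled line. -/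
def IsLineView {s : ℕ} (n : ℕ) (x : ℤ → Option (ℕ × Fin s)) (t : ℕ) (i : ℤ) (w : View) : Prop :=
  w.1 = n ∧ (∃ p, x i = some p ∧ w.2.1 = p.1) ∧ w.2.2.Pairwise (fun e e' => e.1 < e'.1) ∧
    (∀ k : ℤ, |k| ≤ t → ∀ p, x (i + k) = some p → ∃ e ∈ w.2.2, IsEntry x t i k p e) ∧
    ∀ e ∈ w.2.2, ∃ k : ℤ, |k| ≤ t ∧ ∃ p, x (i + k) = some p ∧ IsEntry x t i k p e

open Classical in
/-- The view of the node at position `i` of a labeled line. -/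
noncomputable def lineView {s : ℕ} (n : ℕ) (x : ℤ → Option (ℕ × Fin s)) (t : ℕ) (i : ℤ) : View :=
  Classical.epsilon (IsLineView n x t i)

theorem pairwise_eq_of_mem_iff {α : Type*} {R : α → α → Prop} (hR : ∀ a b, R a b → ¬ R b a)
    {l₁ l₂ : List α} (h₁ : l₁.Pairwise R) (h₂ : l₂.Pairwise R) (h : ∀ a, a ∈ l₁ ↔ a ∈ l₂) :
    l₁ = l₂ := by
  have hne : ∀ {a b}, R a b → a ≠ b := by
    rintro a b hab rfl
    exact hR _ _ hab hab
  have hp : l₁.Perm l₂ := (List.perm_ext_iff_of_nodup (h₁.imp hne) (h₂.imp hne)).2 h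
  exact hp.eq_of_pairwise (fun a b _ _ hab hba => absurd hba (hR _ _ hab)) h₁ h₂

theorem IsEntry.unique {s : ℕ} {x : ℤ → Option (ℕ × Fin s)} {t : ℕ} {i k : ℤ} {p : ℕ × Fin s}
    {e e' : ℕ × ℕ × List ℕ} (h : IsEntry x t i k p e) (h' : IsEntry x t i k p e') : e = e' := by
  refine Prod.ext (h.1.trans h'.1.symm) (Prod.ext (h.2.1.trans h'.2.1.symm) ?_)
  exact pairwise_eq_of_mem_iff (fun a b => lt_asymm) h.2.2.1 h'.2.2.1
    fun a => (h.2.2.2 a).trans (h'.2.2.2 a).symm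

/-- Sorting by identifiers leaves no freedom, since a strictly sorted list is determined by its
members. This is what makes `lineView`, defined by choice, meaningful. -/
theorem IsLineView.unique {s n : ℕ} {x : ℤ → Option (ℕ × Fin s)} {t : ℕ} {i : ℤ} {w w' : View}
    (h : IsLineView n x t i w) (h' : IsLineView n x t i w') : w = w' := by
  refine Prod.ext (h.1.trans h'.1.symm) (Prod.ext ?_ ?_)
  · obtain ⟨p, hp, hw⟩ := h.2.1
    obtain ⟨p', hp', hw'⟩ := h'.2.1
    rw [hp] at hp'
    rw [hw, hw', Option.some.inj hp']
  · refine pairwise_eq_of_mem_iff (fun a b => lt_asymm) h.2.2.1 h'.2.2.1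
      fun e => ⟨fun he => ?_, fun he => ?_⟩
    · obtain ⟨k, hk, p, hp, hd⟩ := h.2.2.2.2 e he
      obtain ⟨e', he', hd'⟩ := h'.2.2.2.1 k hk p hp
      rwa [hd.unique hd']
    · obtain ⟨k, hk, p, hp, hd⟩ := h'.2.2.2.2 e he
      obtain ⟨e', he', hd'⟩ := h.2.2.2.1 k hk p hp
      rwa [hd.unique hd']

theorem IsLineView.lineView_eq {s n : ℕ} {x : ℤ → Option (ℕ × Fin s)} {t : ℕ} {i : ℤ} {w : View}
    (h : IsLineView n x t i w) : lineView n x t i = w :=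
  IsLineView.unique (Classical.epsilon_spec (p := IsLineView n x t i) ⟨w, h⟩) h

/-- The lines `x` around `i` and `y` around `j` agree up to distance `R`, where `y` is read
backwards if `ε = -1`. -/
def Agree {α : Type*} (R : ℕ) (x : ℤ → α) (i : ℤ) (y : ℤ → α) (j ε : ℤ) : Prop :=
  (ε = 1 ∨ ε = -1) ∧ ∀ k : ℤ, |k| ≤ R → x (i + k) = y (j + ε * k)

theorem abs_sign_mul {ε : ℤ} (h : ε = 1 ∨ ε = -1) (k : ℤ) : |ε * k| = |k| := by
  rcases h with rfl | rfl <;> simp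

theorem int_sign_mul_self {ε : ℤ} (h : ε = 1 ∨ ε = -1) : ε * ε = 1 := by
  rcases h with rfl | rfl <;> simp

theorem Agree.symm {α : Type*} {R : ℕ} {x y : ℤ → α} {i j ε : ℤ} (h : Agree R x i y j ε) :
    Agree R y j x i ε := by
  refine ⟨h.1, fun k hk => ?_⟩
  rw [h.2 (ε * k) (by rwa [abs_sign_mul h.1]), ← mul_assoc, int_sign_mul_self h.1, one_mul]

theorem Agree.shift {α : Type*} {R R' : ℕ} {x y : ℤ → α} {i j ε : ℤ} (h : Agree R x i y j ε)
    {k : ℤ} (hk : |k| + R' ≤ R) : Agree R' x (i + k) y (j + ε * k) ε := by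
  refine ⟨h.1, fun m hm => ?_⟩
  have := h.2 (k + m) ((abs_add_le k m).trans (by linarith))
  rw [add_assoc, this]
  ring_nf

theorem Agree.mono {α : Type*} {R R' : ℕ} {x y : ℤ → α} {i j ε : ℤ} (h : Agree R x i y j ε)
    (hR : R' ≤ R) : Agree R' x i y j ε :=
  ⟨h.1, fun k hk => h.2 k (hk.trans (by exact_mod_cast hR))⟩

theorem Agree.center {α : Type*} {R : ℕ} {x y : ℤ → α} {i j ε : ℤ} (h : Agree R x i y j ε) :
    x i = y j := by
  simpa using h.2 0 (by simp)

theorem Agree.isEntry {s : ℕ} {x y : ℤ → Option (ℕ × Fin s)} {t : ℕ} {i j ε : ℤ}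
    (h : Agree t x i y j ε) {k : ℤ} {p : ℕ × Fin s} {e : ℕ × ℕ × List ℕ}
    (he : IsEntry x t i k p e) : IsEntry y t j (ε * k) p e := by
  refine ⟨he.1, he.2.1, he.2.2.1, fun a => (he.2.2.2 a).trans ⟨?_, ?_⟩⟩
  · rintro ⟨k', hk', hkk, p', hp', ha⟩
    refine ⟨ε * k', by rwa [abs_sign_mul h.1], by rw [← mul_sub, abs_sign_mul h.1, hkk], p', ?_, ha⟩
    rw [← h.2 k' hk', hp']
  · rintro ⟨k', hk', hkk, p', hp', ha⟩
    refine ⟨ε * k', by rwa [abs_sign_mul h.1], ?_, p', ?_, ha⟩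
    · rw [← abs_sign_mul h.1, mul_sub, ← mul_assoc, int_sign_mul_self h.1, one_mul, hkk]
    · rw [← hp', h.symm.2 k' hk']

theorem Agree.isLineView {s n : ℕ} {x y : ℤ → Option (ℕ × Fin s)} {t : ℕ} {i j ε : ℤ}
    (h : Agree t x i y j ε) {w : View} (hw : IsLineView n x t i w) : IsLineView n y t j w := by
  obtain ⟨h1, ⟨p, hp, h2⟩, h3, h4, h5⟩ := hw
  refine ⟨h1, ⟨p, by rw [← h.center, hp], h2⟩, h3, fun k hk p hp => ?_, fun e he => ?_⟩
  · obtain ⟨e, he, hd⟩ := h4 (ε * k) (by rwa [abs_sign_mul h.1]) p (by rw [← hp, h.symm.2 k hk])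
    refine ⟨e, he, ?_⟩
    have := h.isEntry hd
    rwa [← mul_assoc, int_sign_mul_self h.1, one_mul] at this
  · obtain ⟨k, hk, p, hp, hd⟩ := h5 e he
    exact ⟨ε * k, by rwa [abs_sign_mul h.1], p, by rw [← hp, h.2 k hk], h.isEntry hd⟩

/-- A view mentions offsets only through absolute values, so a reflection of the line is invisible.
The defining predicates are equal, hence the choices agree even where no view exists. -/
theorem Agree.lineView_eq {s n : ℕ} {x y : ℤ → Option (ℕ × Fin s)} {t : ℕ} {i j ε : ℤ}
    (h : Agree t x i y j ε) : lineView n x t i = lineView n y t j := by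
  unfold lineView
  congr 1
  funext w
  exact propext ⟨h.isLineView, h.symm.isLineView⟩

theorem mem_sortById {n : ℕ} {ids : Fin n → ℕ} {S : Set (Fin n)} {u : Fin n} :
    u ∈ sortById ids S ↔ u ∈ S := by
  simp [sortById]

theorem pairwise_sortById {n : ℕ} {ids : Fin n → ℕ} (hids : Function.Injective ids)
    (S : Set (Fin n)) : (sortById ids S).Pairwise (fun u w => ids u < ids w) := by
  classical
  have h1 : (sortById ids S).Pairwise (fun u w => decide (ids u ≤ ids w) = true) := by
    apply List.pairwise_mergeSort
    · intro a b c
      simp only [decide_eq_true_eq]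
      exact le_trans
    · intro a b
      simp only [Bool.or_eq_true, decide_eq_true_eq]
      exact le_total _ _
  have h2 : (sortById ids S).Nodup := by
    unfold sortById
    rw [(List.mergeSort_perm _ _).nodup_iff]
    exact (List.nodup_finRange n).filter _
  refine (h1.and h2).imp ?_
  rintro a b ⟨h, h'⟩
  simp only [decide_eq_true_eq] at h
  exact lt_of_le_of_ne h fun he => h' (hids he)

/-- Offsets in the window differ by at most `2 * t`. With `2 * t + 2 ≤ n` the neighborhood does not
close up around the cycle, and its edges are exactly the pairs of consecutive offsets. -/
theorem isLineView_view {cyc : Bool} {s n t : ℕ} {ids : Fin n → ℕ} {inp : Fin n → Fin s}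
    (hids : Function.Injective ids) (hn : 2 * t + 2 ≤ n) {i : ℤ} {v : Fin n}
    (hi : nodeAt cyc n i = some v) :
    IsLineView n (hostLine cyc fun u => (ids u, inp u)) t i
      (view (hostGraph cyc n) ids (fun u => (inp u : ℕ)) t v) := by
  have hentry : ∀ k : ℤ, |k| ≤ t → ∀ u, nodeAt cyc n (i + k) = some u →
      IsEntry (hostLine cyc fun u => (ids u, inp u)) t i k (ids u, inp u) (ids u, (inp u : ℕ),
        (sortById ids {w | w ∈ nbhd (hostGraph cyc n) t v ∧ (hostGraph cyc n).Adj u w}).map ids) := by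
    intro k hk u hu
    refine ⟨rfl, rfl, List.pairwise_map.2 (pairwise_sortById hids _), fun a => ?_⟩
    simp only [List.mem_map, mem_sortById, Set.mem_ofPred_eq]
    constructor
    · rintro ⟨w, ⟨hw, hadj⟩, rfl⟩
      obtain ⟨k', hk', hw'⟩ := (mem_nbhd_hostGraph hi).1 hw
      have hkk : |k - k'| ≤ |k| + |k'| := abs_sub k k'
      refine ⟨k', hk', ?_, (ids w, inp w), by rw [hostLine, hw']; rfl, rfl⟩
      have := (adj_iff_of_nodeAt hu hw' (by rw [add_sub_add_left_eq_sub]; linarith)).1 hadj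
      rwa [add_sub_add_left_eq_sub] at this
    · rintro ⟨k', hk', hkk, p', hp', rfl⟩
      obtain ⟨w, hw, rfl⟩ := hostLine_eq_some.1 hp'
      refine ⟨w, ⟨(mem_nbhd_hostGraph hi).2 ⟨k', hk', hw⟩, ?_⟩, rfl⟩
      rw [adj_iff_of_nodeAt hu hw, add_sub_add_left_eq_sub, hkk]
      rw [add_sub_add_left_eq_sub, hkk]
      have := (abs_nonneg k).trans hk
      have : k ≠ k' := by rintro rfl; simp at hkk
      -- It remains to see `2 < n`; two different offsets in the window force `t ≥ 1`, hence `n ≥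
      -- 4`.
      have : (0 : ℤ) < t := by
        by_contra h0
        have h1 := abs_nonpos_iff.1 (hk.trans (by omega))
        have h2 := abs_nonpos_iff.1 (hk'.trans (by omega))
        omega
      omega
  refine ⟨rfl, ⟨(ids v, inp v), by rw [hostLine, hi]; rfl, rfl⟩, ?_, ?_, ?_⟩
  · exact List.pairwise_map.2 (pairwise_sortById hids _)
  · intro k hk p hp
    obtain ⟨u, hu, rfl⟩ := hostLine_eq_some.1 hp
    refine ⟨_, List.mem_map.2 ⟨u, mem_sortById.2 ((mem_nbhd_hostGraph hi).2 ⟨k, hk, hu⟩), rfl⟩,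
      hentry k hk u hu⟩
  · intro e he
    obtain ⟨u, hu, rfl⟩ := List.mem_map.1 he
    obtain ⟨k, hk, hu'⟩ := (mem_nbhd_hostGraph hi).1 (mem_sortById.1 hu)
    exact ⟨k, hk, (ids u, inp u), by rw [hostLine, hu']; rfl, hentry k hk u hu'⟩

theorem view_eq_lineView {cyc : Bool} {s n t : ℕ} {ids : Fin n → ℕ} {inp : Fin n → Fin s}
    (hids : Function.Injective ids) (hn : 2 * t + 2 ≤ n) {i : ℤ} {v : Fin n}
    (hi : nodeAt cyc n i = some v) :
    view (hostGraph cyc n) ids (fun u => (inp u : ℕ)) t v =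
      lineView n (hostLine cyc fun u => (ids u, inp u)) t i :=
  (isLineView_view hids hn hi).lineView_eq.symm

/-! ## Recovering the window from the view -/

/-- A view names the neighbors of a node without telling left from right, so neighbors can only be
compared as unordered pairs. -/
theorem Option.pair_eq_or_swap {β : Type*} {a b a' b' : Option β}
    (h : ∀ q, (a = some q ∨ b = some q) ↔ (a' = some q ∨ b' = some q))
    (hab : ∀ q, a = some q → b ≠ some q) (hab' : ∀ q, a' = some q → b' ≠ some q) :
    (a = a' ∧ b = b') ∨ (a = b' ∧ b = a') := by
  have ha := fun q => (h q).1 ∘ Or.inl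
  have hb := fun q => (h q).1 ∘ Or.inr
  have ha' := fun q => (h q).2 ∘ Or.inl
  have hb' := fun q => (h q).2 ∘ Or.inr
  clear h
  cases a <;> cases b <;> cases a' <;> cases b' <;> simp_all <;> grind

/-- The view lists the label and the neighbors of every node that it contains. Matching the two
neighbors of the center fixes a direction, and from there the window is traced outwards: at each
node the neighbor on the inner side is already matched, so the outer ones match too. -/
theorem exists_agree_of_isLineView {s n t : ℕ} {x y : ℤ → Option (ℕ × Fin s)} {i j : ℤ} {w : View}
    (hx : IsLineView n x t i w) (hy : IsLineView n y t j w)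
    (hxid : ∀ k k' : ℤ, |k| ≤ t → |k'| ≤ t → ∀ p p', x (i + k) = some p → x (i + k') = some p' →
      p.1 = p'.1 → k = k')
    (hyid : ∀ k k' : ℤ, |k| ≤ t → |k'| ≤ t → ∀ p p', y (j + k) = some p → y (j + k') = some p' →
      p.1 = p'.1 → k = k')
    (hxs : ∀ a b c : ℤ, a ≤ b → b ≤ c → (x a).isSome → (x c).isSome → (x b).isSome)
    (hys : ∀ a b c : ℤ, a ≤ b → b ≤ c → (y a).isSome → (y c).isSome → (y b).isSome) :
    ∃ ε, Agree t x i y j ε := by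
  have key : ∀ k k' : ℤ, |k| ≤ t → |k'| ≤ t → ∀ p p', x (i + k) = some p → y (j + k') = some p' →
      p.1 = p'.1 → ∃ e, IsEntry x t i k p e ∧ IsEntry y t j k' p' e := by
    intro k k' hk hk' p p' hp hp' hpp
    obtain ⟨e, he, hd⟩ := hx.2.2.2.1 k hk p hp
    obtain ⟨k'', hk'', p'', hp'', hd'⟩ := hy.2.2.2.2 e he
    have : k'' = k' := hyid k'' k' hk'' hk' _ _ hp'' hp' (by rw [← hd'.1, hd.1, hpp])
    subst this
    rw [hp'] at hp''
    cases Option.some.inj hp''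
    exact ⟨e, hd, hd'⟩
  have keq : ∀ k k' : ℤ, |k| ≤ t → |k'| ≤ t → ∀ p p', x (i + k) = some p → y (j + k') = some p' →
      p.1 = p'.1 → p = p' := by
    intro k k' hk hk' p p' hp hp' hpp
    obtain ⟨e, h1, h2⟩ := key k k' hk hk' p p' hp hp' hpp
    exact Prod.ext hpp (Fin.ext (by rw [← h1.2.1, h2.2.1]))
  have nb : ∀ k k' : ℤ, |k| + 1 ≤ t → |k'| + 1 ≤ t → ∀ p, x (i + k) = some p →
      y (j + k') = some p → ∀ q, (x (i + k + 1) = some q ∨ x (i + k - 1) = some q) ↔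
        (y (j + k' + 1) = some q ∨ y (j + k' - 1) = some q) := by
    intro k k' hk hk' p hp hp' q
    have hk1 := abs_le.1 (by linarith : |k| ≤ t - 1)
    have hk1' := abs_le.1 (by linarith : |k'| ≤ t - 1)
    obtain ⟨e, h1, h2⟩ := key k k' (by linarith) (by linarith) p p hp hp' rfl
    constructor
    · intro h
      obtain ⟨d, hd, hdk, hdq⟩ : ∃ d : ℤ, |d| ≤ t ∧ |k - d| = 1 ∧ x (i + d) = some q := by
        rcases h with h | h
        · exact ⟨k + 1, abs_le.2 (by omega), by norm_num, by rw [← h]; ring_nf⟩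
        · exact ⟨k - 1, abs_le.2 (by omega), by norm_num, by rw [← h]; ring_nf⟩
      obtain ⟨d', hd', hdk', q', hq', hqq⟩ :=
        (h2.2.2.2 q.1).1 ((h1.2.2.2 q.1).2 ⟨d, hd, hdk, q, hdq, rfl⟩)
      cases keq d d' hd hd' _ _ hdq hq' hqq
      rcases (abs_eq (by norm_num)).1 hdk' with hh | hh
      · right; rw [← hq']; congr 1; omega
      · left; rw [← hq']; congr 1; omega
    · intro h
      obtain ⟨d, hd, hdk, hdq⟩ : ∃ d : ℤ, |d| ≤ t ∧ |k' - d| = 1 ∧ y (j + d) = some q := by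
        rcases h with h | h
        · exact ⟨k' + 1, abs_le.2 (by omega), by norm_num, by rw [← h]; ring_nf⟩
        · exact ⟨k' - 1, abs_le.2 (by omega), by norm_num, by rw [← h]; ring_nf⟩
      obtain ⟨d', hd', hdk', q', hq', hqq⟩ :=
        (h1.2.2.2 q.1).1 ((h2.2.2.2 q.1).2 ⟨d, hd, hdk, q, hdq, rfl⟩)
      cases keq d' d hd' hd _ _ hq' hdq hqq.symm
      rcases (abs_eq (by norm_num)).1 hdk' with hh | hh
      · right; rw [← hq']; congr 1; omega
      · left; rw [← hq']; congr 1; omega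
  have swap : ∀ k k' : ℤ, |k| + 1 ≤ t → |k'| + 1 ≤ t → ∀ p, x (i + k) = some p →
      y (j + k') = some p →
      (x (i + k + 1) = y (j + k' + 1) ∧ x (i + k - 1) = y (j + k' - 1)) ∨
        (x (i + k + 1) = y (j + k' - 1) ∧ x (i + k - 1) = y (j + k' + 1)) := by
    intro k k' hk hk' p hp hp'
    have hk1 := abs_le.1 (by linarith : |k| ≤ t - 1)
    have hk1' := abs_le.1 (by linarith : |k'| ≤ t - 1)
    refine Option.pair_eq_or_swap (nb k k' hk hk' p hp hp') ?_ ?_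
    · intro q h1 h2
      have := hxid (k + 1) (k - 1) (abs_le.2 (by omega)) (abs_le.2 (by omega)) q q
        (by rw [← h1]; ring_nf) (by rw [← h2]; ring_nf) rfl
      omega
    · intro q h1 h2
      have := hyid (k' + 1) (k' - 1) (abs_le.2 (by omega)) (abs_le.2 (by omega)) q q
        (by rw [← h1]; ring_nf) (by rw [← h2]; ring_nf) rfl
      omega
  obtain ⟨p, hp, hwp⟩ := hx.2.1
  obtain ⟨p', hp', hwp'⟩ := hy.2.1
  have hpp : p = p' := keq 0 0 (by simp) (by simp) p p' (by simpa using hp) (by simpa using hp')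
    (by rw [← hwp, hwp'])
  subst hpp
  rcases Nat.eq_zero_or_pos t with rfl | ht
  · refine ⟨1, Or.inl rfl, fun k hk => ?_⟩
    have : k = 0 := abs_nonpos_iff.1 (by simpa using hk)
    subst this
    simp [hp, hp']
  -- The unordered pair of neighbors of the center decides between reading forwards and reading
  -- backwards.
  obtain ⟨ε, hε, h1⟩ : ∃ ε : ℤ, (ε = 1 ∨ ε = -1) ∧ Agree 1 x i y j ε := by
    have small : ∀ k : ℤ, |k| ≤ (1 : ℕ) → k = 0 ∨ k = 1 ∨ k = -1 := by
      intro k hk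
      rw [abs_le] at hk
      omega
    rcases swap 0 0 (by simp; omega) (by simp; omega) p (by simpa using hp)
      (by simpa using hp') with ⟨h, h'⟩ | ⟨h, h'⟩
    · refine ⟨1, Or.inl rfl, Or.inl rfl, fun k hk => ?_⟩
      rcases small k hk with rfl | rfl | rfl
      · simp [hp, hp']
      · simpa using h
      · simpa [sub_eq_add_neg] using h'
    · refine ⟨-1, Or.inr rfl, Or.inr rfl, fun k hk => ?_⟩
      rcases small k hk with rfl | rfl | rfl
      · simp [hp, hp']
      · simpa [sub_eq_add_neg] using h
      · simpa [sub_eq_add_neg] using h'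
  refine ⟨ε, ?_⟩
  have step : ∀ m : ℕ, 1 ≤ m → m ≤ t → Agree m x i y j ε := by
    intro m hm
    induction m, hm using Nat.le_induction with
    | base => exact fun _ => h1
    | succ m hm ih =>
      intro hmt
      have ih := ih (by omega)
      have ext : ∀ δ : ℤ, (δ = 1 ∨ δ = -1) → x (i + δ * (m + 1)) = y (j + ε * (δ * (m + 1))) := by
        intro δ hδ
        have hm0 : |δ * (m : ℤ)| = m := by rw [abs_sign_mul hδ]; simp
        have hm1 : |ε * (δ * (m : ℤ))| = m := by rw [abs_sign_mul hε, hm0]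
        have hprev := ih.2 (δ * m) (by rw [hm0])
        have hprev' := ih.2 (δ * (m - 1)) (by
          rw [abs_sign_mul hδ, abs_of_nonneg (by omega)]
          omega)
        -- If both lines have ended at distance `m`, they stay empty further out because the
        -- nonempty places form an interval. Otherwise `hno` excludes that the outer neighbor is the
        -- inner one, and `swap` determines it.
        cases hcase : x (i + δ * m) with
        | none =>
          rw [hcase] at hprev
          have e1 : x (i + δ * (m + 1)) = none := by
            by_contra hne
            have hs : (x (i + δ * (m + 1))).isSome := Option.isSome_iff_ne_none.2 hne
            have : (x (i + δ * m)).isSome := by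
              rcases hδ with rfl | rfl
              · exact hxs i _ _ (by omega) (by omega) (by simp [hp]) hs
              · exact hxs _ _ i (by omega) (by omega) hs (by simp [hp])
            simp [hcase] at this
          have e2 : y (j + ε * (δ * (m + 1))) = none := by
            by_contra hne
            have hs : (y (j + ε * (δ * (m + 1)))).isSome := Option.isSome_iff_ne_none.2 hne
            have : (y (j + ε * (δ * m))).isSome := by
              rcases hδ with rfl | rfl <;> rcases hε with rfl | rfl
              · exact hys j _ _ (by omega) (by omega) (by simp [hp']) hs
              · exact hys _ _ j (by omega) (by omega) hs (by simp [hp'])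
              · exact hys _ _ j (by omega) (by omega) hs (by simp [hp'])
              · exact hys j _ _ (by omega) (by omega) (by simp [hp']) hs
            simp [← hprev] at this
          rw [e1, e2]
        | some q =>
          rw [hcase] at hprev
          have hsw := swap (δ * m) (ε * (δ * m)) (by rw [hm0]; exact_mod_cast hmt)
            (by rw [hm1]; exact_mod_cast hmt) q hcase hprev.symm
          have hno : ∀ r, x (i + δ * (m + 1)) = some r → x (i + δ * (m - 1)) ≠ some r := by
            intro r h1 h2
            have := hxid (δ * (m + 1)) (δ * (m - 1))
              (by rw [abs_sign_mul hδ, abs_of_nonneg (by omega)]; exact_mod_cast hmt)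
              (by rw [abs_sign_mul hδ, abs_of_nonneg (by omega)]; omega) r r h1 h2 rfl
            rcases hδ with rfl | rfl <;> omega
          have fin : ∀ a b c d : Option (ℕ × Fin s), b = d → (∀ r, a = some r → b ≠ some r) →
              (a = c ∧ b = d ∨ a = d ∧ b = c) → a = c := by
            rintro a b c d h1 h2 (⟨h3, -⟩ | ⟨h3, h4⟩)
            · exact h3
            · rw [h3, ← h1, h4]
          refine fin _ _ _ _ hprev' hno ?_
          rcases hδ with rfl | rfl <;> rcases hε with rfl | rfl <;>
            (ring_nf at hsw ⊢; tauto)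
      refine ⟨hε, fun k hk => ?_⟩
      rcases lt_or_ge |k| (m + 1 : ℤ) with h | h
      · exact ih.2 k (by omega)
      · push_cast at hk
        rcases (abs_eq (by omega)).1 (le_antisymm hk h) with rfl | rfl
        · simpa using ext 1 (Or.inl rfl)
        · simpa using ext (-1) (Or.inr rfl)
  exact step t ht le_rfl

/-! ## Local correctness in terms of windows -/

/-- The window of width `2 r + 1` around position `i` of a line. -/
def window {α : Type*} (r : ℕ) (z : ℤ → α) (i : ℤ) : Fin (2 * r + 1) → α :=
  fun k => z (i - r + (k : ℕ))

/-- The labeled path that fills the non-empty places of a window is isomorphic to an accepted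
graph, with the middle of the window as the center. -/
def LCL.Accepts (P : LCL) (q : Fin (2 * P.radius + 1) → Option (ℕ × ℕ)) : Prop :=
  ∃ H ∈ P.accepted, ∃ e : {k // (q k).isSome} ≃ Fin H.nodes.length,
    (∀ k, q k.1 = some (H.nodes.get (e k))) ∧
    (∀ k k', H.graph.Adj (e k) (e k') ↔
      (k.1 : ℕ) + 1 = (k'.1 : ℕ) ∨ (k'.1 : ℕ) + 1 = (k.1 : ℕ)) ∧
    ∀ k, (k.1 : ℕ) = P.radius → (e k : ℕ) = H.center

theorem exists_windowEquiv {cyc : Bool} {n r : ℕ} {α : Type*} (l : Fin n → α) (hn : 2 * r + 2 ≤ n)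
    (v : Fin n) : ∃ β : {k // (window r (hostLine cyc l) v k).isSome} ≃ nbhd (hostGraph cyc n) r v,
      ∀ k, nodeAt cyc n ((v : ℕ) - r + (k.1 : ℕ)) = some (β k : Fin n) := by
  have hs : ∀ k : {k // (window r (hostLine cyc l) v k).isSome},
      (nodeAt cyc n ((v : ℕ) - r + (k.1 : ℕ))).isSome := by
    rintro ⟨k, hk⟩
    rwa [window, hostLine_isSome] at hk
  have hmem : ∀ k, (nodeAt cyc n ((v : ℕ) - r + (k.1 : ℕ))).get (hs k) ∈
      nbhd (hostGraph cyc n) r v := by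
    intro k
    refine (mem_nbhd_hostGraph (nodeAt_self v)).2 ⟨-r + (k.1 : ℕ), ?_, ?_⟩
    · have := k.1.2
      rw [abs_le]
      omega
    · rw [Option.some_get, ← add_assoc, ← sub_eq_add_neg]
  refine ⟨Equiv.ofBijective (fun k => ⟨_, hmem k⟩) ⟨?_, ?_⟩,
    fun k => (Option.some_get (hs k)).symm⟩
  · rintro k k' h
    have h1 := congrArg Subtype.val h
    have h2 : nodeAt cyc n ((v : ℕ) - r + (k.1 : ℕ)) =
        nodeAt cyc n ((v : ℕ) - r + (k'.1 : ℕ)) := by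
      rw [← Option.some_get (hs k), ← Option.some_get (hs k')]
      exact congrArg some h1
    have h3 := eq_of_nodeAt_eq (Option.some_get (hs k)).symm
      (h2.symm.trans (Option.some_get (hs k)).symm) (by
        have := k.1.2
        have := k'.1.2
        rw [abs_lt]
        omega)
    exact Subtype.ext (Fin.ext (by omega))
  · rintro ⟨u, hu⟩
    obtain ⟨k, hk, hku⟩ := (mem_nbhd_hostGraph (nodeAt_self v)).1 hu
    rw [abs_le] at hk
    have e : ((v : ℕ) : ℤ) - r + ((k + r).toNat : ℕ) = (v : ℕ) + k := by
      rw [Int.toNat_of_nonneg (by omega)]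
      ring
    refine ⟨⟨⟨(k + r).toNat, by omega⟩, ?_⟩, Subtype.ext ?_⟩
    · rw [window, hostLine_isSome, e, hku]
      rfl
    · simp only [e, hku, Option.get_some]

/-- The window is too short to wrap around the cycle, so the ball around `v` is the path on the
nonempty places. Isomorphisms are transported along this bijection. -/
theorem exists_matches_iff_accepts {cyc : Bool} {n : ℕ} {P : LCL} (hn : 2 * P.radius + 2 ≤ n)
    (inp out : Fin n → ℕ) (v : Fin n) :
    (∃ H ∈ P.accepted, H.Matches (hostGraph cyc n) inp out P.radius v) ↔
      P.Accepts (window P.radius (hostLine cyc fun u => (inp u, out u)) v) := by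
  obtain ⟨β, hβ⟩ := exists_windowEquiv (cyc := cyc) (fun u => (inp u, out u)) hn v
  have hlab : ∀ k, window P.radius (hostLine cyc fun u => (inp u, out u)) v k.1 =
      some (inp (β k), out (β k)) := by
    intro k
    rw [window, hostLine, hβ]
    rfl
  have hadj : ∀ k k', (hostGraph cyc n).Adj (β k) (β k') ↔
      (k.1 : ℕ) + 1 = (k'.1 : ℕ) ∨ (k'.1 : ℕ) + 1 = (k.1 : ℕ) := by
    intro k k'
    have := k.1.2
    have := k'.1.2
    rw [adj_iff_of_nodeAt (hβ k) (hβ k'), add_sub_add_left_eq_sub, abs_eq (by norm_num)]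
    · omega
    · rw [add_sub_add_left_eq_sub, ← lt_sub_iff_add_lt, abs_lt]
      omega
  have hcen : ∀ k, (k.1 : ℕ) = P.radius ↔ (β k : Fin n) = v := by
    intro k
    have hk := hβ k
    have := k.1.2
    constructor
    · intro h
      rw [h, sub_add_cancel, nodeAt_self] at hk
      exact (Option.some.inj hk).symm
    · intro h
      rw [h] at hk
      have := eq_of_nodeAt_eq hk (nodeAt_self v) (by rw [abs_lt]; omega)
      omega
  constructor
  · rintro ⟨H, hH, e, h1, h2⟩
    refine ⟨H, hH, β.trans e.toEquiv, fun k => ?_, fun k k' => ?_, fun k hk => ?_⟩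
    · rw [hlab]
      exact congrArg some (h1 (β k)).symm
    · rw [← hadj]
      exact e.map_adj_iff
    · exact h2 _ ((hcen k).1 hk)
  · rintro ⟨H, hH, e, h1, h2, h3⟩
    refine ⟨H, hH, ⟨β.symm.trans e, ?_⟩, fun u => ?_, fun u hu => ?_⟩
    · intro a b
      have := h2 (β.symm a) (β.symm b)
      rw [← hadj, β.apply_symm_apply, β.apply_symm_apply] at this
      exact this
    · have := h1 (β.symm u)
      rw [hlab, β.apply_symm_apply] at this
      exact (Option.some.inj this).symm
    · refine h3 (β.symm u) ((hcen _).2 ?_)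
      rw [β.apply_symm_apply, hu]

/-- Accepted graphs are undirected, and a reflection fixes the middle of the window. -/
theorem LCL.Accepts.rev {P : LCL} {q : Fin (2 * P.radius + 1) → Option (ℕ × ℕ)}
    (h : P.Accepts q) : P.Accepts (q ∘ Fin.rev) := by
  obtain ⟨H, hH, e, h1, h2, h3⟩ := h
  let β : {k // ((q ∘ Fin.rev) k).isSome} ≃ {k // (q k).isSome} :=
    Fin.revPerm.subtypeEquiv fun k => Iff.rfl
  have hβ : ∀ k, ((β k).1 : ℕ) = 2 * P.radius - (k.1 : ℕ) := by
    intro k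
    change ((Fin.rev k.1 : Fin (2 * P.radius + 1)) : ℕ) = _
    rw [Fin.val_rev]
    omega
  refine ⟨H, hH, β.trans e, fun k => h1 (β k), fun k k' => ?_, fun k hk => h3 (β k) ?_⟩
  · have := h2 (β k) (β k')
    rw [hβ, hβ] at this
    have h4 := k.1.2
    have h5 := k'.1.2
    refine this.trans ?_
    omega
  · rw [hβ]
    omega

/-! ## Transition relations -/

/-- `Chain N E v q q'`: there is a sequence of states from `q` to `q'`, with consecutive states
related by `E`, whose interior states satisfy the constraints `N` given by the letters of `v`. -/
def Chain {A Q : Type*} (N : A → Q → Prop) (E : Q → Q → Prop) : List A → Q → Q → Prop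
  | [], q, q' => E q q'
  | a :: v, q, q' => ∃ p, E q p ∧ N a p ∧ Chain N E v p q'

section Chain

variable {A Q : Type*} {N : A → Q → Prop} {E : Q → Q → Prop}

theorem chain_append_cons {v w : List A} {a : A} {q q' : Q} :
    Chain N E (v ++ a :: w) q q' ↔ ∃ p, Chain N E v q p ∧ N a p ∧ Chain N E w p q' := by
  induction v generalizing q with
  | nil => simp [Chain]
  | cons b v ih =>
    simp only [List.cons_append, Chain, ih]
    constructor
    · rintro ⟨p, h1, h2, p', h3, h4, h5⟩
      exact ⟨p', ⟨p, h1, h2, h3⟩, h4, h5⟩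
    · rintro ⟨p', ⟨p, h1, h2, h3⟩, h4, h5⟩
      exact ⟨p, h1, h2, p', h3, h4, h5⟩

/-- Together with the version for the other side: words with the same relation are interchangeable
inside any longer word, which is what pumping rests on. -/
theorem chain_append_congr_left {v v' : List A} (h : Chain N E v = Chain N E v') (w : List A) :
    Chain N E (v ++ w) = Chain N E (v' ++ w) := by
  cases w with
  | nil => simpa using h
  | cons a w =>
    funext q q'
    rw [chain_append_cons, chain_append_cons, h]

theorem chain_append_congr_right {v v' : List A} (h : Chain N E v = Chain N E v') (w : List A) :
    Chain N E (w ++ v) = Chain N E (w ++ v') := by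
  induction w with
  | nil => simpa using h
  | cons a w ih =>
    funext q q'
    simp only [List.cons_append, Chain, ih]

theorem chain_reverse {rev : Q → Q} (hN : ∀ a q, N a q → N a (rev q))
    (hE : ∀ q q', E q q' → E (rev q') (rev q)) {v : List A} :
    ∀ {q q' : Q}, Chain N E v q q' → Chain N E v.reverse (rev q') (rev q) := by
  induction v with
  | nil => exact fun h => hE _ _ h
  | cons a v ih =>
    rintro q q' ⟨p, h1, h2, h3⟩
    rw [List.reverse_cons, chain_append_cons]
    exact ⟨rev p, ih h3, hN _ _ h2, hE _ _ h1⟩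

/-- The right end of a block is pumped as a prefix of the reversed block; this turns the resulting
substitute around. -/
theorem chain_reverse_congr {rev : Q → Q} (hrev : ∀ q, rev (rev q) = q)
    (hN : ∀ a q, N a q → N a (rev q)) (hE : ∀ q q', E q q' → E (rev q') (rev q)) {v v' : List A}
    (h : Chain N E v = Chain N E v') : Chain N E v.reverse = Chain N E v'.reverse := by
  have key : ∀ {v v' : List A}, Chain N E v = Chain N E v' → ∀ q q',
      Chain N E v.reverse q q' → Chain N E v'.reverse q q' := by
    intro v v' h q q' hc
    have h1 := chain_reverse hN hE hc
    rw [List.reverse_reverse, h] at h1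
    have h2 := chain_reverse hN hE h1
    rwa [hrev, hrev] at h2
  funext q q'
  exact propext ⟨key h q q', key h.symm q q'⟩

theorem chain_of_sequence {v : List A} : ∀ {s : ℕ → Q}, (∀ k ≤ v.length, E (s k) (s (k + 1))) →
    (∀ k (h : k < v.length), N v[k] (s (k + 1))) → Chain N E v (s 0) (s (v.length + 1)) := by
  induction v with
  | nil => exact fun h _ => h 0 le_rfl
  | cons a v ih =>
    intro s h1 h2
    refine ⟨s 1, h1 0 (by simp), h2 0 (by simp), ?_⟩
    refine ih (s := fun k => s (k + 1)) (fun k hk => h1 (k + 1) (by simpa using hk)) ?_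
    intro k hk
    exact h2 (k + 1) (by simpa using hk)

theorem exists_sequence_of_chain {v : List A} : ∀ {q q' : Q}, Chain N E v q q' →
    ∃ s : ℕ → Q, s 0 = q ∧ s (v.length + 1) = q' ∧ (∀ k ≤ v.length, E (s k) (s (k + 1))) ∧
      ∀ k (h : k < v.length), N v[k] (s (k + 1)) := by
  induction v with
  | nil =>
    intro q q' h
    refine ⟨fun k => if k = 0 then q else q', rfl, rfl, fun k hk => ?_, by simp⟩
    obtain rfl : k = 0 := by simpa using hk
    exact h
  | cons a v ih =>
    rintro q q' ⟨p, h1, h2, h3⟩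
    obtain ⟨s, hs0, hs1, hs2, hs3⟩ := ih h3
    refine ⟨fun k => k.casesOn q s, rfl, hs1, fun k hk => ?_, fun k hk => ?_⟩
    · cases k with
      | zero => simpa [hs0] using h1
      | succ k => exact hs2 k (by simpa using hk)
    · cases k with
      | zero => simpa [hs0] using h2
      | succ k => exact hs3 k (by simpa using hk)

end Chain

/-! ## Pumping -/

/-- The words that occur as input labelings of a factor of a long cycle, or of a long path
extended by empty places `none` on both sides (where no factor meets both ends). -/
def Legal {α : Type*} (cyc : Bool) (l : List (Option α)) : Prop :=
  if cyc then ∀ a ∈ l, a.isSome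
  else l.Pairwise (fun a b => a.isSome → b.isSome) ∨ l.Pairwise (fun a b => b.isSome → a.isSome)

theorem pairwise_replace {α : Type*} {R : Bool → Bool → Prop} (hR : ∀ b, R b b)
    {l₁ y y' l₂ : List (Option α)} {b : Bool} (hy : ∀ a ∈ y, a.isSome = b) (hne : y ≠ [])
    (hy' : ∀ a ∈ y', a.isSome = b)
    (h : (l₁ ++ (y ++ l₂)).Pairwise fun a b => R a.isSome b.isSome) :
    (l₁ ++ (y' ++ l₂)).Pairwise fun a b => R a.isSome b.isSome := by
  obtain ⟨c, hc⟩ := List.exists_mem_of_ne_nil y hne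
  simp only [List.pairwise_append, List.mem_append] at h ⊢
  obtain ⟨h1, ⟨h2, h3, h4⟩, h5⟩ := h
  refine ⟨h1, ⟨?_, h3, fun a ha d hd => ?_⟩, fun a ha d hd => ?_⟩
  · exact List.pairwise_of_forall_mem_list fun a ha d hd => by rw [hy' a ha, hy' d hd]; exact hR b
  · have := h4 c hc d hd
    rwa [hy c hc, ← hy' a ha] at this
  · rcases hd with hd | hd
    · have := h5 a ha c (Or.inl hc)
      rwa [hy c hc, ← hy' d hd] at this
    · exact h5 a ha d (Or.inr hd)

/-- Legality sees only which places are empty, and it is a monotonicity condition, so the length of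
a constant stretch is immaterial. One letter of the nonempty `y` represents the stretch in all
comparisons with the rest. -/
theorem Legal.replace {α : Type*} {cyc : Bool} {l₁ y y' l₂ : List (Option α)} {b : Bool}
    (hy : ∀ a ∈ y, a.isSome = b) (hne : y ≠ []) (hy' : ∀ a ∈ y', a.isSome = b)
    (h : Legal cyc (l₁ ++ (y ++ l₂))) : Legal cyc (l₁ ++ (y' ++ l₂)) := by
  cases cyc with
  | true =>
    simp only [Legal, if_true, List.mem_append] at h ⊢
    obtain ⟨c, hc⟩ := List.exists_mem_of_ne_nil y hne
    have := h c (by tauto)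
    rintro a (ha | ha | ha)
    · exact h a (by tauto)
    · rw [hy' a ha, ← hy c hc, this]
    · exact h a (by tauto)
  | false =>
    simp only [Legal, Bool.false_eq_true, if_false] at h ⊢
    refine h.imp (fun h => ?_) fun h => ?_
    · exact pairwise_replace (R := fun a b => a → b) (fun _ => id) hy hne hy' h
    · exact pairwise_replace (R := fun a b => b → a) (fun _ => id) hy hne hy' h

theorem Legal.sublist {α : Type*} {cyc : Bool} {l l' : List (Option α)} (h : Legal cyc l)
    (hl : l'.Sublist l) : Legal cyc l' := by
  cases cyc with
  | true =>
    simp only [Legal, if_true] at h ⊢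
    exact fun a ha => h a (hl.subset ha)
  | false =>
    simp only [Legal, Bool.false_eq_true, if_false] at h ⊢
    exact h.imp (fun h => h.sublist hl) fun h => h.sublist hl

theorem Legal.reverse {α : Type*} {cyc : Bool} {l : List (Option α)} (h : Legal cyc l) :
    Legal cyc l.reverse := by
  cases cyc with
  | true =>
    simp only [Legal, if_true, List.mem_reverse] at h ⊢
    exact h
  | false =>
    simp only [Legal, Bool.false_eq_true, if_false, List.pairwise_reverse] at h ⊢
    exact h.symm

theorem Legal.isSome_eq_of_between {α : Type*} {cyc : Bool} {l : List (Option α)}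
    (h : Legal cyc l) {i m j : ℕ} (hi : i < l.length) (hm : m < l.length) (hj : j < l.length)
    (him : i ≤ m) (hmj : m ≤ j) (hij : l[i].isSome = l[j].isSome) :
    l[m].isSome = l[i].isSome := by
  rcases him.eq_or_lt with rfl | him
  · rfl
  rcases hmj.eq_or_lt with rfl | hmj
  · exact hij.symm
  cases cyc with
  | true =>
    simp only [Legal, if_true] at h
    rw [h _ (List.getElem_mem hm), h _ (List.getElem_mem hi)]
  | false =>
    simp only [Legal, Bool.false_eq_true, if_false, List.pairwise_iff_getElem] at h
    rcases h with h | h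
    · have h1 := h i m hi hm him
      have h2 := h m j hm hj hmj
      rw [Bool.eq_iff_iff]
      exact ⟨fun h => hij ▸ h2 h, h1⟩
    · have h1 := h i m hi hm him
      have h2 := h m j hm hj hmj
      rw [Bool.eq_iff_iff]
      exact ⟨h1, fun h => h2 (hij ▸ h)⟩

/-- Pigeonhole on pairs of the relation of a prefix and the emptiness of the next letter, of which
there are `2 * (2 ^ |Q|) ^ |Q|`. If the prefixes `x` and `x ++ y` have the same relation, `y` may be
repeated at will. Equal emptiness at the two cuts makes `y` constant in this respect, so the
repetition preserves legality. -/
theorem exists_pumped {α Q : Type*} [Fintype Q] {N : Option α → Q → Prop} {E : Q → Q → Prop}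
    {cyc : Bool} {v : List (Option α)} (hv : Legal cyc v)
    (hlen : 2 * (2 ^ Fintype.card Q) ^ Fintype.card Q < v.length) (m : ℕ) :
    ∃ V : List (Option α), m ≤ V.length ∧ Chain N E V = Chain N E v ∧
      ∀ l₁ l₂, Legal cyc (l₁ ++ (v ++ l₂)) → Legal cyc (l₁ ++ (V ++ l₂)) := by
  classical
  obtain ⟨i, j, hij, he⟩ := Fintype.exists_ne_map_eq_of_card_lt
    (fun i : Fin v.length => (Chain N E (v.take i), v[i].isSome)) (by
      simpa [Fintype.card_prod, Fintype.card_pi, mul_comm] using hlen)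
  wlog hlt : i < j generalizing i j
  · exact this j i hij.symm he.symm (lt_of_le_of_ne (not_lt.1 hlt) hij.symm)
  obtain ⟨he1, he2⟩ := Prod.mk.inj he
  have hlt' : (i : ℕ) < j := hlt
  set x := v.take i with hx
  set y := (v.take j).drop i with hy
  set z := v.drop j with hz
  have hxy : x ++ y = v.take j := by
    rw [hx, hy, ← List.take_append_drop i (v.take j), List.take_take, min_eq_left hlt'.le]
    simp
  have hv' : v = x ++ (y ++ z) := by
    rw [← List.append_assoc, hxy, hz, List.take_append_drop]
  have hylen : 0 < y.length := by
    simp only [hy, List.length_drop, List.length_take]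
    have := j.2
    omega
  have hyk : ∀ a ∈ y, a.isSome = v[i].isSome := by
    intro a ha
    obtain ⟨m, hm, rfl⟩ := List.getElem_of_mem ha
    simp only [hy, List.length_drop, List.length_take] at hm
    simp only [hy, List.getElem_drop, List.getElem_take]
    exact hv.isSome_eq_of_between i.2 (by omega) j.2 (by omega) (by omega) he2
  have hxyc : Chain N E (x ++ y) = Chain N E x := by rw [hxy, he1]
  have hpow : ∀ m : ℕ, Chain N E (x ++ ((List.replicate m y).flatten ++ z)) =
      Chain N E (x ++ z) := by
    intro m
    induction m with
    | zero => simp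
    | succ m ih =>
      rw [List.replicate_succ, List.flatten_cons, List.append_assoc, ← List.append_assoc x]
      rw [chain_append_congr_left hxyc, ih]
  refine ⟨x ++ ((List.replicate m y).flatten ++ z), ?_, ?_, fun l₁ l₂ h => ?_⟩
  · have : m * 1 ≤ m * y.length := Nat.mul_le_mul_left _ hylen
    simp only [List.length_append, List.length_flatten, List.map_replicate, List.sum_replicate,
      smul_eq_mul]
    omega
  · rw [hpow, hv', ← List.append_assoc x y, chain_append_congr_left hxyc]
  · rw [hv'] at h
    have h' : Legal cyc ((l₁ ++ x) ++ (y ++ (z ++ l₂))) := by simpa using h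
    have := h'.replace hyk (List.length_pos_iff.1 hylen)
      (y' := (List.replicate m y).flatten) (by
        intro a ha
        simp only [List.mem_flatten, List.mem_replicate] at ha
        obtain ⟨_, ⟨-, rfl⟩, ha⟩ := ha
        exact hyk a ha)
    simpa using this

/-! ## Window states -/

/-- The labels in a window: an input label and an output label (with one spare value) at every
place that is a node. -/
abbrev LCL.State (P : LCL) :=
  Fin (2 * P.radius + 1) → Option (Fin P.numIn × Fin (P.numOut + 1))

/-- The window state `q` is correct at its middle place, which carries the letter `a`. -/
def LCL.NodeOk (P : LCL) (a : Option (Fin P.numIn)) (q : P.State) : Prop :=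
  (q ⟨P.radius, by omega⟩).map Prod.fst = a ∧ (a.isSome →
    (∀ p, q ⟨P.radius, by omega⟩ = some p → (p.2 : ℕ) < P.numOut) ∧
      P.Accepts fun k => (q k).map fun p => ((p.1 : ℕ), (p.2 : ℕ)))

/-- The window states `q` and `q'` of adjacent places overlap consistently. -/
def LCL.EdgeOk (P : LCL) (q q' : P.State) : Prop :=
  ∀ k : Fin (2 * P.radius), q k.succ = q' k.castSucc

/-- The reversed window state. -/
def LCL.revState (P : LCL) (q : P.State) : P.State := fun k => q (Fin.rev k)

theorem LCL.revState_revState (P : LCL) (q : P.State) : P.revState (P.revState q) = q := by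
  funext k
  simp [LCL.revState]

theorem LCL.rev_mid (P : LCL) :
    Fin.rev (⟨P.radius, by omega⟩ : Fin (2 * P.radius + 1)) = ⟨P.radius, by omega⟩ := by
  ext
  simp only [Fin.val_rev]
  omega

theorem LCL.NodeOk.rev {P : LCL} {a : Option (Fin P.numIn)} {q : P.State} (h : P.NodeOk a q) :
    P.NodeOk a (P.revState q) := by
  unfold LCL.NodeOk LCL.revState at *
  rw [P.rev_mid]
  exact ⟨h.1, fun ha => ⟨(h.2 ha).1, (h.2 ha).2.rev⟩⟩

theorem LCL.EdgeOk.rev {P : LCL} {q q' : P.State} (h : P.EdgeOk q q') :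
    P.EdgeOk (P.revState q') (P.revState q) := by
  intro k
  have := h (Fin.rev k)
  unfold LCL.revState
  rw [Fin.rev_succ, Fin.rev_castSucc, this]

/-- The length of the words that are used for pumping. -/
def LCL.pumpLength (P : LCL) : ℕ :=
  2 * (2 ^ (P.numIn * (P.numOut + 1) + 1) ^ (2 * P.radius + 1)) ^
    (P.numIn * (P.numOut + 1) + 1) ^ (2 * P.radius + 1) + 1

/-- The cardinality of `P.State` is written out in `LCL.pumpLength`, so that the latter is visibly
primitive recursive in `P`. -/
theorem LCL.lt_pumpLength (P : LCL) :
    2 * (2 ^ Fintype.card P.State) ^ Fintype.card P.State < P.pumpLength := by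
  simp [LCL.pumpLength, Fintype.card_pi, Fintype.card_option]

/-- The choice function `f`, applied in one of the two orientations of an anchor. -/
def LCL.orient (P : LCL) (s : Bool)
    (f : List (Option (Fin P.numIn)) → Option (Fin P.numIn) → List (Option (Fin P.numIn)) → P.State)
    (u : List (Option (Fin P.numIn))) (a : Option (Fin P.numIn)) (v : List (Option (Fin P.numIn))) :
    P.State :=
  if s then f u a v else P.revState (f v a u)

/-- The function `f` chooses the window state of every anchor from its letter and from the words on
its two sides, read outwards up to the next anchors, in such a way that all blocks between
consecutive anchors can be completed, whatever the orientations of the anchors. -/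
def LCL.IsFeasible (P : LCL) (cyc : Bool)
    (f : List (Option (Fin P.numIn)) → Option (Fin P.numIn) → List (Option (Fin P.numIn)) →
      P.State) : Prop :=
  (∀ u a v, 2 * P.pumpLength ≤ u.length → 2 * P.pumpLength ≤ v.length →
    Legal cyc (u.reverse ++ a :: v) → P.NodeOk a (f u a v)) ∧
  ∀ u a v b w, 2 * P.pumpLength ≤ u.length → 2 * P.pumpLength ≤ v.length →
    2 * P.pumpLength ≤ w.length → Legal cyc (u.reverse ++ a :: (v ++ b :: w)) → ∀ s s',
      Chain P.NodeOk P.EdgeOk v (P.orient s f u a v) (P.orient s' f v.reverse b w)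

/-! ## Running a LOCAL algorithm along a line -/

/-- The output label `o`, cut off at the spare label `m`. -/
def capOutput (m o : ℕ) : Fin (m + 1) :=
  ⟨min o m, by omega⟩

/-- The window state at position `i` that a `t`-round algorithm for `n`-node graphs produces. -/
noncomputable def algState (P : LCL) (n t : ℕ) (o : View → ℕ)
    (x : ℤ → Option (ℕ × Fin P.numIn)) (i : ℤ) : P.State :=
  window P.radius (fun j => (x j).map fun p =>
    (p.2, capOutput P.numOut (o (lineView n x t j)))) i

theorem edgeOk_window {P : LCL} (z : ℤ → Option (Fin P.numIn × Fin (P.numOut + 1))) (i : ℤ) :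
    P.EdgeOk (window P.radius z i) (window P.radius z (i + 1)) := by
  intro k
  simp only [window, Fin.val_succ, Fin.val_castSucc]
  congr 1
  push_cast
  ring

/-- Each of the places within distance `P.radius` has a view of radius `t` of its own, hence the sum
of the radii. -/
theorem algState_eq_of_agree {P : LCL} {n t : ℕ} {o : View → ℕ}
    {x y : ℤ → Option (ℕ × Fin P.numIn)} {i j : ℤ} (h : Agree (t + P.radius) x i y j 1) :
    algState P n t o x i = algState P n t o y j := by
  funext k
  have hk : |(-P.radius + (k : ℕ) : ℤ)| ≤ P.radius := by
    have := k.2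
    rw [abs_le]
    omega
  have h1 := h.shift (R' := t) (k := -P.radius + (k : ℕ)) (by push_cast; linarith)
  simp only [algState, window]
  rw [one_mul, ← add_assoc, ← add_assoc, ← sub_eq_add_neg, ← sub_eq_add_neg] at h1
  rw [h1.center, h1.lineView_eq]

/-- Views do not notice a reflection, so on the mirrored line the algorithm repeats the same outputs
in mirrored order. -/
theorem algState_eq_rev_of_agree {P : LCL} {n t : ℕ} {o : View → ℕ}
    {x y : ℤ → Option (ℕ × Fin P.numIn)} {i j : ℤ} (h : Agree (t + P.radius) x i y j (-1)) :
    algState P n t o x i = P.revState (algState P n t o y j) := by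
  funext k
  have hk : |(-P.radius + (k : ℕ) : ℤ)| ≤ P.radius := by
    have := k.2
    rw [abs_le]
    omega
  have h1 := h.shift (R' := t) (k := -P.radius + (k : ℕ)) (by push_cast; linarith)
  have h2 : j + -1 * (-P.radius + (k : ℕ)) = j - P.radius + (Fin.rev k : Fin _) := by
    rw [Fin.val_rev]
    have := k.2
    omega
  simp only [algState, window, LCL.revState]
  rw [h2, ← add_assoc, ← sub_eq_add_neg] at h1
  rw [h1.center, h1.lineView_eq]

/-- The window of radius `R` around position `i` of a labeled line occurs in some `n`-node cycle
or path with identifiers below `n`. -/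
structure Hostable {s : ℕ} (cyc : Bool) (n R : ℕ) (x : ℤ → Option (ℕ × Fin s)) (i : ℤ) : Prop where
  id_inj : ∀ k k' : ℤ, |k| ≤ R → |k'| ≤ R → ∀ p p', x (i + k) = some p → x (i + k') = some p' →
    p.1 = p'.1 → k = k'
  id_lt : ∀ k : ℤ, |k| ≤ R → ∀ p, x (i + k) = some p → p.1 < n
  isSome_of_cycle : cyc = true → ∀ k : ℤ, |k| ≤ R → (x (i + k)).isSome
  isSome_mono : (∀ k k' : ℤ, |k| ≤ R → |k'| ≤ R → k ≤ k' → (x (i + k)).isSome →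
      (x (i + k')).isSome) ∨
    (∀ k k' : ℤ, |k| ≤ R → |k'| ≤ R → k ≤ k' → (x (i + k')).isSome → (x (i + k)).isSome)

/-- On a cycle every position serves. On a path the window sees at most one end: the node is placed
at the matching distance from that end, or at position `R` if no end is seen. -/
theorem Hostable.exists_position {s : ℕ} {cyc : Bool} {n R : ℕ} {x : ℤ → Option (ℕ × Fin s)} {i : ℤ}
    (h : Hostable cyc n R x i) (hn : 2 * R + 2 ≤ n) (hi : (x i).isSome) :
    ∃ v : Fin n, ∀ k : ℤ, |k| ≤ R → (x (i + k)).isSome = (nodeAt cyc n (v + k)).isSome := by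
  cases cyc with
  | true =>
    refine ⟨⟨0, by omega⟩, fun k hk => ?_⟩
    rw [h.isSome_of_cycle rfl k hk, nodeAt_cycle_isSome (by omega)]
  | false =>
    suffices ∃ v : Fin n, ∀ k : ℤ, |k| ≤ R →
        ((x (i + k)).isSome ↔ 0 ≤ (v : ℤ) + k ∧ (v : ℤ) + k < n) by
      obtain ⟨v, hv⟩ := this
      refine ⟨v, fun k hk => ?_⟩
      rw [Bool.eq_iff_iff, hv k hk, nodeAt_path_isSome]
    rcases h.isSome_mono with hm | hm
    · by_cases hall : ∃ k : ℕ, k ≤ R ∧ ¬ (x (i + -k)).isSome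
      · classical
        let k₀ := Nat.find hall
        obtain ⟨h1, h2⟩ := Nat.find_spec hall
        have hmin : ∀ k < k₀, ¬ (k ≤ R ∧ ¬ (x (i + -k)).isSome) := fun k hk => Nat.find_min hall hk
        change k₀ ≤ R at h1
        change ¬ (x (i + -k₀)).isSome at h2
        have hpos : 0 < k₀ := by
          rcases Nat.eq_zero_or_pos k₀ with h0 | h0
          · rw [h0] at h2
            simp [hi] at h2
          · exact h0
        -- The first empty place to the left, at offset `-k₀`, has to fall on position `-1`.
        refine ⟨⟨k₀ - 1, by omega⟩, fun k hk => ?_⟩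
        have hk' := abs_le.1 hk
        simp only
        rw [Nat.cast_sub (by omega)]
        constructor
        · intro hs
          refine ⟨?_, by push_cast; omega⟩
          by_contra hc
          exact h2 (hm k (-k₀) hk (abs_le.2 (by omega)) (by push_cast at hc; omega) hs)
        · rintro ⟨hs, -⟩
          have := hmin (k₀ - 1) (by omega)
          rw [not_and, not_not] at this
          refine hm _ k (abs_le.2 (by omega)) hk ?_ (this (by omega))
          omega
      · push Not at hall
        refine ⟨⟨R, by omega⟩, fun k hk => ?_⟩
        have hk' := abs_le.1 hk
        have : (x (i + k)).isSome :=
          hm (-R) k (by simp) hk (by omega) (by simpa using hall R le_rfl)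
        simp only [this, true_iff]
        omega
    · by_cases hall : ∃ k : ℕ, k ≤ R ∧ ¬ (x (i + k)).isSome
      · classical
        let k₀ := Nat.find hall
        obtain ⟨h1, h2⟩ := Nat.find_spec hall
        have hmin : ∀ k < k₀, ¬ (k ≤ R ∧ ¬ (x (i + k)).isSome) := fun k hk => Nat.find_min hall hk
        change k₀ ≤ R at h1
        change ¬ (x (i + k₀)).isSome at h2
        have hpos : 0 < k₀ := by
          rcases Nat.eq_zero_or_pos k₀ with h0 | h0
          · rw [h0] at h2
            simp [hi] at h2
          · exact h0
        -- The first empty place to the right, at offset `k₀`, has to fall on position `n`.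
        refine ⟨⟨n - k₀, by omega⟩, fun k hk => ?_⟩
        have hk' := abs_le.1 hk
        simp only
        rw [Nat.cast_sub (by omega)]
        constructor
        · intro hs
          refine ⟨by omega, ?_⟩
          by_contra hc
          exact h2 (hm k₀ k (abs_le.2 (by omega)) hk (by omega) hs)
        · rintro ⟨-, hs⟩
          have := hmin (k₀ - 1) (by omega)
          rw [not_and, not_not] at this
          refine hm k _ hk (abs_le.2 (by omega)) ?_ (this (by omega))
          omega
      · push Not at hall
        refine ⟨⟨R, by omega⟩, fun k hk => ?_⟩
        have hk' := abs_le.1 hk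
        have : (x (i + k)).isSome :=
          hm k R hk (by simp) (by omega) (by simpa using hall R le_rfl)
        simp only [this, true_iff]
        omega

/-- Serves to hand out the unused identifiers to the nodes outside of a prescribed window. -/
theorem exists_injective_extension {α : Type*} [Finite α] {S : Set α} {g : α → α}
    (hg : Set.InjOn g S) : ∃ σ : α → α, Function.Injective σ ∧ ∀ a ∈ S, σ a = g a := by
  classical
  have := Fintype.ofFinite α
  let e : {a // a ∈ S} ≃ {a // a ∈ g '' S} := Equiv.Set.imageOfInjOn g S hg
  refine ⟨e.extendSubtype, e.extendSubtype.injective, fun a ha => ?_⟩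
  rw [Equiv.extendSubtype_apply_of_mem e a ha]
  rfl

theorem Hostable.exists_host {s : ℕ} {cyc : Bool} {n R : ℕ} {x : ℤ → Option (ℕ × Fin s)} {i : ℤ}
    (h : Hostable cyc n R x i) (hn : 2 * R + 2 ≤ n) (hi : (x i).isSome) :
    ∃ (v : Fin n) (ids : Fin n → ℕ) (inp : Fin n → Fin s), Function.Injective ids ∧
      (∀ u, ids u < n) ∧ Agree R x i (hostLine cyc fun u => (ids u, inp u)) v 1 := by
  classical
  obtain ⟨v, hv⟩ := h.exists_position hn hi
  obtain ⟨p₀, hp₀⟩ := Option.isSome_iff_exists.1 hi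
  let W : Fin n → ℤ → Prop := fun u k => |k| ≤ R ∧ nodeAt cyc n (v + k) = some u
  have hW : ∀ u k k', W u k → W u k' → k = k' := by
    rintro u k k' ⟨hk, h1⟩ ⟨hk', h2⟩
    have := abs_le.1 hk
    have := abs_le.1 hk'
    have := eq_of_nodeAt_eq h1 h2 (by rw [abs_lt]; omega)
    omega
  let S : Set (Fin n) := {u | ∃ k, W u k}
  let dat : Fin n → ℕ × Fin s := fun u =>
    if h : ∃ k, W u k then (x (i + h.choose)).getD p₀ else p₀
  have hdat : ∀ u k, W u k → x (i + k) = some (dat u) := by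
    intro u k hk
    have hex : ∃ k, W u k := ⟨k, hk⟩
    have hch : hex.choose = k := hW u _ _ hex.choose_spec hk
    have hs : (x (i + k)).isSome := by rw [hv k hk.1, hk.2]; rfl
    obtain ⟨p, hp⟩ := Option.isSome_iff_exists.1 hs
    simp only [dat, dif_pos hex, hch, hp, Option.getD_some]
  let g : Fin n → Fin n := fun u => if h : (dat u).1 < n then ⟨(dat u).1, h⟩ else u
  have hg : ∀ u ∈ S, (g u : ℕ) = (dat u).1 := by
    rintro u ⟨k, hk⟩
    simp only [g, dif_pos (h.id_lt k hk.1 _ (hdat u k hk))]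
  obtain ⟨σ, hσ, hσg⟩ := exists_injective_extension (S := S) (g := g) (by
    rintro u ⟨k, hk⟩ u' ⟨k', hk'⟩ he
    have he' : (dat u).1 = (dat u').1 := by rw [← hg u ⟨k, hk⟩, ← hg u' ⟨k', hk'⟩, he]
    have := h.id_inj k k' hk.1 hk'.1 _ _ (hdat u k hk) (hdat u' k' hk') he'
    subst this
    exact Option.some.inj (hk.2.symm.trans hk'.2))
  refine ⟨v, fun u => σ u, fun u => (dat u).2, fun u u' he => hσ (Fin.ext he), fun u => (σ u).2,
    Or.inl rfl, fun k hk => ?_⟩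
  rw [one_mul, hostLine]
  cases hu : nodeAt cyc n (v + k) with
  | none =>
    have := hv k hk
    rw [hu] at this
    simpa using this
  | some u =>
    rw [hdat u k ⟨hk, hu⟩]
    simp only [Option.map_some, hσg u ⟨k, hk, hu⟩, hg u ⟨k, hk, hu⟩]

/-- The window is realized in an actual `n`-node graph, where the algorithm is correct, and equal
views give equal outputs. Different positions of the line may use different graphs, so the line
itself need not have distinct identifiers. -/
theorem nodeOk_algState {P : LCL} {cyc : Bool} {c n : ℕ} (hc : 1 ≤ c) {A : LocalAlgorithm}
    (hA : A.Solves P c (hostGraph cyc n)) (hn : 2 * (A.rounds n + P.radius) + 2 ≤ n)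
    {x : ℤ → Option (ℕ × Fin P.numIn)} {i : ℤ}
    (h : Hostable cyc n (A.rounds n + P.radius) x i) :
    P.NodeOk ((x i).map Prod.snd) (algState P n (A.rounds n) A.output x i) := by
  have hmid : algState P n (A.rounds n) A.output x i ⟨P.radius, by omega⟩ = (x i).map fun p =>
      (p.2, capOutput P.numOut (A.output (lineView n x (A.rounds n) i))) := by
    simp [algState, window]
  refine ⟨by rw [hmid, Option.map_map]; rfl, fun hs => ?_⟩
  rw [Option.isSome_map] at hs
  obtain ⟨v, ids, inp, hinj, hlt, hag⟩ := h.exists_host hn hs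
  -- The identifiers of the host lie below `n`, hence below `n ^ c` because `c ≥ 1`.
  obtain ⟨out, hout, hcor⟩ := hA ids hinj
    (fun u => (hlt u).trans_le (Nat.le_self_pow (by omega) n)) inp
  have key : ∀ (j k : ℤ), |k| ≤ P.radius → ∀ u, nodeAt cyc n (v + k) = some u → j = i + k →
      x j = some (ids u, inp u) ∧ A.output (lineView n x (A.rounds n) j) = out u := by
    rintro _ k hk u hu rfl
    have h1 := hag.shift (R' := A.rounds n) (k := k) (by push_cast; linarith)
    rw [one_mul] at h1
    refine ⟨by rw [h1.center, hostLine, hu]; rfl, ?_⟩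
    rw [h1.lineView_eq, ← view_eq_lineView hinj (by omega) hu, hout]
  refine ⟨fun p hp => ?_, ?_⟩
  · obtain ⟨h1, h2⟩ := key i 0 (by simp) v (by simpa using nodeAt_self v) (by simp)
    rw [hmid, h2, h1] at hp
    cases Option.some.inj hp
    have := (out v).2
    simp only [capOutput]
    omega
  · have := (exists_matches_iff_accepts (cyc := cyc) (by omega) (fun u => (inp u : ℕ))
      (fun u => (out u : ℕ)) v).1 (hcor v)
    convert this using 1
    funext k
    have hk : |(-P.radius + (k : ℕ) : ℤ)| ≤ P.radius := by
      have := k.2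
      rw [abs_le]
      omega
    have e1 : i - P.radius + (k : ℕ) = i + (-P.radius + (k : ℕ)) := by ring
    have e2 : (v : ℕ) - P.radius + (k : ℕ) = (v : ℕ) + (-P.radius + (k : ℕ) : ℤ) := by ring
    simp only [algState, window, hostLine, e2]
    cases hu : nodeAt cyc n (v + (-P.radius + (k : ℕ))) with
    | none =>
      have h1 := hag.2 (-P.radius + (k : ℕ)) (hk.trans (by push_cast; omega))
      rw [one_mul, hostLine, hu] at h1
      rw [e1, h1]
      rfl
    | some u =>
      obtain ⟨h1, h2⟩ := key _ _ hk u hu e1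
      rw [h2, h1]
      have := (out u).2
      simp only [capOutput, Option.map_some, Option.some.injEq, Prod.mk.injEq, true_and]
      omega

/-! ## Lines around an anchor -/

/-- The line of letters with `a` at position `0`, `v` to the right and `u`, read outwards, to the
left of it. -/
def lettersAt {α : Type*} (u : List (Option α)) (a : Option α) (v : List (Option α)) (k : ℤ) :
    Option α :=
  if k = 0 then a else if 0 < k then v.getD (k - 1).toNat none else u.getD (-k - 1).toNat none

theorem lettersAt_neg {α : Type*} (u : List (Option α)) (a : Option α) (v : List (Option α))
    (k : ℤ) : lettersAt u a v (-k) = lettersAt v a u k := by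
  unfold lettersAt
  rcases lt_trichotomy k 0 with h | h | h
  · rw [if_neg (by omega), if_pos (by omega), if_neg (by omega), if_neg (by omega)]
  · simp [h]
  · rw [if_neg (by omega), if_neg (by omega), if_neg (by omega), if_pos (by omega), neg_neg]

theorem lettersAt_eq_getD {α : Type*} (u : List (Option α)) (a : Option α) (v : List (Option α))
    (k : ℤ) (hk : -(u.length : ℤ) ≤ k) :
    lettersAt u a v k = (u.reverse ++ a :: v).getD (k + u.length).toNat none := by
  unfold lettersAt
  simp only [List.getD_eq_getElem?_getD]
  rcases lt_trichotomy k 0 with h | h | h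
  · rw [if_neg (by omega), if_neg (by omega), List.getElem?_append_left (by simp; omega),
      List.getElem?_reverse (by omega)]
    congr 2
    omega
  · subst h
    simp
  · rw [if_neg (by omega), if_pos h, List.getElem?_append_right (by simp; omega)]
    have : (k + u.length).toNat - u.reverse.length = (k - 1).toNat + 1 := by
      simp only [List.length_reverse]
      omega
    rw [this, List.getElem?_cons_succ]

/-- Recenters the line from the anchor `a` to the anchor `b`; the word to the left of `b`, read
outwards, continues through `a` into `u`. -/
theorem lettersAt_append_cons {α : Type*} (u : List (Option α)) (a : Option α)
    (v : List (Option α)) (b : Option α) (w : List (Option α)) (k : ℤ)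
    (hk : -(v.length + 1 + u.length : ℤ) ≤ k) :
    lettersAt u a (v ++ b :: w) (v.length + 1 + k) = lettersAt (v.reverse ++ a :: u) b w k := by
  rw [lettersAt_eq_getD _ _ _ _ (by omega), lettersAt_eq_getD _ _ _ _ (by simp; omega)]
  congr 1
  · simp
  · simp only [List.length_append, List.length_reverse, List.length_cons]
    push_cast
    congr 1
    ring

theorem lettersAt_congr {α : Type*} {u u' : List (Option α)} (a : Option α)
    {v v' : List (Option α)} (hu : u <+: u') (hv : v <+: v') {k : ℤ}
    (h1 : -(u.length : ℤ) ≤ k) (h2 : k ≤ v.length) :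
    lettersAt u a v k = lettersAt u' a v' k := by
  obtain ⟨t, rfl⟩ := hu
  obtain ⟨t', rfl⟩ := hv
  unfold lettersAt
  simp only [List.getD_eq_getElem?_getD]
  split_ifs with h h'
  · rfl
  · rw [List.getElem?_append_left (by omega)]
  · rw [List.getElem?_append_left (by omega)]

theorem legal_lettersAt {α : Type*} {cyc : Bool} {u : List (Option α)} {a : Option α}
    {v : List (Option α)} (h : Legal cyc (u.reverse ++ a :: v)) :
    (cyc = true → ∀ k : ℤ, -(u.length : ℤ) ≤ k → k ≤ v.length → (lettersAt u a v k).isSome) ∧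
    ((∀ k k' : ℤ, -(u.length : ℤ) ≤ k → k ≤ k' → k' ≤ v.length → (lettersAt u a v k).isSome →
        (lettersAt u a v k').isSome) ∨
      (∀ k k' : ℤ, -(u.length : ℤ) ≤ k → k ≤ k' → k' ≤ v.length → (lettersAt u a v k').isSome →
        (lettersAt u a v k).isSome)) := by
  have hget : ∀ k : ℤ, -(u.length : ℤ) ≤ k → k ≤ v.length →
      ∃ h : (k + u.length).toNat < (u.reverse ++ a :: v).length,
        lettersAt u a v k = (u.reverse ++ a :: v)[(k + u.length).toNat] := by
    intro k h1 h2
    have hlt : (k + u.length).toNat < (u.reverse ++ a :: v).length := by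
      simp only [List.length_append, List.length_reverse, List.length_cons]
      omega
    refine ⟨hlt, ?_⟩
    rw [lettersAt_eq_getD _ _ _ _ h1, List.getD_eq_getElem _ _ hlt]
  cases cyc with
  | true =>
    simp only [Legal, if_true] at h
    have hall : ∀ k : ℤ, -(u.length : ℤ) ≤ k → k ≤ v.length → (lettersAt u a v k).isSome := by
      intro k h1 h2
      obtain ⟨hlt, he⟩ := hget k h1 h2
      rw [he]
      exact h _ (List.getElem_mem hlt)
    exact ⟨fun _ => hall, Or.inl fun k k' h1 h2 h3 _ => hall k' (h1.trans h2) h3⟩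
  | false =>
    refine ⟨fun h => by simp at h, ?_⟩
    simp only [Legal, Bool.false_eq_true, if_false, List.pairwise_iff_getElem] at h
    refine h.imp (fun h => ?_) (fun h => ?_)
    all_goals
      intro k k' h1 h2 h3
      rcases h2.eq_or_lt with rfl | h2
      · exact id
      obtain ⟨hlt, he⟩ := hget k h1 (by omega)
      obtain ⟨hlt', he'⟩ := hget k' (by omega) h3
      rw [he, he']
      exact h _ _ hlt hlt' (by omega)

theorem hostable_lettersAt {s : ℕ} {cyc : Bool} {n R : ℕ} {u : List (Option (Fin s))}
    {a : Option (Fin s)} {v : List (Option (Fin s))} {ids : ℤ → ℕ} {i : ℤ}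
    (h : Legal cyc (u.reverse ++ a :: v)) (h1 : -(u.length : ℤ) ≤ i - R) (h2 : i + R ≤ v.length)
    (hid : ∀ k k', |k - i| ≤ R → |k' - i| ≤ R → ids k = ids k' → k = k') (hlt : ∀ k, ids k < n) :
    Hostable cyc n R (fun k => (lettersAt u a v k).map fun l => (ids k, l)) i := by
  obtain ⟨hl1, hl2⟩ := legal_lettersAt h
  refine ⟨?_, ?_, ?_, ?_⟩
  · intro k k' hk hk' p p' hp hp' hpp
    simp only [Option.map_eq_some_iff] at hp hp'
    obtain ⟨_, _, rfl⟩ := hp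
    obtain ⟨_, _, rfl⟩ := hp'
    have := hid (i + k) (i + k') (by simpa using hk) (by simpa using hk') hpp
    omega
  · intro k hk p hp
    simp only [Option.map_eq_some_iff] at hp
    obtain ⟨_, _, rfl⟩ := hp
    exact hlt _
  · intro hc k hk
    have := abs_le.1 hk
    simp only [Option.isSome_map]
    exact hl1 hc _ (by omega) (by omega)
  · simp only [Option.isSome_map]
    refine hl2.imp (fun h k k' hk hk' hkk => ?_) (fun h k k' hk hk' hkk => ?_)
    all_goals
      have := abs_le.1 hk
      have := abs_le.1 hk'
      exact h _ _ (by omega) (by omega) (by omega)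

/-! ## A fast algorithm yields a feasible function -/

section Pumped

variable (P : LCL) (cyc : Bool) (m : ℕ)

open Classical in
/-- A word of length at least `m` that is interchangeable with the first letters of `v`. -/
noncomputable def pumped (v : List (Option (Fin P.numIn))) : List (Option (Fin P.numIn)) :=
  if h : Legal cyc (v.take P.pumpLength) ∧ P.pumpLength ≤ v.length then
    (exists_pumped (N := P.NodeOk) (E := P.EdgeOk) h.1
      (by rw [List.length_take, min_eq_left h.2]; exact P.lt_pumpLength) m).choose
  else []

variable {P cyc m}

theorem pumped_spec {v : List (Option (Fin P.numIn))} (h1 : Legal cyc (v.take P.pumpLength))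
    (h2 : P.pumpLength ≤ v.length) :
    m ≤ (pumped P cyc m v).length ∧
      Chain P.NodeOk P.EdgeOk (pumped P cyc m v) =
        Chain P.NodeOk P.EdgeOk (v.take P.pumpLength) ∧
      ∀ l₁ l₂, Legal cyc (l₁ ++ (v.take P.pumpLength ++ l₂)) →
        Legal cyc (l₁ ++ (pumped P cyc m v ++ l₂)) := by
  unfold pumped
  rw [dif_pos ⟨h1, h2⟩]
  exact (exists_pumped (N := P.NodeOk) (E := P.EdgeOk) h1
      (by rw [List.length_take, min_eq_left h2]; exact P.lt_pumpLength) m).choose_spec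

theorem legal_pumped {v l₁ l₂ : List (Option (Fin P.numIn))} (hv : P.pumpLength ≤ v.length)
    (h : Legal cyc (l₁ ++ (v.take P.pumpLength ++ l₂))) :
    Legal cyc (l₁ ++ (pumped P cyc m v ++ l₂)) :=
  (pumped_spec (h.sublist (by
    rw [← List.append_assoc]
    exact (List.sublist_append_right _ _).trans (List.sublist_append_left _ _))) hv).2.2 _ _ h

theorem legal_pumped_reverse {v l₁ l₂ : List (Option (Fin P.numIn))}
    (hv : P.pumpLength ≤ v.length)
    (h : Legal cyc (l₁ ++ ((v.take P.pumpLength).reverse ++ l₂))) :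
    Legal cyc (l₁ ++ ((pumped P cyc m v).reverse ++ l₂)) := by
  have h1 : Legal cyc (l₂.reverse ++ (v.take P.pumpLength ++ l₁.reverse)) := by
    simpa using h.reverse
  simpa using (legal_pumped (m := m) hv h1).reverse

end Pumped

/-- Identifiers on a line with anchors at `0` and `B`: around the anchors they increase or
decrease, depending on the orientations `s` and `s'`. -/
def anchorIds (R : ℕ) (s s' : Bool) (B k : ℤ) : ℕ :=
  if |k| ≤ R then (if s then R + k else R - k).toNat
  else if |k - B| ≤ R then (if s' then R + (k - B) else R - (k - B)).toNat
  else (2 * R + 1 + k % (2 * R + 1)).toNat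

theorem anchorIds_lt (R : ℕ) (s s' : Bool) (B k : ℤ) : anchorIds R s s' B k < 4 * R + 2 := by
  have h1 := Int.emod_nonneg k (b := 2 * R + 1) (by omega)
  have h2 := Int.emod_lt_of_pos k (b := 2 * R + 1) (by omega)
  unfold anchorIds
  simp only [abs_le]
  split_ifs <;> omega

/-- The zones around the anchors use the values up to `2 * R`, and all other places use larger
values given by residues modulo `2 * R + 1`. The bound on `B` puts the zones more than `2 * R`
apart, so the two places never lie in different zones. -/
theorem anchorIds_inj {R : ℕ} {s s' : Bool} {B k k' : ℤ} (hB : 4 * R + 1 ≤ B)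
    (hk : |k - k'| ≤ 2 * R) (h : anchorIds R s s' B k = anchorIds R s s' B k') : k = k' := by
  have h1 := Int.emod_nonneg k (b := 2 * R + 1) (by omega)
  have h1' := Int.emod_nonneg k' (b := 2 * R + 1) (by omega)
  unfold anchorIds at h
  simp only [abs_le] at h hk
  by_cases ha : -(R : ℤ) ≤ k ∧ k ≤ R <;> by_cases hb : -(R : ℤ) ≤ k - B ∧ k - B ≤ R <;>
    by_cases ha' : -(R : ℤ) ≤ k' ∧ k' ≤ R <;> by_cases hb' : -(R : ℤ) ≤ k' - B ∧ k' - B ≤ R <;>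
    simp only [ha, hb, ha', hb', if_true, if_false, and_self] at h <;>
    first
    | omega
    | (cases s <;> cases s' <;> simp at h <;> omega)
    | (have he : k % (2 * R + 1) = k' % (2 * R + 1) := by omega
       have hd := Int.emod_eq_emod_iff_emod_sub_eq_zero.1 he
       have := Int.eq_zero_of_abs_lt_dvd (Int.dvd_of_emod_eq_zero hd) (by rw [abs_lt]; omega)
       omega)

theorem exists_isFeasible {P : LCL} {cyc : Bool} {c n : ℕ} (hc : 1 ≤ c) {A : LocalAlgorithm}
    (hA : A.Solves P c (hostGraph cyc n)) (hn : 4 * (A.rounds n + P.radius) + 10 ≤ n) :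
    ∃ f, P.IsFeasible cyc f := by
  set R := A.rounds n + P.radius with hR
  let line : (s s' : Bool) → ℤ → List (Option (Fin P.numIn)) → Option (Fin P.numIn) →
      List (Option (Fin P.numIn)) → ℤ → Option (ℕ × Fin P.numIn) :=
    fun s s' B u a v k => (lettersAt u a v k).map fun l => (anchorIds R s s' B k, l)
  let pm := pumped P cyc (4 * R + 1)
  -- The identifiers increase across the anchor at `0`. The second anchor, at `4 * R + 1`, is a
  -- dummy: its zone is out of reach of the radius-`R` window.
  let f := fun u a v => algState P n (A.rounds n) A.output
    (line true true (4 * R + 1) (pm u) a (pm v)) 0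
  have hnode : ∀ s s' B u a v (i : ℤ), Legal cyc (u.reverse ++ a :: v) →
      -(u.length : ℤ) ≤ i - R → i + R ≤ v.length → (4 * R + 1 : ℤ) ≤ B →
      P.NodeOk (lettersAt u a v i)
        (algState P n (A.rounds n) A.output (line s s' B u a v) i) := by
    intro s s' B u a v i hl h1 h2 hB
    have hh : Hostable cyc n R (line s s' B u a v) i := by
      refine hostable_lettersAt hl h1 h2 (fun k k' hk hk' => ?_) fun k => ?_
      · have := abs_le.1 hk
        have := abs_le.1 hk'
        exact anchorIds_inj hB (abs_le.2 (by omega))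
      · have := anchorIds_lt R s s' B k
        omega
    have := nodeOk_algState hc hA (by omega) hh
    rwa [Option.map_map, show (Prod.snd ∘ fun l => (anchorIds R s s' B i, l)) = id from rfl,
      Option.map_id, id] at this
  have hlen : ∀ {v}, P.pumpLength ≤ v.length → Legal cyc (v.take P.pumpLength) →
      4 * R + 1 ≤ (pm v).length := fun hv hl => (pumped_spec hl hv).1
  have htake : ∀ {u l : List (Option (Fin P.numIn))}, Legal cyc (u.reverse ++ l) →
      Legal cyc (u.take P.pumpLength) := fun {u l} hl => by
    have h := (hl.sublist (List.sublist_append_left _ _)).reverse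
    rw [List.reverse_reverse] at h
    exact h.sublist (List.take_sublist _ _)
  refine ⟨f, fun u a v hu hv hl => ?_, fun u a v b w hu hv hw hl s s' => ?_⟩
  · have hul : P.pumpLength ≤ u.length := by omega
    have hvl : P.pumpLength ≤ v.length := by omega
    have h1 : Legal cyc ((u.take P.pumpLength).reverse ++ a :: v.take P.pumpLength) := by
      refine hl.sublist (List.Sublist.append ?_ ?_)
      · exact (List.take_sublist _ _).reverse
      · exact (List.take_sublist _ _).cons_cons a
    have h2 : Legal cyc ((pm u).reverse ++ a :: v.take P.pumpLength) :=
      legal_pumped_reverse (l₁ := []) hul h1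
    have h3 : Legal cyc ((pm u).reverse ++ a :: pm v) := by
      have := legal_pumped (cyc := cyc) (m := 4 * R + 1) (v := v) (l₁ := (pm u).reverse ++ [a])
        (l₂ := []) hvl (by simpa using h2)
      simpa using this
    have hlu := hlen hul (htake hl)
    have hlv := hlen hvl (hl.sublist ((List.take_sublist _ _).trans
      ((List.sublist_cons_self a v).trans (List.sublist_append_right _ _))))
    simpa [lettersAt] using hnode true true (4 * R + 1) (pm u) a (pm v) 0 h3 (by omega)
      (by omega) le_rfl
  · have hul : P.pumpLength ≤ u.length := by omega
    have hwl : P.pumpLength ≤ w.length := by omega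
    have hvl : P.pumpLength ≤ v.length := by omega
    have hvl' : P.pumpLength ≤ v.reverse.length := by rw [List.length_reverse]; omega
    -- The block has length at least `2 * P.pumpLength`, so the parts pumped at its two ends are
    -- disjoint and `mid` stays untouched.
    set v₁ := v.take P.pumpLength with hv₁
    set v₂ := v.reverse.take P.pumpLength with hv₂
    set mid := (v.drop P.pumpLength).take (v.length - P.pumpLength - P.pumpLength) with hmid
    have hv : v = v₁ ++ (mid ++ v₂.reverse) := by
      rw [hv₁, hv₂, hmid, List.take_reverse, List.reverse_reverse]
      have : v.drop (v.length - P.pumpLength) =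
          (v.drop P.pumpLength).drop (v.length - P.pumpLength - P.pumpLength) := by
        rw [List.drop_drop]
        congr 1
        omega
      rw [this, List.take_append_drop, List.take_append_drop]
    set V := pm v ++ (mid ++ (pm v.reverse).reverse) with hV
    have hlu := hlen hul (htake hl)
    have hlw := hlen hwl (hl.sublist ((List.take_sublist _ _).trans
      ((List.sublist_cons_self b w).trans ((List.sublist_append_right v _).trans
        ((List.sublist_cons_self a _).trans (List.sublist_append_right _ _))))))
    have hlegv : Legal cyc v := hl.sublist ((List.sublist_append_left v _).trans
        ((List.sublist_cons_self a _).trans (List.sublist_append_right _ _)))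
    have hspv := pumped_spec (m := 4 * R + 1) (hlegv.sublist (List.take_sublist _ _)) hvl
    have hspv' := pumped_spec (m := 4 * R + 1)
      (hlegv.reverse.sublist (List.take_sublist _ _)) hvl'
    have hVl : 4 * R + 1 ≤ V.length := by
      have : 4 * R + 1 ≤ (pm v).length := hspv.1
      simp only [hV, List.length_append]
      omega
    -- It therefore suffices to complete the pumped block `V`, in which each anchor sees on this
    -- side exactly the pumped word used by `f`.
    have hchain : Chain P.NodeOk P.EdgeOk V = Chain P.NodeOk P.EdgeOk v := by
      rw [hV, chain_append_congr_left hspv.2.1]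
      conv_rhs => rw [hv]
      refine chain_append_congr_right (chain_append_congr_right ?_ _) _
      exact chain_reverse_congr (N := P.NodeOk) (E := P.EdgeOk) (rev := P.revState) P.revState_revState (fun _ _ => LCL.NodeOk.rev)
        (fun _ _ => LCL.EdgeOk.rev) hspv'.2.1
    have hleg : Legal cyc ((pm u).reverse ++ a :: (V ++ b :: pm w)) := by
      have h1 : Legal cyc ((u.take P.pumpLength).reverse ++
          a :: (v ++ b :: w.take P.pumpLength)) := by
        refine hl.sublist (List.Sublist.append ?_ (List.Sublist.cons_cons a
          (List.Sublist.append (List.Sublist.refl v) (List.Sublist.cons_cons b ?_))))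
        · exact (List.take_sublist _ _).reverse
        · exact List.take_sublist _ _
      have h2 := legal_pumped_reverse (m := 4 * R + 1) (l₁ := []) hul h1
      have h3 := legal_pumped (m := 4 * R + 1) (v := w)
        (l₁ := (pm u).reverse ++ a :: (v ++ [b])) (l₂ := []) hwl (by simpa using h2)
      rw [hv] at h3
      have h4 := legal_pumped (m := 4 * R + 1) (v := v)
        (l₁ := (pm u).reverse ++ [a]) (l₂ := mid ++ v₂.reverse ++ b :: pm w) hvl
        (by simpa using h3)
      have h5 := legal_pumped_reverse (m := 4 * R + 1) (v := v.reverse)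
        (l₁ := (pm u).reverse ++ [a] ++ pm v ++ mid) (l₂ := b :: pm w) hvl'
        (by simpa using h4)
      simpa [hV] using h5
    -- Decreasing identifiers around an anchor are the mirror image of increasing ones, so the
    -- algorithm then produces the reversed state for the exchanged words. This realizes both values
    -- of the orientation in feasibility.
    have hag : ∀ j : ℤ, ∀ s : Bool, ∀ u' a' v', ∀ y : ℤ → Option (ℕ × Fin P.numIn),
        (∀ k : ℤ, |k| ≤ R → y (j + k) =
          (lettersAt (pm u') a' (pm v') k).map
            fun l => ((if s then R + k else R - k : ℤ).toNat, l)) →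
        algState P n (A.rounds n) A.output y j = P.orient s f u' a' v' := by
      intro j s u' a' v' y hy
      have hid : ∀ k : ℤ, |k| ≤ R → anchorIds R true true (4 * R + 1) k = (R + k).toNat := by
        intro k hk
        simp [anchorIds, hk]
      cases s with
      | true =>
        refine algState_eq_of_agree ⟨Or.inl rfl, fun k hk => ?_⟩
        rw [hy k hk, one_mul, zero_add]
        simp only [line, hid k hk, if_true]
      | false =>
        refine algState_eq_rev_of_agree ⟨Or.inr rfl, fun k hk => ?_⟩
        rw [hy k hk, neg_one_mul, zero_add]
        simp only [line]
        rw [hid (-k) (by rwa [abs_neg]), lettersAt_neg]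
        rfl
    rw [← hchain]
    have hstart : algState P n (A.rounds n) A.output
        (line s s' (V.length + 1) (pm u) a (V ++ b :: pm w)) 0 = P.orient s f u a v := by
      refine hag 0 s u a v _ fun k hk => ?_
      have hk' := abs_le.1 hk
      have := hspv.1
      simp only [line, zero_add, anchorIds, hk, if_true]
      rw [lettersAt_congr (u := pm u) (u' := pm u) (v := pm v) (v' := V ++ b :: pm w) a
        (List.prefix_refl _) ⟨mid ++ (pm v.reverse).reverse ++ b :: pm w, by simp [hV]⟩
        (by omega) (by change k ≤ ((pumped P cyc (4 * R + 1) v).length : ℤ); omega)]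
    have hend : algState P n (A.rounds n) A.output
        (line s s' (V.length + 1) (pm u) a (V ++ b :: pm w)) (V.length + 1 : ℕ) =
          P.orient s' f v.reverse b w := by
      refine hag _ s' v.reverse b w _ fun k hk => ?_
      have hk' := abs_le.1 hk
      have := hspv'.1
      -- The right zone is disjoint from the left one, so the second branch of `anchorIds` applies.
      have hne : ¬ |(V.length + 1 : ℕ) + k| ≤ (R : ℤ) := by
        rw [abs_le]
        push_cast
        omega
      have e : ((V.length + 1 : ℕ) : ℤ) + k - (V.length + 1) = k := by push_cast; ring
      simp only [line, anchorIds]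
      rw [if_neg hne, e, if_pos hk,
        show ((V.length + 1 : ℕ) : ℤ) + k = V.length + 1 + k by push_cast; ring,
        lettersAt_append_cons _ _ _ _ _ _ (by omega),
        lettersAt_congr (u := pm v.reverse) (u' := V.reverse ++ a :: pm u) (v := pm w) (v' := pm w)
        b ⟨mid.reverse ++ (pm v).reverse ++ a :: pm u, by simp [hV]⟩ (List.prefix_refl _)
        (by change -((pumped P cyc (4 * R + 1) v.reverse).length : ℤ) ≤ k; omega) (by omega)]
    rw [← hstart, ← hend]
    -- The states produced along the line complete the block: windows of one labeling always overlap
    -- consistently, and each is correct because it can be hosted.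
    have hc := chain_of_sequence (N := P.NodeOk) (E := P.EdgeOk) (v := V)
      (s := fun k : ℕ => algState P n (A.rounds n) A.output
        (line s s' (V.length + 1) (pm u) a (V ++ b :: pm w)) (k : ℤ)) (fun k hk => ?_)
        (fun k hk => ?_)
    · exact hc
    · simp only [Nat.cast_add, Nat.cast_one]
      exact edgeOk_window _ _
    · have h := hnode s s' (V.length + 1) (pm u) a (V ++ b :: pm w) ((k + 1 : ℕ) : ℤ) hleg
        (by omega) (by simp only [List.length_append, List.length_cons]; omega) (by omega)
      have e : lettersAt (pm u) a (V ++ b :: pm w) ((k + 1 : ℕ) : ℤ) = V[k] := by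
        unfold lettersAt
        rw [if_neg (by omega), if_pos (by omega), List.getD_eq_getElem?_getD]
        have : (((k + 1 : ℕ) : ℤ) - 1).toNat = k := by omega
        rw [this, List.getElem?_append_left hk, List.getElem?_eq_getElem hk, Option.getD_some]
      rwa [e] at h

/-! ## Symmetry breaking on a line -/

/-- The value of `F y` at a place depends only on the radius-`R` window of `y`, up to reversal. -/
def LocalMap {α β : Type*} (R : ℕ) (F : (ℤ → α) → ℤ → β) : Prop :=
  ∀ y y' i j ε, Agree R y i y' j ε → F y i = F y' j

theorem LocalMap.agree {α β : Type*} {R R' : ℕ} {F : (ℤ → α) → ℤ → β} (hF : LocalMap R F)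
    {y y' : ℤ → α} {i j ε : ℤ} (h : Agree (R' + R) y i y' j ε) : Agree R' (F y) i (F y') j ε :=
  ⟨h.1, fun k hk => hF _ _ _ _ ε (h.shift (by push_cast; linarith))⟩

theorem LocalMap.comp {α β γ : Type*} {R R' : ℕ} {F : (ℤ → α) → ℤ → β} {G : (ℤ → β) → ℤ → γ}
    (hG : LocalMap R' G) (hF : LocalMap R F) : LocalMap (R' + R) fun y => G (F y) :=
  fun _ _ _ _ _ h => hG _ _ _ _ _ (hF.agree h)

/-- Places at distance at most `K` have different colors. -/
def ProperColoring (K : ℕ) (col : ℤ → ℕ) : Prop :=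
  ∀ i j : ℤ, i ≠ j → |i - j| ≤ K → col i ≠ col j

open Classical in
/-- A binary place in which `a` and `b` differ. -/
noncomputable def diffBit (a b : ℕ) : ℕ :=
  if h : ∃ i, a.testBit i ≠ b.testBit i then Nat.find h else 0

theorem testBit_diffBit {a b : ℕ} (h : a ≠ b) :
    a.testBit (diffBit a b) ≠ b.testBit (diffBit a b) := by
  classical
  have hex : ∃ i, a.testBit i ≠ b.testBit i := by
    by_contra hc
    push Not at hc
    exact h (Nat.eq_of_testBit_eq hc)
  unfold diffBit
  rw [dif_pos hex]
  exact Nat.find_spec hex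

theorem diffBit_lt {a b k : ℕ} (h : a ≠ b) (ha : a < 2 ^ k) (hb : b < 2 ^ k) :
    diffBit a b < k := by
  by_contra hc
  have hk : 2 ^ k ≤ 2 ^ diffBit a b := Nat.pow_le_pow_right (by norm_num) (not_lt.1 hc)
  apply testBit_diffBit h
  rw [Nat.testBit_lt_two_pow (ha.trans_le hk), Nat.testBit_lt_two_pow (hb.trans_le hk)]

/-- A number that encodes a set of numbers below `m`. -/
def encodeSet (m : ℕ) (s : Finset ℕ) : ℕ :=
  Nat.ofDigits (m + 1) ((s.sort (· ≤ ·)).map (· + 1))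

theorem encodeSet_lt {m l : ℕ} {s : Finset ℕ} (hm : 0 < m) (hs : ∀ x ∈ s, x < m)
    (hl : s.card ≤ l) : encodeSet m s < (m + 1) ^ l := by
  refine (Nat.ofDigits_lt_base_pow_length (by omega) ?_).trans_le ?_
  · intro x hx
    simp only [List.mem_map, Finset.mem_sort] at hx
    obtain ⟨y, hy, rfl⟩ := hx
    have := hs y hy
    omega
  · refine Nat.pow_le_pow_right (by omega) ?_
    simpa using hl

/-- The shift by one makes all digits nonzero, so no leading zero is lost and the sorted list can be
recovered from the number. -/
theorem encodeSet_inj {m : ℕ} {s s' : Finset ℕ} (hm : 0 < m) (hs : ∀ x ∈ s, x < m)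
    (hs' : ∀ x ∈ s', x < m) (h : encodeSet m s = encodeSet m s') : s = s' := by
  have key : ∀ {s : Finset ℕ}, (∀ x ∈ s, x < m) →
      Nat.digits (m + 1) (encodeSet m s) = (s.sort (· ≤ ·)).map (· + 1) := by
    intro s hs
    refine Nat.digits_ofDigits _ (by omega) _ (fun x hx => ?_) fun hne => ?_
    · simp only [List.mem_map, Finset.mem_sort] at hx
      obtain ⟨y, hy, rfl⟩ := hx
      have := hs y hy
      omega
    · have hx := List.getLast_mem hne
      simp only [List.mem_map] at hx
      obtain ⟨y, -, hy⟩ := hx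
      omega
  have h1 : (s.sort (· ≤ ·)).map (· + 1) = (s'.sort (· ≤ ·)).map (· + 1) := by
    rw [← key hs, ← key hs', h]
  have h2 := List.map_injective_iff.2 (add_left_injective 1) h1
  rw [← Finset.sort_toFinset s (· ≤ ·), h2, Finset.sort_toFinset]

/-- The nonzero offsets up to `K`. -/
noncomputable def offsets (K : ℕ) : Finset ℤ :=
  (Finset.Icc (-K : ℤ) K).erase 0

theorem mem_offsets {K : ℕ} {d : ℤ} : d ∈ offsets K ↔ d ≠ 0 ∧ |d| ≤ K := by
  simp [offsets, abs_le]

theorem card_offsets (K : ℕ) : (offsets K).card = 2 * K := by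
  rw [offsets, Finset.card_erase_of_mem (by simp), Int.card_Icc]
  omega

/-- The set of pairs (binary place, bit) by which the color of `i` differs from the colors of the
places around it. -/
noncomputable def bitSet (K : ℕ) (col : ℤ → ℕ) (i : ℤ) : Finset ℕ :=
  (offsets K).image fun d =>
    2 * diffBit (col i) (col (i + d)) + ((col i).testBit (diffBit (col i) (col (i + d)))).toNat

/-- One round of color reduction. -/
noncomputable def reduceStep (K b : ℕ) (col : ℤ → ℕ) (i : ℤ) : ℕ :=
  encodeSet (2 * b) (bitSet K col i)

theorem mem_bitSet_lt {K b : ℕ} {col : ℤ → ℕ} (hcol : ProperColoring K col)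
    (hlt : ∀ i, col i < 2 ^ b) (i : ℤ) : ∀ x ∈ bitSet K col i, x < 2 * b := by
  intro x hx
  simp only [bitSet, Finset.mem_image, mem_offsets] at hx
  obtain ⟨d, ⟨hd, hdK⟩, rfl⟩ := hx
  have h1 := diffBit_lt (hcol i (i + d) (by omega) (by simpa using hdK)) (hlt _) (hlt _)
  have h2 := Bool.toNat_le ((col i).testBit (diffBit (col i) (col (i + d))))
  omega

/-- Suppose that `i` and `j` obtain the same set. The pair (place, bit) by which `i` differs from
`j` then also belongs to the set of `j`, so both colors have the same bit at a place where they
differ. -/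
theorem reduceStep_proper {K b : ℕ} {col : ℤ → ℕ} (hb : 0 < b) (hcol : ProperColoring K col)
    (hlt : ∀ i, col i < 2 ^ b) : ProperColoring K (reduceStep K b col) := by
  intro i j hij hK he
  have hset := encodeSet_inj (by omega) (mem_bitSet_lt hcol hlt i) (mem_bitSet_lt hcol hlt j) he
  have hne := hcol i j hij hK
  have hmem : 2 * diffBit (col i) (col j) + ((col i).testBit (diffBit (col i) (col j))).toNat ∈
      bitSet K col i := by
    simp only [bitSet, Finset.mem_image, mem_offsets]
    refine ⟨j - i, ⟨by omega, by rwa [abs_sub_comm]⟩, ?_⟩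
    rw [add_sub_cancel]
  rw [hset] at hmem
  simp only [bitSet, Finset.mem_image] at hmem
  obtain ⟨d, -, hd⟩ := hmem
  have h1 := Bool.toNat_le ((col i).testBit (diffBit (col i) (col j)))
  have h2 := Bool.toNat_le ((col j).testBit (diffBit (col j) (col (j + d))))
  have h3 : diffBit (col j) (col (j + d)) = diffBit (col i) (col j) := by omega
  rw [h3] at hd
  apply testBit_diffBit hne
  have h4 : ((col j).testBit (diffBit (col i) (col j))).toNat =
      ((col i).testBit (diffBit (col i) (col j))).toNat := by omega
  revert h4
  cases (col j).testBit (diffBit (col i) (col j)) <;>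
    cases (col i).testBit (diffBit (col i) (col j)) <;> simp

theorem reduceStep_lt {K b : ℕ} {col : ℤ → ℕ} (hb : 0 < b) (hcol : ProperColoring K col)
    (hlt : ∀ i, col i < 2 ^ b) (i : ℤ) : reduceStep K b col i < (2 * b + 1) ^ (2 * K) :=
  encodeSet_lt (by omega) (mem_bitSet_lt hcol hlt i)
    (Finset.card_image_le.trans (card_offsets K).le)

/-- A set over all offsets, rather than a tuple, makes the new color independent of the direction.
-/
theorem localMap_reduceStep (K b : ℕ) : LocalMap K (reduceStep K b) := by
  intro y y' i j ε h
  unfold reduceStep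
  congr 1
  have key : ∀ {y y' : ℤ → ℕ} {i j ε : ℤ}, Agree K y i y' j ε →
      bitSet K y i ⊆ bitSet K y' j := by
    intro y y' i j ε h x hx
    simp only [bitSet, Finset.mem_image, mem_offsets] at hx ⊢
    obtain ⟨d, ⟨hd, hdK⟩, rfl⟩ := hx
    refine ⟨ε * d, ⟨?_, by rwa [abs_sign_mul h.1]⟩, by rw [h.center, h.2 d hdK]⟩
    rcases h.1 with rfl | rfl <;> simpa using hd
  exact Finset.Subset.antisymm (key h) (key h.symm)

/-- The tower function, the inverse of the iterated logarithm. -/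
def tower : ℕ → ℕ
  | 0 => 1
  | j + 1 => 2 ^ tower j

theorem tower_pos (j : ℕ) : 0 < tower j := by
  cases j <;> simp [tower]

/-- The number of bits of the final palette. -/
def finalBits (K c : ℕ) : ℕ :=
  2 ^ (2 * (2 * K + c) + 4)

/-- One round goes from `D * 2 ^ t` bits down to `D * t` bits, for `D = finalBits K c` and `t =
tower j`. With `m = 2 * K + c` the new color takes at most `(2 * m + 6 + t) * (2 * K)` bits, and `D
= 16 * 4 ^ m` exceeds the quadratic polynomial in `m` that bounds this per unit of `t`. -/
theorem reduce_bound (K c j : ℕ) :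
    (2 * (finalBits K c * tower (j + 1)) + 1) ^ (2 * K) ≤ 2 ^ (finalBits K c * tower j) := by
  set m := 2 * K + c with hm
  set t := tower j with ht
  have ht1 : 1 ≤ t := tower_pos j
  have hpow : m + 1 ≤ 2 ^ m := Nat.lt_two_pow_self
  have hD : finalBits K c = 16 * (2 ^ m * 2 ^ m) := by
    rw [finalBits, ← hm, pow_add, two_mul, pow_add]
    ring
  have h1 : 2 * (finalBits K c * tower (j + 1)) + 1 ≤ 2 ^ (2 * m + 6 + t) := by
    have : 0 < 2 ^ (2 * m + 4 + t) := by positivity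
    rw [finalBits, ← hm, tower, ← ht, ← pow_add, show 2 * m + 6 + t = 2 * m + 4 + t + 1 + 1 by ring,
      pow_succ, pow_succ]
    omega
  refine (Nat.pow_le_pow_left h1 _).trans ?_
  rw [← pow_mul]
  refine Nat.pow_le_pow_right (by norm_num) ?_
  rw [hD]
  have h2 : (m + 1) * (m + 1) ≤ 2 ^ m * 2 ^ m := Nat.mul_le_mul hpow hpow
  calc (2 * m + 6 + t) * (2 * K) ≤ ((2 * m + 7) * t) * m :=
        Nat.mul_le_mul (by nlinarith) (by omega)
    _ = ((2 * m + 7) * m) * t := by ring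
    _ ≤ (16 * ((m + 1) * (m + 1))) * t := Nat.mul_le_mul_right _ (by nlinarith)
    _ ≤ 16 * (2 ^ m * 2 ^ m) * t := by gcongr

/-- `j` rounds of color reduction, with palettes of `finalBits K c * tower j` bits. -/
noncomputable def reduceColors (K c : ℕ) : ℕ → (ℤ → ℕ) → ℤ → ℕ
  | 0, col => col
  | j + 1, col => reduceColors K c j (reduceStep K (finalBits K c * tower (j + 1)) col)

theorem reduceColors_spec (K c : ℕ) : ∀ (j : ℕ) (col : ℤ → ℕ), ProperColoring K col →
    (∀ i, col i < 2 ^ (finalBits K c * tower j)) →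
    ProperColoring K (reduceColors K c j col) ∧ ∀ i, reduceColors K c j col i < 2 ^ finalBits K c
  | 0, col, h1, h2 => ⟨h1, by simpa [tower, reduceColors] using h2⟩
  | j + 1, col, h1, h2 => by
    have hb : 0 < finalBits K c * tower (j + 1) := Nat.mul_pos (by simp [finalBits]) (tower_pos _)
    exact reduceColors_spec K c j _ (reduceStep_proper hb h1 h2)
      fun i => (reduceStep_lt hb h1 h2 i).trans_le (reduce_bound K c j)

theorem localMap_reduceColors (K c : ℕ) : ∀ j, LocalMap (j * K) (reduceColors K c j)
  | 0 => fun _ _ _ _ _ h => h.center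
  | j + 1 => by
    have := (localMap_reduceColors K c j).comp
      (localMap_reduceStep K (finalBits K c * tower (j + 1)))
    rwa [← Nat.succ_mul] at this

/-- The places of color less than `m` that are selected greedily, color by color, subject to having
distance more than `K` from each other. -/
def greedySet (K : ℕ) : ℕ → (ℤ → ℕ) → ℤ → Prop
  | 0, _, _ => False
  | m + 1, col, i => greedySet K m col i ∨
      (col i = m ∧ ∀ d : ℤ, d ≠ 0 → |d| ≤ K → ¬ greedySet K m col (i + d))

theorem greedySet_sparse {K : ℕ} {col : ℤ → ℕ} (hcol : ProperColoring K col) :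
    ∀ {m : ℕ} {i j : ℤ}, greedySet K m col i → greedySet K m col j → i ≠ j → (K : ℤ) < |i - j|
  | 0, _, _, h, _, _ => h.elim
  | m + 1, i, j, hi, hj, hij => by
    by_contra hK
    rw [not_lt] at hK
    rcases hi with hi | ⟨hi, hi'⟩ <;> rcases hj with hj | ⟨hj, hj'⟩
    · exact absurd (greedySet_sparse hcol hi hj hij) (not_lt.2 hK)
    · refine hj' (i - j) (by omega) hK ?_
      rwa [add_sub_cancel]
    · refine hi' (j - i) (by omega) (by rwa [abs_sub_comm]) ?_
      rwa [add_sub_cancel]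
    · exact hcol i j hij hK (hi.trans hj.symm)

/-- When its color comes up, a place is either selected or blocked by a selected place within
distance `K`. -/
theorem greedySet_dense {K : ℕ} {col : ℤ → ℕ} : ∀ {m : ℕ} {i : ℤ}, col i < m →
    ∃ d : ℤ, |d| ≤ K ∧ greedySet K m col (i + d)
  | 0, _, h => absurd h (Nat.not_lt_zero _)
  | m + 1, i, h => by
    rcases Nat.lt_succ_iff_lt_or_eq.1 h with h | h
    · obtain ⟨d, hd, hd'⟩ := greedySet_dense (K := K) h
      exact ⟨d, hd, Or.inl hd'⟩
    · by_cases hex : ∃ d : ℤ, d ≠ 0 ∧ |d| ≤ K ∧ greedySet K m col (i + d)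
      · obtain ⟨d, -, hd, hd'⟩ := hex
        exact ⟨d, hd, Or.inl hd'⟩
      · push Not at hex
        exact ⟨0, by simp, by rw [add_zero]; exact Or.inr ⟨h, hex⟩⟩

theorem localMap_greedySet (K : ℕ) : ∀ m, LocalMap (m * K) (greedySet K m)
  | 0 => fun _ _ _ _ _ _ => rfl
  | m + 1 => by
    have key : ∀ {y y' : ℤ → ℕ} {i j ε : ℤ}, Agree ((m + 1) * K) y i y' j ε →
        greedySet K (m + 1) y i → greedySet K (m + 1) y' j := by
      intro y y' i j ε h hi
      have h' : Agree K (greedySet K m y) i (greedySet K m y') j ε :=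
        (localMap_greedySet K m).agree (by rwa [Nat.succ_mul, Nat.add_comm] at h)
      rcases hi with hi | ⟨hi, hi'⟩
      · left
        rwa [← h'.center]
      · right
        refine ⟨h.center ▸ hi, fun d hd hdK hc => hi' (ε * d) ?_ (by rwa [abs_sign_mul h.1]) ?_⟩
        · rcases h.1 with rfl | rfl <;> simpa using hd
        · rw [← h'.symm.2 d hdK]
          exact hc
    exact fun y y' i j ε h => propext ⟨key h, key h.symm⟩

/-- The anchors: a maximal set of places with distances more than `K`, for a line with pairwise
distinct identifiers of at most `finalBits K c * tower j` bits. -/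
def anchorSet (K c j : ℕ) (ids : ℤ → ℕ) : ℤ → Prop :=
  greedySet K (2 ^ finalBits K c) (reduceColors K c j ids)

/-- The first summand is a constant for the problem; only `j`, which will be `log* n`, grows with
the graph. -/
theorem localMap_anchorSet (K c j : ℕ) :
    LocalMap (2 ^ finalBits K c * K + j * K) (anchorSet K c j) :=
  (localMap_greedySet K _).comp (localMap_reduceColors K c j)

theorem anchorSet_sparse {K c j : ℕ} {ids : ℤ → ℕ} (h : ProperColoring K ids)
    (hlt : ∀ i, ids i < 2 ^ (finalBits K c * tower j)) {i i' : ℤ} (hi : anchorSet K c j ids i)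
    (hi' : anchorSet K c j ids i') (hne : i ≠ i') : (K : ℤ) < |i - i'| :=
  greedySet_sparse (reduceColors_spec K c j ids h hlt).1 hi hi' hne

theorem anchorSet_dense {K c j : ℕ} {ids : ℤ → ℕ} (h : ProperColoring K ids)
    (hlt : ∀ i, ids i < 2 ^ (finalBits K c * tower j)) (i : ℤ) :
    ∃ d : ℤ, |d| ≤ K ∧ anchorSet K c j ids (i + d) :=
  greedySet_dense ((reduceColors_spec K c j ids h hlt).2 i)

/-! ## Completing a labeling from the anchors -/

/-- The letters at the `m` places from `i` on. -/
def lineSegment {α : Type*} (y : ℤ → α) (i : ℤ) (m : ℕ) : List α :=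
  (List.range m).map fun k : ℕ => y (i + (k : ℤ))

theorem length_lineSegment {α : Type*} (y : ℤ → α) (i : ℤ) (m : ℕ) : (lineSegment y i m).length = m := by
  simp [lineSegment]

theorem getElem_lineSegment {α : Type*} {y : ℤ → α} {i : ℤ} {m k : ℕ}
    (h : k < (lineSegment y i m).length) : (lineSegment y i m)[k] = y (i + k) := by
  simp [lineSegment]

theorem lineSegment_add {α : Type*} (y : ℤ → α) (i : ℤ) (a b : ℕ) :
    lineSegment y i (a + b) = lineSegment y i a ++ lineSegment y (i + a) b := by
  simp only [lineSegment, List.range_add, List.map_append, List.map_map]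
  congr 1
  refine List.map_congr_left fun k _ => ?_
  simp only [Function.comp_apply]
  congr 1
  push_cast
  ring

theorem lineSegment_succ {α : Type*} (y : ℤ → α) (i : ℤ) (m : ℕ) :
    lineSegment y i (m + 1) = y i :: lineSegment y (i + 1) m := by
  rw [add_comm, lineSegment_add]
  simp [lineSegment]

theorem lineSegment_congr {α : Type*} {y y' : ℤ → α} {i j : ℤ} {m : ℕ}
    (h : ∀ k : ℕ, k < m → y (i + k) = y' (j + k)) : lineSegment y i m = lineSegment y' j m :=
  List.map_congr_left fun k hk => h k (List.mem_range.1 hk)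

theorem lineSegment_congr_reverse {α : Type*} {y y' : ℤ → α} {i j : ℤ} {m : ℕ}
    (h : ∀ k : ℕ, k < m → y (i + k) = y' (j - k)) :
    lineSegment y i m = (lineSegment y' (j - m + 1) m).reverse := by
  refine List.ext_getElem (by simp [length_lineSegment]) fun k h1 h2 => ?_
  rw [length_lineSegment] at h1
  rw [List.getElem_reverse, getElem_lineSegment, getElem_lineSegment, h k h1, length_lineSegment]
  congr 1
  omega

section Fill

variable {P : LCL}

/-- A line of identifiers, letters and anchors. -/
abbrev AnchorLine (P : LCL) := ℤ → ℕ × Option (Fin P.numIn) × Prop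

/-- The distance from place `i` to the next anchor in direction `δ`. -/
noncomputable def gap (K : ℕ) (T : AnchorLine P) (i δ : ℤ) : ℕ :=
  sInf {g : ℕ | 1 ≤ g ∧ g ≤ 2 * K + 1 ∧ (T (i + δ * g)).2.2}

/-- The letters from place `i` to the next anchor on the right. -/
noncomputable def rightWord (K : ℕ) (T : AnchorLine P) (i : ℤ) : List (Option (Fin P.numIn)) :=
  lineSegment (fun j => (T j).2.1) (i + 1) (gap K T i 1 - 1)

/-- The letters from place `i` to the next anchor on the left, read outwards. -/
noncomputable def leftWord (K : ℕ) (T : AnchorLine P) (i : ℤ) : List (Option (Fin P.numIn)) :=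
  (lineSegment (fun j => (T j).2.1) (i - gap K T i (-1) + 1) (gap K T i (-1) - 1)).reverse

variable (f : List (Option (Fin P.numIn)) → Option (Fin P.numIn) → List (Option (Fin P.numIn)) →
  P.State)

/-- The window state chosen at an anchor. -/
noncomputable def anchorState (K : ℕ) (T : AnchorLine P) (i : ℤ) : P.State :=
  P.orient (decide ((T (i - 1)).1 < (T (i + 1)).1)) f (leftWord K T i) (T i).2.1 (rightWord K T i)

open Classical in
/-- The states along a block between two anchors. -/
noncomputable def blockStates (v : List (Option (Fin P.numIn))) (q q' : P.State) : ℕ → P.State :=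
  if h : Chain P.NodeOk P.EdgeOk v q q' then (exists_sequence_of_chain h).choose else fun _ => q

theorem blockStates_spec {v : List (Option (Fin P.numIn))} {q q' : P.State}
    (h : Chain P.NodeOk P.EdgeOk v q q') :
    blockStates v q q' 0 = q ∧ blockStates v q q' (v.length + 1) = q' ∧
      (∀ k ≤ v.length, P.EdgeOk (blockStates v q q' k) (blockStates v q q' (k + 1))) ∧
      ∀ k (h : k < v.length), P.NodeOk v[k] (blockStates v q q' (k + 1)) := by
  unfold blockStates
  rw [dif_pos h]
  exact (exists_sequence_of_chain h).choose_spec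

/-- The states along the block of length `g` that starts at the anchor `l`. -/
noncomputable def orientedBlock (K : ℕ) (T : AnchorLine P) (l : ℤ) (g k : ℕ) : P.State :=
  if (T l).1 < (T (l + g)).1 then
    blockStates (lineSegment (fun j => (T j).2.1) (l + 1) (g - 1)) (anchorState f K T l)
      (anchorState f K T (l + g)) k
  else
    P.revState (blockStates (lineSegment (fun j => (T j).2.1) (l + 1) (g - 1)).reverse
      (P.revState (anchorState f K T (l + g))) (P.revState (anchorState f K T l)) (g - k))

open Classical in
/-- The window state chosen at a place. -/
noncomputable def fillState (K : ℕ) (T : AnchorLine P) (i : ℤ) : P.State :=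
  if (T i).2.2 then anchorState f K T i
  else orientedBlock f K T (i - gap K T i (-1)) (gap K T i (-1) + gap K T i 1) (gap K T i (-1))

/-- The state `q`, reversed if `ε = -1`. -/
def LCL.act (P : LCL) (ε : ℤ) (q : P.State) : P.State :=
  if ε = 1 then q else P.revState q

variable {f}

/-- The cap `2 * K + 1` built into `gap` makes it local unconditionally; it is `0` if there is no
anchor in reach. -/
theorem gap_agree {K : ℕ} {T T' : AnchorLine P} {i j ε : ℤ} (h : Agree (2 * K + 1) T i T' j ε)
    {δ : ℤ} (hδ : δ = 1 ∨ δ = -1) : gap K T i δ = gap K T' j (ε * δ) := by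
  unfold gap
  congr 1
  ext g
  refine and_congr_right fun _ => and_congr_right fun hg => ?_
  rw [h.2 (δ * g) (by rw [abs_sign_mul hδ, abs_of_nonneg (by omega)]; exact_mod_cast hg), mul_assoc]

theorem gap_le (K : ℕ) (T : AnchorLine P) (i δ : ℤ) : gap K T i δ ≤ 2 * K + 1 := by
  unfold gap
  rcases Set.eq_empty_or_nonempty
    {g : ℕ | 1 ≤ g ∧ g ≤ 2 * K + 1 ∧ (T (i + δ * g)).2.2} with h | h
  · rw [h, Nat.sInf_empty]
    omega
  · exact (Nat.sInf_mem h).2.1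

theorem anchorState_agree_one {K : ℕ} {T T' : AnchorLine P} {i j : ℤ}
    (h : Agree (2 * K + 1) T i T' j 1) : anchorState f K T i = anchorState f K T' j := by
  have hg := gap_agree h (δ := 1) (Or.inl rfl)
  have hg' := gap_agree h (δ := -1) (Or.inr rfl)
  rw [one_mul] at hg hg'
  have hle := gap_le K T i 1
  have hle' := gap_le K T i (-1)
  have hT : ∀ k : ℤ, |k| ≤ 2 * K + 1 → T (i + k) = T' (j + k) := fun k hk => by
    simpa using h.2 k (by push_cast; exact hk)
  have hr : rightWord K T i = rightWord K T' j := by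
    rw [rightWord, rightWord, ← hg]
    refine lineSegment_congr fun k hk => ?_
    rw [add_assoc, add_assoc, hT (1 + k) (by rw [abs_le]; omega)]
  have hl : leftWord K T i = leftWord K T' j := by
    rw [leftWord, leftWord, ← hg']
    congr 1
    refine lineSegment_congr fun k hk => ?_
    have := hT (-gap K T i (-1) + 1 + k) (by rw [abs_le]; omega)
    rw [← add_assoc, ← add_assoc, ← add_assoc, ← add_assoc, ← sub_eq_add_neg,
      ← sub_eq_add_neg] at this
    rw [this]
  unfold anchorState
  rw [hr, hl, h.center]
  have h1 := hT 1 (by rw [abs_le]; omega)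
  have h2 := hT (-1) (by rw [abs_le]; omega)
  rw [← sub_eq_add_neg, ← sub_eq_add_neg] at h2
  rw [h1, h2]

/-- A reflection exchanges the two words and flips the comparison of the neighboring identifiers.
The flip needs these to be distinct, which is `hid`. -/
theorem anchorState_agree_neg {K : ℕ} {T T' : AnchorLine P} {i j : ℤ}
    (h : Agree (2 * K + 1) T i T' j (-1)) (hid : (T (i - 1)).1 ≠ (T (i + 1)).1) :
    anchorState f K T i = P.revState (anchorState f K T' j) := by
  have hg := gap_agree h (δ := 1) (Or.inl rfl)
  have hg' := gap_agree h (δ := -1) (Or.inr rfl)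
  rw [neg_one_mul] at hg hg'
  rw [neg_neg] at hg'
  have hle := gap_le K T i 1
  have hle' := gap_le K T i (-1)
  have hT : ∀ k : ℤ, |k| ≤ 2 * K + 1 → T (i + k) = T' (j - k) := fun k hk => by
    simpa [sub_eq_add_neg] using h.2 k (by push_cast; exact hk)
  have hr : rightWord K T i = leftWord K T' j := by
    rw [rightWord, leftWord, ← hg]
    -- For gap `0` the truncated length `gap - 1` is `0` and both words are empty.
    rcases Nat.eq_zero_or_pos (gap K T i 1) with h0 | h0
    · simp [h0, lineSegment]
    rw [lineSegment_congr_reverse (j := j - 1) (y' := fun j => (T' j).2.1)]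
    · rw [Nat.cast_sub h0]
      congr 2
      push_cast
      ring
    · intro k hk
      rw [add_assoc, hT (1 + k) (by rw [abs_le]; omega), sub_sub]
  have hl : leftWord K T i = rightWord K T' j := by
    rw [rightWord, leftWord, ← hg', List.reverse_eq_iff]
    rcases Nat.eq_zero_or_pos (gap K T i (-1)) with h0 | h0
    · simp [h0, lineSegment]
    rw [lineSegment_congr_reverse (j := j + gap K T i (-1) - 1) (y' := fun j => (T' j).2.1)]
    · rw [Nat.cast_sub h0]
      congr 2
      push_cast
      ring
    · intro k hk
      have := hT (-gap K T i (-1) + 1 + k) (by rw [abs_le]; omega)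
      rw [← add_assoc, ← add_assoc, ← sub_eq_add_neg] at this
      rw [this]
      congr 3
      ring
  have h1 := hT 1 (by rw [abs_le]; omega)
  have h2 := hT (-1) (by rw [abs_le]; omega)
  rw [← sub_eq_add_neg, sub_neg_eq_add] at h2
  unfold anchorState
  rw [h1, h2] at hid ⊢
  rw [hr, hl, h.center]
  rcases lt_or_gt_of_ne hid with hlt | hlt
  · rw [decide_eq_true hlt, decide_eq_false (not_lt.2 hlt.le)]
    simp [LCL.orient, LCL.revState_revState]
  · rw [decide_eq_true hlt, decide_eq_false (not_lt.2 hlt.le)]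
    simp [LCL.orient]

theorem anchorState_agree {K : ℕ} {T T' : AnchorLine P} {i j ε : ℤ}
    (h : Agree (2 * K + 1) T i T' j ε) (hid : (T (i - 1)).1 ≠ (T (i + 1)).1) :
    anchorState f K T i = P.act ε (anchorState f K T' j) := by
  rcases h.1 with rfl | rfl
  · simpa [LCL.act] using anchorState_agree_one h
  · simpa [LCL.act] using anchorState_agree_neg h hid

theorem orientedBlock_agree_one {K : ℕ} {T T' : AnchorLine P} {l l' : ℤ} {g k : ℕ}
    (h : ∀ d : ℤ, -(2 * K + 1 : ℤ) ≤ d → d ≤ g + (2 * K + 1) → T (l + d) = T' (l' + d)) :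
    orientedBlock f K T l g k = orientedBlock f K T' l' g k := by
  have h0 : anchorState f K T l = anchorState f K T' l' :=
    anchorState_agree_one ⟨Or.inl rfl, fun d hd => by
      push_cast at hd
      have := abs_le.1 hd
      rw [one_mul]
      exact h d (by omega) (by omega)⟩
  have h1 : anchorState f K T (l + g) = anchorState f K T' (l' + g) :=
    anchorState_agree_one ⟨Or.inl rfl, fun d hd => by
      push_cast at hd
      have := abs_le.1 hd
      rw [one_mul, add_assoc, add_assoc]
      exact h _ (by omega) (by omega)⟩
  have h2 : lineSegment (fun j => (T j).2.1) (l + 1) (g - 1) =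
      lineSegment (fun j => (T' j).2.1) (l' + 1) (g - 1) := by
    refine lineSegment_congr fun m hm => ?_
    rw [add_assoc, add_assoc, h _ (by omega) (by omega)]
  have h3 := h 0 (by omega) (by omega)
  have h4 := h g (by omega) (by omega)
  rw [add_zero, add_zero] at h3
  unfold orientedBlock
  rw [h0, h1, h2, h3, h4]

/-- A block is filled starting from the anchor with the smaller identifier, so the arbitrary choice
of a filling commutes with reflections. The conditions on identifiers make the comparisons at the
block and at both anchors strict. -/
theorem orientedBlock_agree_neg {K : ℕ} {T T' : AnchorLine P} {l l' : ℤ} {g k : ℕ} (hg : 0 < g)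
    (hk : k ≤ g)
    (h : ∀ d : ℤ, -(2 * K + 1 : ℤ) ≤ d → d ≤ g + (2 * K + 1) → T (l + d) = T' (l' + g - d))
    (hid : (T l).1 ≠ (T (l + g)).1) (hid1 : (T (l - 1)).1 ≠ (T (l + 1)).1)
    (hid2 : (T (l + g - 1)).1 ≠ (T (l + g + 1)).1) :
    orientedBlock f K T l g k = P.revState (orientedBlock f K T' l' g (g - k)) := by
  have h0 : anchorState f K T l = P.revState (anchorState f K T' (l' + g)) :=
    anchorState_agree_neg ⟨Or.inr rfl, fun d hd => by
      push_cast at hd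
      have := abs_le.1 hd
      rw [neg_one_mul, ← sub_eq_add_neg]
      exact h d (by omega) (by omega)⟩ hid1
  have h1 : anchorState f K T (l + g) = P.revState (anchorState f K T' l') :=
    anchorState_agree_neg ⟨Or.inr rfl, fun d hd => by
      push_cast at hd
      have := abs_le.1 hd
      rw [neg_one_mul, add_assoc, h _ (by omega) (by omega)]
      congr 1
      ring⟩ hid2
  have h2 : lineSegment (fun j => (T j).2.1) (l + 1) (g - 1) =
      (lineSegment (fun j => (T' j).2.1) (l' + 1) (g - 1)).reverse := by
    rw [lineSegment_congr_reverse (j := l' + g - 1) (y' := fun j => (T' j).2.1)]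
    · rw [Nat.cast_sub hg]
      congr 2
      push_cast
      ring
    · intro m hm
      rw [add_assoc, h _ (by omega) (by omega), sub_sub]
  have h3 := h 0 (by omega) (by omega)
  have h4 := h g (by omega) (by omega)
  rw [add_zero, sub_zero] at h3
  rw [add_sub_cancel_right] at h4
  unfold orientedBlock
  rw [h3, h4] at hid
  rw [h0, h1, h2, h3, h4, List.reverse_reverse, P.revState_revState, P.revState_revState,
    Nat.sub_sub_self hk]
  rcases lt_or_gt_of_ne hid with hlt | hlt
  · rw [if_pos hlt, if_neg (not_lt.2 hlt.le), P.revState_revState]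
  · rw [if_pos hlt, if_neg (not_lt.2 hlt.le)]

/-- A place needs `2 * K + 1` steps to reach the anchors of its block and as many again for the
words beyond them. Identifiers are compared up to the neighbors of these anchors, at distance `2 * K
+ 2`. -/
theorem fillState_agree {K : ℕ} {T T' : AnchorLine P} {i j ε : ℤ}
    (h : Agree (4 * K + 2) T i T' j ε)
    (hid : ∀ d d' : ℤ, |d| ≤ 2 * K + 2 → |d'| ≤ 2 * K + 2 → d ≠ d' →
      (T (i + d)).1 ≠ (T (i + d')).1)
    (hgap : 1 ≤ gap K T i 1) :
    fillState f K T i = P.act ε (fillState f K T' j) := by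
  classical
  have hs := h.mono (R' := 2 * K + 1) (by omega)
  have hT : ∀ k : ℤ, |k| ≤ 4 * K + 2 → T (i + k) = T' (j + ε * k) := fun k hk =>
    h.2 k (by push_cast; exact hk)
  have hg := gap_agree hs (δ := 1) (Or.inl rfl)
  have hg' := gap_agree hs (δ := -1) (Or.inr rfl)
  have hle := gap_le K T i 1
  have hle' := gap_le K T i (-1)
  unfold fillState
  rw [h.center]
  by_cases hS : (T' j).2.2
  · rw [if_pos hS, if_pos hS]
    refine anchorState_agree hs ?_
    rw [sub_eq_add_neg]
    exact hid _ _ (by rw [abs_le]; omega) (by rw [abs_le]; omega) (by norm_num)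
  · rw [if_neg hS, if_neg hS]
    rcases h.1 with rfl | rfl
    · rw [one_mul] at hg hg'
      rw [← hg, ← hg', LCL.act, if_pos rfl]
      refine orientedBlock_agree_one fun d hd hd' => ?_
      have := hT (-gap K T i (-1) + d) (by rw [abs_le]; push_cast at hd'; omega)
      rwa [one_mul, ← add_assoc, ← add_assoc, ← sub_eq_add_neg, ← sub_eq_add_neg] at this
    · rw [neg_one_mul] at hg hg'
      rw [neg_neg] at hg'
      rw [← hg, ← hg', LCL.act, if_neg (by norm_num)]
      rw [orientedBlock_agree_neg (T' := T') (l' := j - gap K T i 1), add_comm (gap K T i (-1)),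
        Nat.add_sub_cancel]
      · omega
      · omega
      · intro d hd hd'
        have := hT (-gap K T i (-1) + d) (by rw [abs_le]; push_cast at hd'; omega)
        rw [← add_assoc, ← sub_eq_add_neg] at this
        rw [this]
        congr 1
        push_cast
        ring
      · have := hid (-gap K T i (-1)) (gap K T i 1) (by rw [abs_le]; omega) (by rw [abs_le]; omega)
          (by omega)
        convert this using 3 <;> (push_cast; ring)
      · have := hid (-gap K T i (-1) - 1) (-gap K T i (-1) + 1) (by rw [abs_le]; omega)
          (by rw [abs_le]; omega) (by omega)
        convert this using 3 <;> ring
      · have := hid (gap K T i 1 - 1) (gap K T i 1 + 1) (by rw [abs_le]; omega)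
          (by rw [abs_le]; omega) (by omega)
        convert this using 3 <;> (push_cast; ring)

end Fill

/-! ### Correctness of the completed labeling -/

section FillCorrect

variable {P : LCL} {K : ℕ} {T : AnchorLine P}

theorem gap_eq {i δ : ℤ} {m : ℕ} (h1 : 1 ≤ m) (h2 : m ≤ 2 * K + 1) (h3 : (T (i + δ * m)).2.2)
    (h4 : ∀ k : ℕ, 1 ≤ k → k < m → ¬ (T (i + δ * k)).2.2) : gap K T i δ = m := by
  refine le_antisymm (Nat.sInf_le ⟨h1, h2, h3⟩) (le_csInf ⟨m, h1, h2, h3⟩ fun k hk => ?_)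
  by_contra hlt
  exact h4 k hk.1 (by omega) hk.2.2

theorem gap_spec (hdense : ∀ i, ∃ d : ℤ, |d| ≤ K ∧ (T (i + d)).2.2) (i : ℤ) {δ : ℤ}
    (hδ : δ = 1 ∨ δ = -1) :
    1 ≤ gap K T i δ ∧ (T (i + δ * gap K T i δ)).2.2 ∧
      ∀ k : ℕ, 1 ≤ k → k < gap K T i δ → ¬ (T (i + δ * k)).2.2 := by
  have hne : {g : ℕ | 1 ≤ g ∧ g ≤ 2 * K + 1 ∧ (T (i + δ * g)).2.2}.Nonempty := by
    -- All places within `K` of the one that is `K + 1` steps ahead lie between `1` and `2 * K + 1`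
    -- steps ahead.
    obtain ⟨d, hd, ha⟩ := hdense (i + δ * (K + 1))
    have hd' : |δ * d| ≤ K := by rwa [abs_sign_mul hδ]
    rw [abs_le] at hd'
    refine ⟨(K + 1 + δ * d).toNat, by omega, by omega, ?_⟩
    rw [Int.toNat_of_nonneg (by omega)]
    convert ha using 3
    rw [mul_add, ← mul_assoc, int_sign_mul_self hδ, one_mul, ← add_assoc]
  have hle := gap_le K T i δ
  obtain ⟨h1, -, h3⟩ := Nat.sInf_mem hne
  exact ⟨h1, h3, fun k hk hlt ha => Nat.notMem_of_lt_sInf hlt ⟨hk, by omega, ha⟩⟩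

theorem lt_gap (hdense : ∀ i, ∃ d : ℤ, |d| ≤ K ∧ (T (i + d)).2.2)
    (hsparse : ∀ i i', (T i).2.2 → (T i').2.2 → i ≠ i' → (K : ℤ) < |i - i'|) {i δ : ℤ}
    (hδ : δ = 1 ∨ δ = -1) (hi : (T i).2.2) : K < gap K T i δ := by
  obtain ⟨h1, h2, -⟩ := gap_spec hdense i hδ
  have hne : i ≠ i + δ * gap K T i δ := by rcases hδ with rfl | rfl <;> omega
  have := hsparse _ _ hi h2 hne
  rw [sub_add_cancel_left, abs_neg, abs_sign_mul hδ, Nat.abs_cast] at this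
  exact_mod_cast this

variable {cyc : Bool} {f : List (Option (Fin P.numIn)) → Option (Fin P.numIn) →
  List (Option (Fin P.numIn)) → P.State}

/-- The hypotheses under which the window states of all places can be chosen: the anchors are
sparse and dense, and the letters are those of a long cycle or path. -/
structure WellAnchored (cyc : Bool) (K : ℕ) (T : AnchorLine P) : Prop where
  sparse : ∀ i i', (T i).2.2 → (T i').2.2 → i ≠ i' → (K : ℤ) < |i - i'|
  dense : ∀ i, ∃ d : ℤ, |d| ≤ (K : ℤ) ∧ (T (i + d)).2.2
  legal : ∀ i, Legal cyc (lineSegment (fun j => (T j).2.1) i (6 * K + 3))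

theorem Legal.lineSegment_le {α : Type*} {cyc : Bool} {y : ℤ → Option α} {i : ℤ} {m m' : ℕ}
    (h : Legal cyc (lineSegment y i m)) (hm : m' ≤ m) : Legal cyc (lineSegment y i m') := by
  obtain ⟨d, rfl⟩ := Nat.exists_eq_add_of_le hm
  rw [lineSegment_add] at h
  exact h.sublist (List.sublist_append_left _ _)

variable (h : WellAnchored cyc K T)

include h

/-- Gaps exceed `K`, so the words between anchors have length at least `K`, the length required by
feasibility. If the anchor is oriented backwards, feasibility is applied to the reversed word. -/
theorem WellAnchored.nodeOk_anchorState (hK : K = 2 * P.pumpLength) (hf : P.IsFeasible cyc f) {i : ℤ} (hi : (T i).2.2) :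
    P.NodeOk (T i).2.1 (anchorState f K T i) := by
  have hr := lt_gap h.dense h.sparse (Or.inl rfl) hi
  have hl := lt_gap h.dense h.sparse (Or.inr rfl) hi
  have hr' := gap_le K T i 1
  have hl' := gap_le K T i (-1)
  have hleg : Legal cyc ((leftWord K T i).reverse ++ (T i).2.1 :: rightWord K T i) := by
    have h0 := h.legal (i - gap K T i (-1) + 1)
    have h1 := h0.lineSegment_le (m' := (gap K T i (-1) - 1) + ((gap K T i 1 - 1) + 1)) (by omega)
    rw [lineSegment_add, lineSegment_succ] at h1
    rw [leftWord, rightWord, List.reverse_reverse]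
    have e1 : i - (gap K T i (-1) : ℤ) + 1 + ((gap K T i (-1) - 1 : ℕ) : ℤ) = i := by
      rw [Nat.cast_sub (by omega)]
      push_cast
      ring
    rw [e1] at h1
    exact h1
  have hlen1 : 2 * P.pumpLength ≤ (leftWord K T i).length := by
    rw [leftWord, List.length_reverse, length_lineSegment]; omega
  have hlen2 : 2 * P.pumpLength ≤ (rightWord K T i).length := by
    rw [rightWord, length_lineSegment]; omega
  unfold anchorState LCL.orient
  split_ifs
  · exact hf.1 _ _ _ hlen1 hlen2 hleg
  · refine (hf.1 _ _ _ hlen2 hlen1 ?_).rev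
    have := hleg.reverse
    simpa using this

theorem WellAnchored.chain (hK : K = 2 * P.pumpLength) (hf : P.IsFeasible cyc f) {l : ℤ} (hl : (T l).2.2) :
    Chain P.NodeOk P.EdgeOk
      (lineSegment (fun j => (T j).2.1) (l + 1) (gap K T l 1 - 1))
      (anchorState f K T l)
      (anchorState f K T (l + gap K T l 1)) := by
  obtain ⟨-, hra, hno⟩ := gap_spec h.dense l (Or.inl rfl)
  rw [one_mul] at hra
  set g := gap K T l 1 with hg
  have hgK := lt_gap h.dense h.sparse (Or.inl rfl) hl
  have hgl := lt_gap h.dense h.sparse (Or.inr rfl) hl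
  have hgr := lt_gap h.dense h.sparse (Or.inl rfl) hra
  have hg' := gap_le K T l 1
  have hgl' := gap_le K T l (-1)
  have hgr' := gap_le K T (l + g) 1
  have hback : gap K T (l + g) (-1) = g := by
    refine gap_eq (by omega) hg' (by simpa using hl) fun k hk hk' => ?_
    have := hno (g - k) (by omega) (by omega)
    rw [Nat.cast_sub hk'.le] at this
    convert this using 4
    ring
  have hw : leftWord K T (l + g) = (rightWord K T l).reverse := by
    rw [leftWord, rightWord, hback, add_sub_cancel_right]
  have hleg : Legal cyc ((leftWord K T l).reverse ++ (T l).2.1 ::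
      (rightWord K T l ++ (T (l + g)).2.1 :: rightWord K T (l + g))) := by
    have h0 := h.legal (l - gap K T l (-1) + 1)
    -- The block and its two neighboring blocks together span the sum of three gaps minus one, at
    -- most `6 * K + 2` letters.
    have h1 := h0.lineSegment_le
      (m' := (gap K T l (-1) - 1) + (((g - 1) + ((gap K T (l + g) 1 - 1) + 1)) + 1)) (by omega)
    rw [lineSegment_add, lineSegment_succ, lineSegment_add, lineSegment_succ] at h1
    rw [leftWord, rightWord, rightWord, List.reverse_reverse]
    have e1 : l - (gap K T l (-1) : ℤ) + 1 + ((gap K T l (-1) - 1 : ℕ) : ℤ) = l := by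
      rw [Nat.cast_sub (by omega)]
      push_cast
      ring
    have e2 : l + 1 + ((g - 1 : ℕ) : ℤ) = l + g := by
      rw [Nat.cast_sub (by omega)]
      push_cast
      ring
    rw [e1, e2] at h1
    exact h1
  have := hf.2 (leftWord K T l) (T l).2.1 (rightWord K T l) (T (l + g)).2.1 (rightWord K T (l + g))
    (by rw [leftWord, List.length_reverse, length_lineSegment]; omega)
    (by rw [rightWord, length_lineSegment]; omega)
    (by rw [rightWord, length_lineSegment]; omega) hleg
    (decide ((T (l - 1)).1 < (T (l + 1)).1)) (decide ((T (l + g - 1)).1 < (T (l + g + 1)).1))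
  rw [← hw] at this
  exact this

theorem WellAnchored.orientedBlock_spec (hK : K = 2 * P.pumpLength) (hf : P.IsFeasible cyc f) {l : ℤ} (hl : (T l).2.2) :
    let g := gap K T l 1
    orientedBlock f K T l g 0 = anchorState f K T l ∧
    orientedBlock f K T l g g = anchorState f K T (l + g) ∧
    (∀ k < g, P.EdgeOk (orientedBlock f K T l g k) (orientedBlock f K T l g (k + 1))) ∧
    ∀ k, 0 < k → k < g → P.NodeOk (T (l + k)).2.1 (orientedBlock f K T l g k) := by
  intro g
  have hch : Chain P.NodeOk P.EdgeOk (lineSegment (fun j => (T j).2.1) (l + 1) (g - 1))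
      (anchorState f K T l) (anchorState f K T (l + g)) := h.chain hK hf hl
  have hg : 1 ≤ g := (gap_spec h.dense l (Or.inl rfl)).1
  have hlen : (lineSegment (fun j => (T j).2.1) (l + 1) (g - 1)).length + 1 = g := by
    rw [length_lineSegment]; omega
  by_cases hlt : (T l).1 < (T (l + g)).1
  · have e : ∀ k, orientedBlock f K T l g k =
        blockStates (lineSegment (fun j => (T j).2.1) (l + 1) (g - 1)) (anchorState f K T l)
          (anchorState f K T (l + g)) k := fun k => if_pos hlt
    simp only [e]
    obtain ⟨h1, h2, h3, h4⟩ := blockStates_spec hch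
    rw [hlen] at h2
    refine ⟨h1, h2, fun k hk => h3 k (by omega), fun k hk hkg => ?_⟩
    have := h4 (k - 1) (by omega)
    rw [getElem_lineSegment, Nat.sub_add_cancel hk, Nat.cast_sub hk] at this
    convert this using 4
    push_cast
    ring
  · have e : ∀ k, orientedBlock f K T l g k = P.revState
        (blockStates (lineSegment (fun j => (T j).2.1) (l + 1) (g - 1)).reverse
          (P.revState (anchorState f K T (l + g))) (P.revState (anchorState f K T l)) (g - k)) :=
      fun k => if_neg hlt
    simp only [e]
    have hch' := chain_reverse (rev := P.revState) (fun _ _ h => LCL.NodeOk.rev h)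
      (fun _ _ h => LCL.EdgeOk.rev h) hch
    obtain ⟨h1, h2, h3, h4⟩ := blockStates_spec hch'
    rw [List.length_reverse, hlen] at h2
    rw [List.length_reverse] at h3
    refine ⟨?_, ?_, fun k hk => ?_, fun k hk hkg => ?_⟩
    · rw [Nat.sub_zero]
      exact (congrArg P.revState h2).trans (P.revState_revState _)
    · rw [Nat.sub_self]
      exact (congrArg P.revState h1).trans (P.revState_revState _)
    · have := (h3 (g - (k + 1)) (by omega)).rev
      rwa [show g - (k + 1) + 1 = g - k by omega] at this
    · have hlt' : g - k - 1 < (lineSegment (fun j => (T j).2.1) (l + 1) (g - 1)).reverse.length := by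
        rw [List.length_reverse]; omega
      have := (h4 (g - k - 1) hlt').rev
      rw [List.getElem_reverse, getElem_lineSegment, length_lineSegment,
        show g - k - 1 + 1 = g - k by omega, show g - 1 - 1 - (g - k - 1) = k - 1 by omega,
        Nat.cast_sub hk] at this
      convert this using 4
      push_cast
      ring

/-- Every place inside a block computes the same two bounding anchors, hence the same filling; at
the two ends the filling meets the states of the anchors. -/
theorem WellAnchored.fillState_eq (hK : K = 2 * P.pumpLength) (hf : P.IsFeasible cyc f) {l : ℤ} (hl : (T l).2.2) {k : ℕ}
    (hk : k ≤ gap K T l 1) :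
    fillState f K T (l + k) =
      orientedBlock f K T l (gap K T l 1) k := by
  obtain ⟨h1, h2, -, -⟩ := h.orientedBlock_spec hK hf hl
  obtain ⟨hpos, hra, hno⟩ := gap_spec h.dense l (Or.inl rfl)
  rw [one_mul] at hra
  have hle := gap_le K T l 1
  unfold fillState
  rcases Nat.eq_zero_or_pos k with rfl | hk0
  · rw [Nat.cast_zero, add_zero, if_pos hl, h1]
  rcases hk.eq_or_lt with rfl | hlt
  · rw [if_pos hra, h2]
  have hna : ¬ (T (l + k)).2.2 := by simpa using hno k hk0 hlt
  have e1 : gap K T (l + k) (-1) = k := by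
    refine gap_eq hk0 (by omega) (by simpa using hl) fun m hm hm' => ?_
    have := hno (k - m) (by omega) (by omega)
    rw [Nat.cast_sub hm'.le] at this
    convert this using 4
    ring
  have e2 : gap K T (l + k) 1 = gap K T l 1 - k := by
    refine gap_eq (by omega) (by omega) ?_ fun m hm hm' => ?_
    · rw [Nat.cast_sub hk]
      convert hra using 3
      ring
    · have := hno (k + m) (by omega) (by omega)
      convert this using 4
      push_cast
      ring
  rw [if_neg hna, e1, e2, Nat.add_sub_cancel' hk, add_sub_cancel_right]

theorem WellAnchored.fillState_spec (hK : K = 2 * P.pumpLength) (hf : P.IsFeasible cyc f) (i : ℤ) :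
    P.NodeOk (T i).2.1 (fillState f K T i) ∧
      P.EdgeOk (fillState f K T i) (fillState f K T (i + 1)) := by
  obtain ⟨l, k, hl, hk, rfl⟩ : ∃ (l : ℤ) (k : ℕ), (T l).2.2 ∧
      k < gap K T l 1 ∧ i = l + k := by
    by_cases hi : (T i).2.2
    · exact ⟨i, 0, hi, (gap_spec h.dense i (Or.inl rfl)).1, by simp⟩
    · obtain ⟨h1, h2, h3⟩ := gap_spec h.dense i (Or.inr rfl)
      refine ⟨_, gap K T i (-1), h2, ?_, by ring⟩
      by_contra hlt
      obtain ⟨h4, h5, -⟩ := gap_spec h.dense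
        (i + -1 * (gap K T i (-1) : ℤ)) (Or.inl rfl)
      set m := gap K T (i + -1 * (gap K T i (-1) : ℤ)) 1
      set g := gap K T i (-1)
      rcases (not_lt.1 hlt).eq_or_lt with he | hlt'
      · apply hi
        convert h5 using 3
        rw [he]
        ring
      · apply h3 (g - m) (by omega) (by omega)
        rw [Nat.cast_sub hlt'.le]
        convert h5 using 3
        ring
  obtain ⟨h1, h2, h3, h4⟩ := h.orientedBlock_spec hK hf hl
  have e1 := h.fillState_eq hK hf hl hk.le
  have e2 := h.fillState_eq hK hf hl (k := k + 1) hk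
  rw [Nat.cast_succ, ← add_assoc] at e2
  constructor
  · rcases Nat.eq_zero_or_pos k with rfl | hk0
    · rw [e1, h1, Nat.cast_zero, add_zero]
      exact h.nodeOk_anchorState hK hf hl
    · rw [e1]
      exact h4 k hk0 hk
  · rw [e1, e2]
    exact h3 k hk

end FillCorrect

/-- Consistent overlaps propagate the entries diagonally, so the middle entries determine all
states. -/
theorem LCL.state_eq_window {P : LCL} {s : ℤ → P.State} (h : ∀ i, P.EdgeOk (s i) (s (i + 1)))
    (i : ℤ) : s i = window P.radius (fun j => s j ⟨P.radius, by omega⟩) i := by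
  have key : ∀ (m : ℕ) (i : ℤ) (k : ℕ) (hk : k + m < 2 * P.radius + 1),
      s i ⟨k + m, hk⟩ = s (i + m) ⟨k, by omega⟩ := by
    intro m
    induction m with
    | zero => intro i k hk; simp
    | succ m ih =>
      intro i k hk
      have := h i ⟨k + m, by omega⟩
      simp only [Fin.succ_mk, Fin.castSucc_mk] at this
      rw [show (⟨k + (m + 1), hk⟩ : Fin (2 * P.radius + 1)) = ⟨k + m + 1, by omega⟩ from rfl, this,
        ih]
      congr 1
      push_cast
      ring
  funext k
  rw [window]
  have hk := k.2
  rcases le_total P.radius k with hle | hle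
  · have := key (k - P.radius) i P.radius (by omega)
    rw [Nat.cast_sub hle] at this
    convert this using 2
    · ext; simp; omega
    · ring
  · have := key (P.radius - k) (i - P.radius + k) k (by omega)
    rw [Nat.cast_sub hle] at this
    rw [show i - (P.radius : ℤ) + k + (P.radius - k) = i by ring] at this
    rw [← this]
    congr 1
    ext; simp; omega

/-! ## Completing a labeling of a cycle or path -/

section Host

variable {cyc : Bool} {n : ℕ}

theorem nodeAt_add_congr {i : ℤ} {u : Fin n} (hi : nodeAt cyc n i = some u) (k : ℤ) :
    nodeAt cyc n (i + k) = nodeAt cyc n (u + k) := by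
  rw [nodeAt_eq_some] at hi
  ext w
  rw [nodeAt_eq_some, nodeAt_eq_some]
  refine and_congr ?_ ?_
  · rw [show i + k - w = (u + k - w) + (i - u) by ring]
    exact dvd_add_left hi.1
  · rcases hi.2 with hc | hc
    · simp [hc]
    · rw [hc]

/-- The distance of a place outside of a path from the path. -/
def outerDist (n : ℕ) (i : ℤ) : ℤ :=
  if i < 0 then -i else i - n + 1

/-- The identifiers of the places of a line: those of the nodes of a cycle or path, and virtual
identifiers beyond the ends of a path. -/
def hostIds (cyc : Bool) (b m : ℕ) {n : ℕ} (ids : Fin n → ℕ) (i : ℤ) : ℕ :=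
  match nodeAt cyc n i with
  | some u => ids u
  | none => b + (outerDist n i % m).toNat

/-- A window that leaves the path also contains the end where it leaves, and it is too short to
contain both ends. The distance beyond the end can thus be read off without knowing which end it is.
-/
theorem outerDist_agree {t : ℕ} {i j ε : ℤ} (hn : 2 * t + 2 ≤ n) (hε : ε = 1 ∨ ε = -1)
    (hi : 0 ≤ i ∧ i < n) (hj : 0 ≤ j ∧ j < n)
    (h : ∀ k : ℤ, |k| ≤ t → ((0 ≤ i + k ∧ i + k < n) ↔ (0 ≤ j + ε * k ∧ j + ε * k < n)))
    {k : ℤ} (hk : |k| ≤ t) (hout : ¬ (0 ≤ i + k ∧ i + k < n)) :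
    outerDist n (i + k) = outerDist n (j + ε * k) := by
  have hk' := abs_le.1 hk
  have h0 := h k hk
  unfold outerDist
  by_cases hneg : i + k < 0
  · have h1 := h (-1 - i) (by rw [abs_le]; omega)
    have h2 := h (-i) (by rw [abs_le]; omega)
    rcases hε with rfl | rfl <;> split_ifs <;> omega
  · have h1 := h (n - i) (by rw [abs_le]; omega)
    have h2 := h (n - 1 - i) (by rw [abs_le]; omega)
    rcases hε with rfl | rfl <;> split_ifs <;> omega

theorem hostIds_agree {α : Type*} {b m t : ℕ} {ids ids' : Fin n → ℕ} {inp inp' : Fin n → α}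
    {i j ε : ℤ} (hn : 2 * t + 2 ≤ n) (hi : (nodeAt cyc n i).isSome) (hj : (nodeAt cyc n j).isSome)
    (h : Agree t (hostLine cyc fun u => (ids u, inp u)) i
      (hostLine cyc fun u => (ids' u, inp' u)) j ε) :
    Agree t (hostIds cyc b m ids) i (hostIds cyc b m ids') j ε ∧
      Agree t (hostLine cyc inp) i (hostLine cyc inp') j ε := by
  refine ⟨⟨h.1, fun k hk => ?_⟩, ⟨h.1, fun k hk => ?_⟩⟩
  · have h1 := h.2 k hk
    have h3 : ∀ k : ℤ, |k| ≤ t → (nodeAt cyc n (i + k)).isSome = (nodeAt cyc n (j + ε * k)).isSome :=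
      fun k hk => by
        rw [← hostLine_isSome (l := fun u => (ids u, inp u)), h.2 k hk, hostLine_isSome]
    have h4 := h3 k hk
    unfold hostLine at h1
    unfold hostIds
    cases hu : nodeAt cyc n (i + k) with
    | some u =>
      rw [hu] at h1
      cases hw : nodeAt cyc n (j + ε * k) with
      | none => simp [hw] at h1
      | some w =>
        rw [hw] at h1
        simp only [Option.map_some, Option.some.injEq, Prod.mk.injEq] at h1
        exact h1.1
    | none =>
      rw [hu] at h4
      cases hw : nodeAt cyc n (j + ε * k) with
      | some w => simp [hw] at h4
      | none =>
        cases cyc with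
        | true =>
          have := nodeAt_cycle_isSome (n := n) (by omega) (i := i + k)
          simp [hu] at this
        | false =>
          rw [nodeAt_path_isSome] at hi hj
          simp only
          rw [outerDist_agree hn h.1 hi hj (fun k hk => ?_) hk]
          · rw [← nodeAt_path_isSome, hu]
            simp
          · rw [← nodeAt_path_isSome, ← nodeAt_path_isSome, h3 k hk]
  · have := congrArg (Option.map Prod.snd) (h.2 k hk)
    simpa [hostLine, Function.comp_def] using this

/-- Virtual identifiers start at `b`, above all real ones. On one side of the path they repeat only
after `m > K` places, and places on opposite sides are more than `n > K` apart. -/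
theorem hostIds_proper {b m K : ℕ} {ids : Fin n → ℕ} (hids : Function.Injective ids)
    (hb : ∀ u, ids u < b) (hm : K < m) (hn : K < n) : ProperColoring K (hostIds cyc b m ids) := by
  intro i j hij hd
  unfold hostIds
  cases hu : nodeAt cyc n i with
  | some u =>
    cases hw : nodeAt cyc n j with
    | some w =>
      intro h
      obtain rfl := hids h
      exact hij (eq_of_nodeAt_eq hu hw (by omega))
    | none =>
      have := hb u
      simp only
      omega
  | none =>
    cases hw : nodeAt cyc n j with
    | some w =>
      have := hb w
      simp only
      omega
    | none =>
      simp only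
      intro h
      have hm' : (0 : ℤ) < m := by omega
      have h1 := Int.emod_nonneg (outerDist n i) hm'.ne'
      have h2 := Int.emod_nonneg (outerDist n j) hm'.ne'
      have h3 : outerDist n i % m = outerDist n j % m := by omega
      cases cyc with
      | true =>
        have := nodeAt_cycle_isSome (n := n) (by omega) (i := i)
        simp [hu] at this
      | false =>
        have hi : ¬ (0 ≤ i ∧ i < n) := by rw [← nodeAt_path_isSome, hu]; simp
        have hj : ¬ (0 ≤ j ∧ j < n) := by rw [← nodeAt_path_isSome, hw]; simp
        rw [abs_le] at hd
        have h4 : (m : ℤ) ∣ outerDist n i - outerDist n j :=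
          Int.dvd_of_emod_eq_zero (Int.emod_eq_emod_iff_emod_sub_eq_zero.1 h3)
        have h5 := Int.eq_zero_of_abs_lt_dvd h4 (by
          rw [abs_lt]
          unfold outerDist
          split_ifs <;> omega)
        unfold outerDist at h5
        split_ifs at h5 <;> omega

theorem hostIds_lt {b m : ℕ} {ids : Fin n → ℕ} (hb : ∀ u, ids u < b) (hm : 0 < m) (i : ℤ) :
    hostIds cyc b m ids i < b + m := by
  unfold hostIds
  cases hu : nodeAt cyc n i with
  | some u =>
    have := hb u
    simp only
    omega
  | none =>
    have := Int.emod_lt_of_pos (outerDist n i) (b := m) (by omega)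
    simp only
    omega

/-- A segment of at most `n` places cannot leave the path at both ends; the sign of `i` tells at
which end it may leave. -/
theorem legal_lineSegment_hostLine {α : Type*} (inp : Fin n → α) (i : ℤ) {m : ℕ} (hn : 0 < n)
    (hm : m ≤ n) : Legal cyc (lineSegment (hostLine cyc inp) i m) := by
  cases cyc with
  | true =>
    simp only [Legal, if_true, lineSegment, List.mem_map]
    rintro a ⟨k, -, rfl⟩
    rw [hostLine_isSome]
    exact nodeAt_cycle_isSome hn
  | false =>
    simp only [Legal, Bool.false_eq_true, if_false, lineSegment, List.pairwise_map,
      hostLine_isSome, nodeAt_path_isSome]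
    rcases le_or_gt 0 i with hi | hi
    · right
      exact List.pairwise_lt_range.imp fun h => by omega
    · left
      refine List.pairwise_lt_range.imp_of_mem fun ha hb h => ?_
      rw [List.mem_range] at ha hb
      omega

variable {P : LCL}

/-- The identifiers, letters and anchors along a cycle or path. -/
def hostAnchors (cyc : Bool) (c J K : ℕ) {n : ℕ} (ids : Fin n → ℕ) (inp : Fin n → Fin P.numIn) :
    AnchorLine P := fun i =>
  (hostIds cyc (n ^ c) (4 * K + 5) ids i, hostLine cyc inp i,
    anchorSet K c J (hostIds cyc (n ^ c) (4 * K + 5) ids) i)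

/-- The distance up to which a node has to look. -/
def lookRadius (K c J : ℕ) : ℕ :=
  4 * K + 2 + (2 ^ finalBits K c * K + J * K)

theorem hostAnchors_agree {c J K : ℕ} {ids ids' : Fin n → ℕ} {inp inp' : Fin n → Fin P.numIn}
    {i j ε : ℤ} (hn : 2 * lookRadius K c J + 2 ≤ n) (hi : (nodeAt cyc n i).isSome)
    (hj : (nodeAt cyc n j).isSome)
    (h : Agree (lookRadius K c J) (hostLine cyc fun u => (ids u, inp u)) i
      (hostLine cyc fun u => (ids' u, inp' u)) j ε) :
    Agree (4 * K + 2) (hostAnchors cyc c J K ids inp) i (hostAnchors cyc c J K ids' inp') j ε := by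
  obtain ⟨h1, h2⟩ := hostIds_agree (b := n ^ c) (m := 4 * K + 5) hn hi hj h
  have h3 := (localMap_anchorSet K c J).agree h1
  have hle : 4 * K + 2 ≤ lookRadius K c J := Nat.le_add_right _ _
  exact ⟨h.1, fun k hk => Prod.ext ((h1.mono hle).2 k hk)
    (Prod.ext ((h2.mono hle).2 k hk) (h3.2 k hk))⟩

/-- From `n ≤ 2 ^ tower J` the real identifiers take `c * tower J` bits; the occurrence of `c` in
`finalBits` absorbs this factor, and `4 * K + 5` accounts for the virtual identifiers. -/
theorem idBound_le {n c K J : ℕ} (hc : 1 ≤ c) (hJ : n ≤ tower (J + 1)) :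
    n ^ c + (4 * K + 5) ≤ 2 ^ (finalBits K c * tower J) := by
  have ht := tower_pos J
  have h1 : n ^ c ≤ 2 ^ (c * tower J + (4 * K + 5)) :=
    calc n ^ c ≤ (2 ^ tower J) ^ c := Nat.pow_le_pow_left hJ c
      _ = 2 ^ (c * tower J) := by rw [← pow_mul, mul_comm]
      _ ≤ _ := Nat.pow_le_pow_right (by norm_num) (by omega)
  have h2 : 4 * K + 5 ≤ 2 ^ (c * tower J + (4 * K + 5)) :=
    (Nat.lt_two_pow_self (n := 4 * K + 5)).le.trans (Nat.pow_le_pow_right (by norm_num) (by omega))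
  have h3 : 2 * (2 * K + c) + 4 < finalBits K c := Nat.lt_two_pow_self
  have h4 : c * tower J + (4 * K + 5) + 1 ≤ finalBits K c * tower J := by
    have : (c + (4 * K + 6)) * tower J ≤ finalBits K c * tower J :=
      Nat.mul_le_mul_right _ (by omega)
    nlinarith
  calc _ ≤ 2 ^ (c * tower J + (4 * K + 5) + 1) := by rw [pow_succ]; omega
    _ ≤ _ := Nat.pow_le_pow_right (by norm_num) h4

theorem wellAnchored_hostAnchors {c J K : ℕ} {ids : Fin n → ℕ} (hids : Function.Injective ids)
    (hb : ∀ u, ids u < n ^ c) (inp : Fin n → Fin P.numIn) (hc : 1 ≤ c) (hJ : n ≤ tower (J + 1))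
    (hn : 6 * K + 5 ≤ n) : WellAnchored cyc K (hostAnchors (P := P) cyc c J K ids inp) := by
  have hp : ProperColoring K (hostIds cyc (n ^ c) (4 * K + 5) ids) :=
    hostIds_proper hids hb (by omega) (by omega)
  have hlt : ∀ i, hostIds cyc (n ^ c) (4 * K + 5) ids i < 2 ^ (finalBits K c * tower J) :=
    fun i => (hostIds_lt hb (by omega) i).trans_le (idBound_le hc hJ)
  exact ⟨fun i i' hi hi' hne => anchorSet_sparse hp hlt hi hi' hne, fun i => anchorSet_dense hp hlt i,
    fun i => legal_lineSegment_hostLine inp i (by omega) (by omega)⟩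

theorem LCL.act_mid (P : LCL) (ε : ℤ) (q : P.State) :
    P.act ε q ⟨P.radius, by omega⟩ = q ⟨P.radius, by omega⟩ := by
  unfold LCL.act
  split_ifs
  · rfl
  · rw [LCL.revState, P.rev_mid]

/-- The middle entry of a state is fixed by reversal, so the label of a node depends on its window
but not on the direction in which it is read. -/
theorem fillState_mid_agree {f : List (Option (Fin P.numIn)) → Option (Fin P.numIn) →
    List (Option (Fin P.numIn)) → P.State} {c J K : ℕ} {ids ids' : Fin n → ℕ}
    {inp inp' : Fin n → Fin P.numIn} (hids : Function.Injective ids) (hb : ∀ u, ids u < n ^ c)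
    (hc : 1 ≤ c) (hJ : n ≤ tower (J + 1)) (hn6 : 6 * K + 5 ≤ n)
    (hn : 2 * lookRadius K c J + 2 ≤ n)
    {i j ε : ℤ} (hi : (nodeAt cyc n i).isSome) (hj : (nodeAt cyc n j).isSome)
    (h : Agree (lookRadius K c J) (hostLine cyc fun u => (ids u, inp u)) i
      (hostLine cyc fun u => (ids' u, inp' u)) j ε) :
    fillState f K (hostAnchors cyc c J K ids inp) i ⟨P.radius, by omega⟩ =
      fillState f K (hostAnchors cyc c J K ids' inp') j ⟨P.radius, by omega⟩ := by
  -- Two offsets of absolute value at most `2 * K + 2` differ by at most `4 * K + 4`; this is why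
  -- virtual identifiers have period `4 * K + 5`.
  have hp : ProperColoring (4 * K + 4) (hostIds cyc (n ^ c) (4 * K + 5) ids) := by
    refine hostIds_proper hids hb (by omega) ?_
    have : 4 * K + 2 ≤ lookRadius K c J := Nat.le_add_right _ _
    omega
  rw [fillState_agree (hostAnchors_agree hn hi hj h) (fun d d' hd hd' hne => ?_)
    (gap_spec (wellAnchored_hostAnchors (cyc := cyc) hids hb inp hc hJ hn6).dense i
      (Or.inl rfl)).1, P.act_mid]
  rw [abs_le] at hd hd'
  exact hp _ _ (by omega) (by rw [abs_le]; push_cast; omega)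

theorem exists_solves_of_isFeasible {f : List (Option (Fin P.numIn)) → Option (Fin P.numIn) →
    List (Option (Fin P.numIn)) → P.State} (hf : P.IsFeasible cyc f) {c J : ℕ} (hc : 1 ≤ c)
    (hJ : n ≤ tower (J + 1)) (hr : 2 * P.radius + 2 ≤ n)
    (hn6 : 6 * (2 * P.pumpLength) + 5 ≤ n) (hn : 2 * lookRadius (2 * P.pumpLength) c J + 2 ≤ n) :
    ∃ A : LocalAlgorithm, A.rounds n = lookRadius (2 * P.pumpLength) c J ∧
      A.Solves P c (hostGraph cyc n) := by
  classical
  set K := 2 * P.pumpLength with hK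
  set t := lookRadius K c J with ht
  let S : (Fin n → ℕ) → (Fin n → Fin P.numIn) → ℤ → P.State := fun ids inp =>
    fillState f K (hostAnchors cyc c J K ids inp)
  let lab : (Fin n → ℕ) → (Fin n → Fin P.numIn) → ℤ → Option (Fin P.numIn × Fin (P.numOut + 1)) :=
    fun ids inp i => S ids inp i ⟨P.radius, by omega⟩
  let C : View → (Fin n → ℕ) × (Fin n → Fin P.numIn) × Fin n → Prop := fun w x =>
    Function.Injective x.1 ∧ (∀ u, x.1 u < n ^ c) ∧
      view (hostGraph cyc n) x.1 (fun u => (x.2.1 u : ℕ)) t x.2.2 = w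
  -- A node picks any labeled graph in which its view occurs and outputs the label of that place.
  -- The pick is immaterial: equal views mean equal windows up to reflection, and these give equal
  -- labels.
  refine ⟨⟨fun _ => t, fun w => if h : ∃ x, C w x then
    ((lab h.choose.1 h.choose.2.1 h.choose.2.2).map fun p => (p.2 : ℕ)).getD 0 else 0⟩, rfl, ?_⟩
  intro ids hids hb inp
  have hspec := fun i => (wellAnchored_hostAnchors (cyc := cyc) hids hb inp hc hJ hn6).fillState_spec
    hK hf i
  have hfst : ∀ i, (lab ids inp i).map Prod.fst = hostLine cyc inp i := fun i => (hspec i).1.1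
  have hlt : ∀ v : Fin n, ∃ p, lab ids inp v = some p ∧ p.1 = inp v ∧ (p.2 : ℕ) < P.numOut := by
    intro v
    have h1 := hfst v
    have h2 : (hostLine cyc inp v).isSome := by rw [hostLine, nodeAt_self]; rfl
    rw [hostLine, nodeAt_self, Option.map_some, Option.map_eq_some_iff] at h1
    obtain ⟨p, hp, hp'⟩ := h1
    exact ⟨p, hp, hp', ((hspec v).1.2 h2).1 p hp⟩
  choose p hp1 hp2 hp3 using hlt
  refine ⟨fun v => ⟨(p v).2, hp3 v⟩, fun v => ?_, fun v => ?_⟩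
  · have hex : ∃ x, C (view (hostGraph cyc n) ids (fun u => (inp u : ℕ)) t v) x :=
      ⟨(ids, inp, v), hids, hb, rfl⟩
    simp only
    rw [dif_pos hex]
    obtain ⟨h1, h2, h3⟩ := hex.choose_spec
    set x := hex.choose with hx
    have hv1 := isLineView_view (inp := inp) hids hn (nodeAt_self (cyc := cyc) v)
    have hv2 := isLineView_view (inp := x.2.1) h1 hn (nodeAt_self (cyc := cyc) x.2.2)
    rw [h3] at hv2
    have hinj : ∀ (ids : Fin n → ℕ) (inp : Fin n → Fin P.numIn) (v : Fin n),
        Function.Injective ids → ∀ k k' : ℤ, |k| ≤ t → |k'| ≤ t → ∀ p p',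
        hostLine cyc (fun u => (ids u, inp u)) (v + k) = some p →
        hostLine cyc (fun u => (ids u, inp u)) (v + k') = some p' → p.1 = p'.1 → k = k' := by
      intro ids inp v hids k k' hk hk' p p' hp hp' he
      rw [hostLine_eq_some] at hp hp'
      obtain ⟨u, hu, rfl⟩ := hp
      obtain ⟨u', hu', rfl⟩ := hp'
      obtain rfl := hids he
      rw [abs_le] at hk hk'
      have := eq_of_nodeAt_eq hu hu' (by rw [abs_lt]; omega)
      omega
    have hbetween : ∀ (ids : Fin n → ℕ) (inp : Fin n → Fin P.numIn) (a b c : ℤ), a ≤ b → b ≤ c →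
        (hostLine cyc (fun u => (ids u, inp u)) a).isSome →
        (hostLine cyc (fun u => (ids u, inp u)) c).isSome →
        (hostLine cyc (fun u => (ids u, inp u)) b).isSome := by
      intro ids inp a b c hab hbc ha hc
      rw [hostLine_isSome] at *
      exact nodeAt_isSome_between ha hc hab hbc
    obtain ⟨ε, hε⟩ := exists_agree_of_isLineView hv1 hv2 (hinj ids inp v hids)
      (hinj x.1 x.2.1 x.2.2 h1) (hbetween _ _) (hbetween _ _)
    have := fillState_mid_agree (f := f) hids hb hc hJ hn6 hn (by rw [nodeAt_self]; rfl)
      (by rw [nodeAt_self]; rfl) hε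
    have hlab : lab x.1 x.2.1 x.2.2 = some (p v) := this.symm.trans (hp1 v)
    rw [hlab]
    rfl
  · rw [exists_matches_iff_accepts hr]
    have h2 : (hostLine cyc inp v).isSome := by rw [hostLine, nodeAt_self]; rfl
    have h3 := ((hspec v).1.2 h2).2
    convert h3 using 1
    funext k
    rw [LCL.state_eq_window (fun i => (hspec i).2) v]
    simp only [window]
    set i : ℤ := v - P.radius + (k : ℕ) with hi
    change hostLine cyc _ i = (lab ids inp i).map _
    cases hu : nodeAt cyc n i with
    | none =>
      have := hfst i
      rw [hostLine, hu, Option.map_none, Option.map_eq_none_iff] at this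
      rw [this, hostLine, hu]
      rfl
    | some u =>
      -- The window around `v` may run past position `n - 1` or `0` of a cycle; the label at such a
      -- position is that of the node it represents.
      have hag : Agree t (hostLine cyc fun u => (ids u, inp u)) i
          (hostLine cyc fun u => (ids u, inp u)) u 1 :=
        ⟨Or.inl rfl, fun k _ => by rw [hostLine, hostLine, one_mul, nodeAt_add_congr hu]⟩
      have : lab ids inp i = lab ids inp u :=
        fillState_mid_agree (f := f) hids hb hc hJ hn6 hn (by rw [hu]; rfl)
          (by rw [nodeAt_self]; rfl) hag
      rw [this, hp1 u, hostLine, hu]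
      simp [hp2 u]

end Host

/-! ## The iterated logarithm -/

theorem le_tower_of_iterate_logb : ∀ {k : ℕ} {x : ℝ}, (Real.logb 2)^[k] x ≤ 1 → x ≤ tower k
  | 0, x, h => by simpa [tower] using h
  | k + 1, x, h => by
    rw [Function.iterate_succ_apply] at h
    have ih := le_tower_of_iterate_logb h
    rcases le_or_gt x 0 with hx | hx
    · exact hx.trans (Nat.cast_nonneg _)
    · rw [Real.logb_le_iff_le_rpow (by norm_num) hx, Real.rpow_natCast] at ih
      simpa [tower] using ih

/-- Below `1` the iterates are no longer monotone, as the real logarithm takes absolute values of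
negative arguments; hence some `j ≤ k` instead of `k` itself. -/
theorem exists_iterate_logb_le : ∀ {k : ℕ} {x : ℝ}, x ≤ tower k →
    ∃ j ≤ k, (Real.logb 2)^[j] x ≤ 1
  | 0, x, h => ⟨0, le_rfl, by simpa [tower] using h⟩
  | k + 1, x, h => by
    rcases le_or_gt x 1 with hx | hx
    · exact ⟨0, Nat.zero_le _, hx⟩
    · obtain ⟨j, hj, h'⟩ := exists_iterate_logb_le (k := k) (x := Real.logb 2 x) (by
        rw [Real.logb_le_iff_le_rpow (by norm_num) (by linarith), Real.rpow_natCast]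
        simpa [tower] using h)
      exact ⟨j + 1, by omega, by rwa [Function.iterate_succ_apply]⟩

theorem lt_tower (k : ℕ) : k < tower k := by
  induction k with
  | zero => simp [tower]
  | succ k ih =>
    have : tower k < tower (k + 1) := Nat.lt_two_pow_self
    omega

theorem le_tower_logStar (n : ℕ) : n ≤ tower (logStar n) := by
  obtain ⟨j, -, hj⟩ := exists_iterate_logb_le (k := n) (x := n) (by exact_mod_cast (lt_tower n).le)
  have : logStar n ∈ {k : ℕ | (Real.logb 2)^[k] (n : ℝ) ≤ 1} := Nat.sInf_mem ⟨j, hj⟩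
  exact_mod_cast le_tower_of_iterate_logb this

theorem logStar_le_of_le_tower {n k : ℕ} (h : n ≤ tower k) : logStar n ≤ k := by
  obtain ⟨j, hjk, hj⟩ := exists_iterate_logb_le (k := k) (x := n) (by exact_mod_cast h)
  exact (Nat.sInf_le hj).trans hjk

theorem logStar_le (n : ℕ) : logStar n ≤ Nat.log 2 n + 2 := by
  refine logStar_le_of_le_tower ?_
  have h1 := Nat.lt_pow_succ_log_self (b := 2) (by norm_num) n
  have h2 : 2 ^ (Nat.log 2 n + 1) ≤ tower (Nat.log 2 n + 2) :=
    Nat.pow_le_pow_right (by norm_num) (lt_tower _).le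
  omega

theorem one_le_logStar {n : ℕ} (hn : 2 ≤ n) : 1 ≤ logStar n := by
  by_contra h
  have h1 := le_tower_logStar n
  rw [show logStar n = 0 by omega] at h1
  simp only [tower] at h1
  omega

theorem mul_succ_le_two_pow {a e : ℕ} (he : 2 * a + 4 ≤ e) : a * (e + 1) ≤ 2 ^ e := by
  induction e, he using Nat.le_induction with
  | base =>
    have h1 : a < 2 ^ a := Nat.lt_two_pow_self
    have h2 : a * (2 * a + 4 + 1) ≤ 2 ^ a * (2 ^ a * 16) := Nat.mul_le_mul h1.le (by omega)
    calc _ ≤ _ := h2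
      _ = _ := by ring
  | succ e _ ih =>
    have : a * (e + 1 + 1) ≤ 2 * (a * (e + 1)) := by nlinarith
    rw [pow_succ]
    omega

/-- An explicit threshold beyond which `n` dominates a multiple of its logarithm. The crude bound of
`log*` by the logarithm makes it sufficient, and `testSize` is this threshold. -/
theorem mul_log_succ_le {a n : ℕ} (hn : 2 ^ (2 * a + 4) ≤ n) : a * (Nat.log 2 n + 1) ≤ n := by
  have h0 : n ≠ 0 := by
    rintro rfl
    have := Nat.two_pow_pos (2 * a + 4)
    omega
  exact (mul_succ_le_two_pow (Nat.le_log_of_pow_le (by norm_num) hn)).trans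
    (Nat.pow_log_le_self 2 h0)

theorem not_isBigOmegaLinear_of_isBigOLogStar {T : ℕ → ℕ∞} (h : IsBigOLogStar T) :
    ¬ IsBigOmegaLinear T := by
  rintro ⟨k, -, hk⟩
  obtain ⟨C, hC⟩ := h
  -- The threshold for the factor `2 * (k * C) + 1` contradicts `n ≤ k * C * (Nat.log 2 n + 2)`.
  obtain ⟨n, h1, h2, h3⟩ := (hk.and (hC.and (Filter.eventually_ge_atTop
    (2 ^ (2 * (2 * (k * C) + 1) + 4))))).exists
  have h4 : (n : ℕ∞) ≤ ((k * (C * logStar n) : ℕ) : ℕ∞) := by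
    push_cast at h2 ⊢
    exact h1.trans (mul_le_mul_right h2 _)
  have h5 : n ≤ k * (C * logStar n) := by exact_mod_cast h4
  have h6 := mul_log_succ_le h3
  have h7 : k * C * logStar n ≤ k * C * (Nat.log 2 n + 2) := Nat.mul_le_mul_left _ (logStar_le n)
  nlinarith

/-! ## The dichotomy -/

/-- The graph can be solved in `t` rounds. -/
def SolvableIn (cyc : Bool) (c : ℕ) (P : LCL) (n t : ℕ) : Prop :=
  ∃ A : LocalAlgorithm, A.rounds n = t ∧ A.Solves P c (hostGraph cyc n)

/-- A bound on the number of rounds, up to a logarithmic factor. -/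
def roundFactor (c : ℕ) (P : LCL) : ℕ :=
  4 * (6 * (2 * P.pumpLength) + 2 + 2 ^ finalBits (2 * P.pumpLength) c * (2 * P.pumpLength) +
    P.radius) + 10 + (6 * (2 * P.pumpLength) + 5)

/-- The number of nodes on which the two complexity classes can be told apart. -/
def testSize (c : ℕ) (P : LCL) : ℕ :=
  2 ^ (2 * roundFactor c P + 4)

theorem SolvableIn.complexity_le {cyc : Bool} {c : ℕ} {P : LCL} {n t : ℕ}
    (h : SolvableIn cyc c P n t) : P.complexity c (hostGraph cyc n) ≤ t := by
  obtain ⟨A, rfl, hA⟩ := h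
  exact iInf₂_le A hA

theorem exists_solves_of_complexity_ne_top {c : ℕ} {P : LCL} {n : ℕ} {G : SimpleGraph (Fin n)}
    (h : P.complexity c G ≠ ⊤) :
    ∃ A : LocalAlgorithm, A.Solves P c G ∧ (A.rounds n : ℕ∞) = P.complexity c G := by
  have hne : Nonempty {A : LocalAlgorithm // A.Solves P c G} := by
    by_contra hempty
    refine h (iInf₂_eq_top.2 fun A hA => absurd ⟨⟨A, hA⟩⟩ hempty)
  have h2 : P.complexity c G = ⨅ A : {A : LocalAlgorithm // A.Solves P c G}, (A.1.rounds n : ℕ∞) := by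
    rw [LCL.complexity, iInf_subtype]
  obtain ⟨A, hA⟩ := ENat.exists_eq_iInf
    (fun A : {A : LocalAlgorithm // A.Solves P c G} => (A.1.rounds n : ℕ∞))
  exact ⟨A.1, A.2, by rw [h2, ← hA]⟩

theorem nbhd_hostGraph_min (cyc : Bool) (n t : ℕ) (v : Fin n) :
    nbhd (hostGraph cyc n) (min t n) v = nbhd (hostGraph cyc n) t v := by
  rcases le_total t n with h | h
  · rw [min_eq_left h]
  rw [min_eq_right h]
  ext w
  rw [mem_nbhd_hostGraph (nodeAt_self v), mem_nbhd_hostGraph (nodeAt_self v)]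
  have hw : nodeAt cyc n (v + (w - v)) = some w := by rw [add_sub_cancel, nodeAt_self]
  have : |((w : ℕ) : ℤ) - (v : ℕ)| ≤ n := by rw [abs_le]; omega
  exact ⟨fun _ => ⟨w - v, by omega, hw⟩, fun _ => ⟨w - v, this, hw⟩⟩

/-- After `n` rounds a node has seen everything it can reach, so more rounds do not change its view.
-/
theorem exists_solvableIn_of_complexity_ne_top {cyc : Bool} {c : ℕ} {P : LCL} {n : ℕ}
    (h : P.complexity c (hostGraph cyc n) ≠ ⊤) : ∃ t ≤ n, SolvableIn cyc c P n t := by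
  obtain ⟨A, hA, -⟩ := exists_solves_of_complexity_ne_top h
  refine ⟨min (A.rounds n) n, min_le_right _ _, ⟨fun _ => min (A.rounds n) n, A.output⟩, rfl, ?_⟩
  intro ids hids hb inp
  obtain ⟨out, h1, h2⟩ := hA ids hids hb inp
  refine ⟨out, fun v => ?_, h2⟩
  rw [h1 v]
  simp only [view, nbhd_hostGraph_min]

/-- `roundFactor` collects the constants; its `6 * K` is the `4 * K` of the radius plus `2 * K` from
`logStar n ≤ Nat.log 2 n + 2`. -/
theorem lookRadius_le {c : ℕ} {P : LCL} {n : ℕ} (hn : testSize c P ≤ n) :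
    4 * (lookRadius (2 * P.pumpLength) c (logStar n) + P.radius) + 10 +
      (6 * (2 * P.pumpLength) + 5) ≤ n := by
  refine le_trans ?_ (mul_log_succ_le hn)
  have := logStar_le n
  set e := Nat.log 2 n
  unfold lookRadius roundFactor
  set K := 2 * P.pumpLength
  have h1 : logStar n * K ≤ (e + 2) * K := Nat.mul_le_mul_right _ this
  nlinarith [Nat.zero_le (2 ^ finalBits K c * K * e), Nat.zero_le (K * e),
    Nat.zero_le (P.radius * e)]

theorem solvableIn_of_isFeasible {cyc : Bool} {c : ℕ} (hc : 1 ≤ c) {P : LCL}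
    (hf : ∃ f, P.IsFeasible cyc f) {n : ℕ} (hn : testSize c P ≤ n) :
    SolvableIn cyc c P n (lookRadius (2 * P.pumpLength) c (logStar n)) := by
  obtain ⟨f, hf⟩ := hf
  have h := lookRadius_le hn
  have ht : n ≤ tower (logStar n + 1) :=
    (le_tower_logStar n).trans (Nat.lt_two_pow_self (n := tower (logStar n))).le
  exact exists_solves_of_isFeasible hf hc ht (by omega) (by omega) (by omega)

theorem isFeasible_of_solvableIn {cyc : Bool} {c : ℕ} (hc : 1 ≤ c) {P : LCL} {n t : ℕ}
    (h : SolvableIn cyc c P n t) (hn : 4 * (t + P.radius) + 10 ≤ n) :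
    ∃ f, P.IsFeasible cyc f := by
  obtain ⟨A, rfl, hA⟩ := h
  exact exists_isFeasible hc hA hn

theorem isBigOLogStar_of_le_lookRadius {K c N : ℕ} {T : ℕ → ℕ∞}
    (h : ∀ n, N ≤ n → T n ≤ (lookRadius K c (logStar n) : ℕ)) : IsBigOLogStar T := by
  refine ⟨lookRadius K c 1, Filter.eventually_atTop.2 ⟨N + 2, fun n hn => ?_⟩⟩
  refine (h n (by omega)).trans ?_
  have h1 := one_le_logStar (n := n) (by omega)
  have : lookRadius K c (logStar n) ≤ lookRadius K c 1 * logStar n := by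
    unfold lookRadius
    nlinarith [Nat.zero_le (2 ^ finalBits K c * K)]
  exact_mod_cast this

theorem isBigOLogStar_of_isFeasible {cyc : Bool} {c : ℕ} (hc : 1 ≤ c) {P : LCL}
    (hf : ∃ f, P.IsFeasible cyc f) :
    IsBigOLogStar fun n => P.complexity c (hostGraph cyc n) :=
  isBigOLogStar_of_le_lookRadius fun _ hn => (solvableIn_of_isFeasible hc hf hn).complexity_le

theorem isBigOmegaLinear_of_not_isFeasible {cyc : Bool} {c : ℕ} (hc : 1 ≤ c) {P : LCL}
    (hf : ¬ ∃ f, P.IsFeasible cyc f) :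
    IsBigOmegaLinear fun n => P.complexity c (hostGraph cyc n) := by
  refine ⟨4 * P.radius + 14, by omega,
    Filter.eventually_atTop.2 ⟨4 * P.radius + 10, fun n hn => ?_⟩⟩
  by_cases htop : P.complexity c (hostGraph cyc n) = ⊤
  · simp only [htop]
    rw [ENat.mul_top (by simp)]
    exact le_top
  · obtain ⟨A, hA, h⟩ := exists_solves_of_complexity_ne_top htop
    -- Since `n ≥ 4 * P.radius + 10`, this forces at least one round, and the additive constant can
    -- be absorbed into the factor `4 * P.radius + 14`.
    have h1 : ¬ 4 * (A.rounds n + P.radius) + 10 ≤ n := fun hle =>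
      hf (exists_isFeasible hc hA hle)
    simp only [← h]
    have h2 : n ≤ (4 * P.radius + 14) * A.rounds n := by
      have : 1 ≤ A.rounds n := by omega
      nlinarith
    exact_mod_cast h2

/-! ## Exhaustive search for algorithms -/

/-- The lists of length `L` with entries below `m`. -/
def tuples (m : ℕ) : ℕ → List (List ℕ)
  | 0 => [[]]
  | L + 1 => (tuples m L).flatMap fun l => (List.range m).map fun x => x :: l

theorem mem_tuples {m : ℕ} : ∀ {L : ℕ} {l : List ℕ},
    l ∈ tuples m L ↔ l.length = L ∧ ∀ x ∈ l, x < m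
  | 0, l => by
    simp only [tuples, List.mem_singleton, List.length_eq_zero_iff]
    exact ⟨fun h => ⟨h, by simp [h]⟩, fun h => h.1⟩
  | L + 1, l => by
    simp only [tuples, List.mem_flatMap, List.mem_map, List.mem_range, mem_tuples (L := L)]
    constructor
    · rintro ⟨l, ⟨h1, h2⟩, x, hx, rfl⟩
      exact ⟨by simp [h1], by simpa using ⟨hx, h2⟩⟩
    · rintro ⟨h1, h2⟩
      cases l with
      | nil => simp at h1
      | cons x l =>
        simp only [List.length_cons, Nat.add_right_cancel_iff] at h1
        exact ⟨l, ⟨h1, fun y hy => h2 y (List.mem_cons_of_mem _ hy)⟩, x, h2 x (by simp), rfl⟩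

theorem ofFn_mem_tuples {m L : ℕ} {f : Fin L → ℕ} (h : ∀ i, f i < m) : List.ofFn f ∈ tuples m L := by
  rw [mem_tuples]
  refine ⟨by simp, fun x hx => ?_⟩
  obtain ⟨i, rfl⟩ := List.mem_ofFn.1 hx
  exact h i

theorem exists_eq_ofFn_of_mem_tuples {m L : ℕ} {l : List ℕ} (h : l ∈ tuples m L) :
    ∃ f : Fin L → Fin m, l = List.ofFn fun i => (f i : ℕ) := by
  rw [mem_tuples] at h
  obtain ⟨rfl, h⟩ := h
  exact ⟨fun i => ⟨l[i], h _ (List.getElem_mem _)⟩, List.ofFn_getElem.symm⟩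

theorem getD_ofFn {α : Type*} {L : ℕ} (f : Fin L → α) (i : Fin L) (d : α) :
    (List.ofFn f).getD i d = f i := by
  simp [List.getD_eq_getElem?_getD]

/-- The node `u` is `k` steps after `v`. -/
def StepsTo (cyc : Bool) (n k v u : ℕ) : Prop :=
  v + k = u ∨ (cyc = true ∧ (v + k) % n = u)

/-- The distance between `v` and `u` is at most `t`. -/
def Near (cyc : Bool) (n t v u : ℕ) : Prop :=
  ∃ k < t + 1, StepsTo cyc n k v u ∨ StepsTo cyc n k u v

/-- The nodes `u` and `w` are adjacent. -/
def Adjacent (cyc : Bool) (n u w : ℕ) : Prop :=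
  u ≠ w ∧ (StepsTo cyc n 1 u w ∨ StepsTo cyc n 1 w u)

theorem stepsTo_iff {cyc : Bool} {n k : ℕ} {v u : Fin n} :
    StepsTo cyc n k v u ↔ nodeAt cyc n (v + k) = some u := by
  have hu := u.2
  have hmod : (v + k : ℕ) % n = u ↔ (n : ℤ) ∣ v + k - u := by
    have h := Nat.modEq_iff_dvd (n := n) (a := u) (b := v + k)
    rw [Nat.ModEq, Nat.mod_eq_of_lt hu, eq_comm] at h
    rw [h]
    push_cast
    rfl
  rw [nodeAt_eq_some, StepsTo]
  cases cyc with
  | true =>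
    simp only [true_and, true_or, and_true]
    rw [← hmod, or_iff_right_iff_imp]
    rintro h
    rw [h]
    exact Nat.mod_eq_of_lt hu
  | false =>
    simp only [Bool.false_eq_true, false_and, or_false, false_or]
    constructor
    · intro h
      have h' : ((v : ℕ) + k : ℤ) = (u : ℕ) := by exact_mod_cast h
      rw [h']
      simp
    · rintro ⟨-, h⟩
      exact_mod_cast h

theorem near_iff {cyc : Bool} {n t : ℕ} {v u : Fin n} :
    Near cyc n t v u ↔ u ∈ nbhd (hostGraph cyc n) t v := by
  rw [mem_nbhd_hostGraph (nodeAt_self v), Near]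
  have hrev : ∀ k : ℤ, nodeAt cyc n (u + k) = some v ↔ nodeAt cyc n (v + -k) = some u := by
    intro k
    rw [nodeAt_eq_some, nodeAt_eq_some]
    refine and_congr ?_ (or_congr_right ?_)
    · rw [← dvd_neg]
      ring_nf
    · constructor <;> intro h <;> omega
  simp only [stepsTo_iff, hrev]
  constructor
  · rintro ⟨k, hk, h | h⟩
    · exact ⟨k, by rw [abs_le]; omega, h⟩
    · exact ⟨-k, by rw [abs_le]; omega, h⟩
  · rintro ⟨k, hk, h⟩
    rw [abs_le] at hk
    rcases le_total 0 k with hk0 | hk0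
    · exact ⟨k.toNat, by omega, Or.inl (by rwa [Int.toNat_of_nonneg hk0])⟩
    · exact ⟨(-k).toNat, by omega, Or.inr (by rwa [Int.toNat_of_nonneg (by omega), neg_neg])⟩

theorem adjacent_iff {cyc : Bool} {n : ℕ} {u w : Fin n} :
    Adjacent cyc n u w ↔ (hostGraph cyc n).Adj u w := by
  rw [hostGraph_adj, Adjacent, stepsTo_iff, stepsTo_iff, Nat.cast_one, Fin.val_ne_iff]

open Classical in
/-- The nodes in `S`, sorted by their identifiers below `b`. -/
noncomputable def sortedNodes (n b : ℕ) (ids : List ℕ) (S : ℕ → Prop) : List ℕ :=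
  (List.range b).flatMap fun i => (List.range n).filter fun u => ids.getD u 0 = i ∧ S u

/-- Running through all possible identifiers lists the nodes in sorted order, as injectivity leaves
at most one node for each. This avoids a sorting procedure in the recursive description. -/
theorem sortedNodes_eq {n b : ℕ} {ids : Fin n → ℕ} (hids : Function.Injective ids)
    (hb : ∀ u, ids u < b) {S : Set (Fin n)} {S' : ℕ → Prop} (hS : ∀ u : Fin n, S' u ↔ u ∈ S) :
    sortedNodes n b (List.ofFn ids) S' = (sortById ids S).map fun u : Fin n => (u : ℕ) := by
  refine pairwise_eq_of_mem_iff
    (R := fun u w => (List.ofFn ids).getD u 0 < (List.ofFn ids).getD w 0)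
    (fun _ _ => lt_asymm) ?_ ?_ fun u => ?_
  · rw [sortedNodes, List.pairwise_flatMap]
    refine ⟨fun i _ => ?_, List.pairwise_lt_range.imp fun {i j} hij u hu w hw => ?_⟩
    · refine ((List.nodup_range (n := n)).filter _).imp_of_mem fun {u w} hu hw hne => ?_
      simp only [List.mem_filter, List.mem_range, decide_eq_true_eq] at hu hw
      exfalso
      apply hne
      have h1 := hu.2.1.trans hw.2.1.symm
      have h2 := getD_ofFn ids ⟨u, hu.1⟩ 0
      have h3 := getD_ofFn ids ⟨w, hw.1⟩ 0
      simp only at h2 h3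
      rw [h2, h3] at h1
      exact congrArg Fin.val (hids h1)
    · simp only [List.mem_filter, List.mem_range, decide_eq_true_eq] at hu hw
      rw [hu.2.1, hw.2.1]
      exact hij
  · rw [List.pairwise_map]
    refine (pairwise_sortById hids S).imp fun h => ?_
    rwa [getD_ofFn, getD_ofFn]
  · simp only [sortedNodes, List.mem_flatMap, List.mem_range, List.mem_filter, decide_eq_true_eq,
      List.mem_map, mem_sortById]
    constructor
    · rintro ⟨i, -, hu, -, hS'⟩
      exact ⟨⟨u, hu⟩, (hS ⟨u, hu⟩).1 hS', rfl⟩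
    · rintro ⟨u, hu, rfl⟩
      exact ⟨ids u, hb u, u.2, getD_ofFn ids u 0, (hS u).2 hu⟩

/-- The view of the node `v`, for identifiers (below `b`) and input labels given by lists. -/
noncomputable def listView (cyc : Bool) (n b t : ℕ) (ids inp : List ℕ) (v : ℕ) : View :=
  (n, ids.getD v 0, (sortedNodes n b ids (Near cyc n t v)).map fun u =>
    (ids.getD u 0, inp.getD u 0,
      (sortedNodes n b ids fun w => Near cyc n t v w ∧ Adjacent cyc n u w).map
        fun w => ids.getD w 0))

theorem listView_eq {cyc : Bool} {n b t : ℕ} {ids : Fin n → ℕ} (hids : Function.Injective ids)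
    (hb : ∀ u, ids u < b) (inp : Fin n → ℕ) (v : Fin n) :
    listView cyc n b t (List.ofFn ids) (List.ofFn inp) v = view (hostGraph cyc n) ids inp t v := by
  unfold listView view
  rw [getD_ofFn, sortedNodes_eq hids hb fun u => near_iff, List.map_map]
  congr 2
  refine List.map_congr_left fun u _ => ?_
  simp only [Function.comp_apply]
  rw [getD_ofFn, getD_ofFn, sortedNodes_eq hids hb
    (S := {w | w ∈ nbhd (hostGraph cyc n) t v ∧ (hostGraph cyc n).Adj u w})
    fun w => and_congr near_iff adjacent_iff, List.map_map]
  congr 2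
  refine List.map_congr_left fun w _ => ?_
  simp only [Function.comp_apply]
  rw [getD_ofFn]

/-- The radius-`r` neighborhood of `v` is isomorphic to `H`; the list `l` maps the nodes of `H`
to the nodes of the neighborhood. -/
def ListMatches (cyc : Bool) (H : CenteredGraph) (n r : ℕ) (inp out : List ℕ) (v : ℕ)
    (l : List ℕ) : Prop :=
  (∀ i < H.nodes.length, ∀ j < H.nodes.length, l.getD i 0 = l.getD j 0 → i = j) ∧
  (∀ u < n, Near cyc n r v u ↔ ∃ i < H.nodes.length, l.getD i 0 = u) ∧
  (∀ i < H.nodes.length,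
    H.nodes.getD i (0, 0) = (inp.getD (l.getD i 0) 0, out.getD (l.getD i 0) 0)) ∧
  (∀ i < H.nodes.length, ∀ j < H.nodes.length, Adjacent cyc n (l.getD i 0) (l.getD j 0) ↔
    i ≠ j ∧ ((i, j) ∈ H.edges ∨ (j, i) ∈ H.edges)) ∧
  H.center < H.nodes.length ∧ l.getD H.center 0 = v

theorem CenteredGraph.adj_iff {H : CenteredGraph} {i j : Fin H.nodes.length} :
    H.graph.Adj i j ↔
      (i : ℕ) ≠ j ∧ (((i : ℕ), (j : ℕ)) ∈ H.edges ∨ ((j : ℕ), (i : ℕ)) ∈ H.edges) := by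
  rw [CenteredGraph.graph, SimpleGraph.fromRel_adj, Fin.val_ne_iff]

theorem matches_iff_exists_listMatches {cyc : Bool} {H : CenteredGraph} {n r : ℕ}
    {inp out : Fin n → ℕ} {v : Fin n} :
    H.Matches (hostGraph cyc n) inp out r v ↔
      ∃ l ∈ tuples n H.nodes.length, ListMatches cyc H n r (List.ofFn inp) (List.ofFn out) v l := by
  constructor
  · rintro ⟨e, h1, h2⟩
    let s : Fin H.nodes.length → Fin n := fun i => (e.symm i).1
    have hget : ∀ i (hi : i < H.nodes.length), (List.ofFn fun i => (s i : ℕ)).getD i 0 = s ⟨i, hi⟩ :=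
      fun i hi => getD_ofFn (fun i => (s i : ℕ)) ⟨i, hi⟩ 0
    have hv : v ∈ nbhd (hostGraph cyc n) r v := by simp [nbhd]
    refine ⟨List.ofFn fun i => (s i : ℕ), ofFn_mem_tuples fun i => (s i).2, ?_, ?_, ?_, ?_, ?_⟩
    · intro i hi j hj hij
      rw [hget i hi, hget j hj] at hij
      have := e.symm.injective (Subtype.ext (Fin.ext hij))
      exact congrArg Fin.val this
    · intro u hu
      rw [near_iff (u := ⟨u, hu⟩)]
      constructor
      · intro hmem
        refine ⟨e ⟨_, hmem⟩, (e ⟨_, hmem⟩).2, ?_⟩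
        rw [hget _ (e ⟨_, hmem⟩).2]
        simp [s]
      · rintro ⟨i, hi, hiu⟩
        rw [hget i hi] at hiu
        have : (⟨u, hu⟩ : Fin n) = s ⟨i, hi⟩ := Fin.ext hiu.symm
        rw [this]
        exact (e.symm ⟨i, hi⟩).2
    · intro i hi
      rw [hget i hi, getD_ofFn, getD_ofFn]
      have := h1 (e.symm ⟨i, hi⟩)
      rw [RelIso.apply_symm_apply] at this
      rw [← this]
      simp [List.getD_eq_getElem?_getD, hi]
    · intro i hi j hj
      rw [hget i hi, hget j hj, adjacent_iff]
      have := e.symm.map_rel_iff (a := ⟨i, hi⟩) (b := ⟨j, hj⟩)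
      rw [CenteredGraph.adj_iff] at this
      exact this
    · have h3 := h2 ⟨v, hv⟩ rfl
      have hlt : H.center < H.nodes.length := by rw [← h3]; exact (e ⟨v, hv⟩).2
      refine ⟨hlt, ?_⟩
      rw [hget _ hlt]
      have : (⟨H.center, hlt⟩ : Fin H.nodes.length) = e ⟨v, hv⟩ := Fin.ext h3.symm
      simp [s, this]
  · rintro ⟨l, hl, h1, h2, h3, h4, h5, h6⟩
    obtain ⟨s, rfl⟩ := exists_eq_ofFn_of_mem_tuples hl
    have hget : ∀ i : Fin H.nodes.length, (List.ofFn fun i => (s i : ℕ)).getD i 0 = s i :=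
      fun i => getD_ofFn (fun i => (s i : ℕ)) i 0
    have hmem : ∀ i, s i ∈ nbhd (hostGraph cyc n) r v := fun i => by
      rw [← near_iff, h2 _ (s i).2]
      exact ⟨i, i.2, hget i⟩
    have hbij : Function.Bijective
        (fun i => ⟨s i, hmem i⟩ : Fin H.nodes.length → nbhd (hostGraph cyc n) r v) := by
      constructor
      · intro i j hij
        refine Fin.ext (h1 i i.2 j j.2 ?_)
        rw [hget, hget]
        exact congrArg (fun x => (x.1 : ℕ)) hij
      · rintro ⟨u, hu⟩
        obtain ⟨i, hi, hiu⟩ := (h2 u u.2).1 (near_iff.2 hu)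
        rw [hget ⟨i, hi⟩] at hiu
        exact ⟨⟨i, hi⟩, Subtype.ext (Fin.ext hiu)⟩
    let e : Fin H.nodes.length ≃ nbhd (hostGraph cyc n) r v := Equiv.ofBijective _ hbij
    have he : ∀ i, (e i : Fin n) = s i := fun i => rfl
    have hadj : ∀ {i j}, ((hostGraph cyc n).induce (nbhd (hostGraph cyc n) r v)).Adj (e i) (e j) ↔
        H.graph.Adj i j := by
      intro i j
      have := h4 i i.2 j j.2
      rw [hget, hget, adjacent_iff] at this
      rw [CenteredGraph.adj_iff, ← this]
      rfl
    refine ⟨(RelIso.mk e hadj : H.graph ≃g _).symm, fun u => ?_, fun u hu => ?_⟩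
    · obtain ⟨i, rfl⟩ := e.surjective u
      have := h3 i i.2
      rw [hget, getD_ofFn, getD_ofFn] at this
      rw [he, ← this]
      simp [List.getD_eq_getElem?_getD]
    · obtain ⟨i, rfl⟩ := e.surjective u
      rw [he] at hu
      have : i = ⟨H.center, h5⟩ := Fin.ext (h1 i i.2 _ h5 (by rw [hget, h6, hu]))
      rw [this]
      simp

/-- All views on `n`-node graphs with input labels below `m` (and some more). -/
noncomputable def allViews (cyc : Bool) (c m n t : ℕ) : List View :=
  (tuples (n ^ c) n).flatMap fun ids => (tuples m n).flatMap fun inp =>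
    (List.range n).map fun v => listView cyc n (n ^ c) t ids inp v

theorem view_mem_allViews {cyc : Bool} {c m n t : ℕ} {ids : Fin n → ℕ}
    (hids : Function.Injective ids) (hb : ∀ u, ids u < n ^ c) (inp : Fin n → Fin m) (v : Fin n) :
    view (hostGraph cyc n) ids (fun u => (inp u : ℕ)) t v ∈ allViews cyc c m n t := by
  simp only [allViews, List.mem_flatMap, List.mem_map, List.mem_range]
  exact ⟨_, ofFn_mem_tuples hb, _, ofFn_mem_tuples fun u => (inp u).2, v, v.2,
    listView_eq hids hb _ v⟩

/-- The output label of a node according to a table of output labels for all views. -/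
noncomputable def tableOutput (cyc : Bool) (c m n t : ℕ) (tab : List ℕ) (w : View) : ℕ :=
  tab.getD ((allViews cyc c m n t).idxOf w) 0

/-- The output labels of all nodes according to a table. -/
noncomputable def tableLabels (cyc : Bool) (c m n t : ℕ) (tab ids inp : List ℕ) : List ℕ :=
  (List.range n).map fun v => tableOutput cyc c m n t tab (listView cyc n (n ^ c) t ids inp v)

/-- The output labels `out` are correct. -/
def ListCorrect (cyc : Bool) (P : LCL) (n : ℕ) (inp out : List ℕ) : Prop :=
  ∀ v < n, out.getD v 0 < P.numOut ∧ ∃ H ∈ P.accepted, ∃ l ∈ tuples n H.nodes.length,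
    ListMatches cyc H n P.radius inp out v l

/-- The algorithm given by a table solves `P`. -/
def TableSolves (cyc : Bool) (c : ℕ) (P : LCL) (n t : ℕ) (tab : List ℕ) : Prop :=
  ∀ ids ∈ tuples (n ^ c) n, (∀ u < n, ∀ w < n, ids.getD u 0 = ids.getD w 0 → u = w) →
    ∀ inp ∈ tuples P.numIn n,
      ListCorrect cyc P n inp (tableLabels cyc c P.numIn n t tab ids inp)

theorem tableLabels_eq {cyc : Bool} {c m n t : ℕ} {tab : List ℕ} {ids : Fin n → ℕ}
    (hids : Function.Injective ids) (hb : ∀ u, ids u < n ^ c) (inp : Fin n → ℕ) :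
    tableLabels cyc c m n t tab (List.ofFn ids) (List.ofFn inp) = List.ofFn fun v =>
      tableOutput cyc c m n t tab (view (hostGraph cyc n) ids inp t v) := by
  refine List.ext_getElem (by simp [tableLabels]) fun v h1 h2 => ?_
  rw [List.length_ofFn] at h2
  simp only [tableLabels, List.getElem_map, List.getElem_range, List.getElem_ofFn]
  rw [← listView_eq hids hb]

theorem listCorrect_iff {cyc : Bool} {P : LCL} {n : ℕ} {inp : Fin n → Fin P.numIn}
    {out : Fin n → ℕ} :
    ListCorrect cyc P n (List.ofFn fun u => (inp u : ℕ)) (List.ofFn out) ↔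
      ∃ out' : Fin n → Fin P.numOut, (∀ v, (out' v : ℕ) = out v) ∧
        P.Correct (hostGraph cyc n) inp out' := by
  constructor
  · intro h
    have hlt : ∀ v : Fin n, out v < P.numOut := fun v => by
      have := (h v v.2).1
      rwa [getD_ofFn] at this
    refine ⟨fun v => ⟨out v, hlt v⟩, fun v => rfl, fun v => ?_⟩
    obtain ⟨H, hH, h1⟩ := (h v v.2).2
    exact ⟨H, hH, matches_iff_exists_listMatches.2 h1⟩
  · rintro ⟨out', h1, h2⟩
    obtain rfl : (fun v => (out' v : ℕ)) = out := funext h1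
    intro v hv
    refine ⟨?_, ?_⟩
    · exact (getD_ofFn (fun v => (out' v : ℕ)) ⟨v, hv⟩ 0).trans_lt (out' ⟨v, hv⟩).2
    · obtain ⟨H, hH, h3⟩ := h2 ⟨v, hv⟩
      exact ⟨H, hH, matches_iff_exists_listMatches.1 h3⟩

theorem TableSolves.solves {cyc : Bool} {c : ℕ} {P : LCL} {n t : ℕ} {tab : List ℕ}
    (h : TableSolves cyc c P n t tab) {A : LocalAlgorithm} (ht : A.rounds n = t)
    (hA : ∀ w : View, w.1 = n → A.output w = tableOutput cyc c P.numIn n t tab w) :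
    A.Solves P c (hostGraph cyc n) := by
  intro ids hids hb inp
  have h1 := h _ (ofFn_mem_tuples hb) (fun u hu w hw he => by
    have h2 := getD_ofFn ids ⟨u, hu⟩ 0
    have h3 := getD_ofFn ids ⟨w, hw⟩ 0
    simp only at h2 h3
    rw [h2, h3] at he
    exact congrArg Fin.val (hids he)) _ (ofFn_mem_tuples fun u => (inp u).2)
  rw [tableLabels_eq hids hb, listCorrect_iff] at h1
  obtain ⟨out, h2, h3⟩ := h1
  refine ⟨out, fun v => ?_, h3⟩
  rw [h2, hA _ rfl, ht]

/-- For fixed `n` and `t` only finitely many views occur, so a table replaces the algorithm. Cutting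
the entries off at `P.numOut` makes the tables finite in number and changes no output that occurs in
a run. -/
theorem exists_tableSolves {cyc : Bool} {c : ℕ} {P : LCL} {n t : ℕ} (h : SolvableIn cyc c P n t) :
    ∃ tab ∈ tuples (P.numOut + 1) (allViews cyc c P.numIn n t).length,
      TableSolves cyc c P n t tab := by
  obtain ⟨A, rfl, hA⟩ := h
  refine ⟨(allViews cyc c P.numIn n (A.rounds n)).map fun w => min (A.output w) P.numOut, ?_, ?_⟩
  · rw [mem_tuples]
    refine ⟨List.length_map _, fun x hx => ?_⟩
    obtain ⟨w, -, rfl⟩ := List.mem_map.1 hx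
    exact Nat.lt_succ_of_le (min_le_right _ _)
  · intro ids hids hinj inp hinp
    obtain ⟨ids, rfl⟩ := exists_eq_ofFn_of_mem_tuples hids
    obtain ⟨inp, rfl⟩ := exists_eq_ofFn_of_mem_tuples hinp
    have hi : Function.Injective fun u => (ids u : ℕ) := by
      intro u w he
      refine Fin.ext (hinj u u.2 w w.2 ?_)
      rw [getD_ofFn (fun u => (ids u : ℕ)), getD_ofFn (fun u => (ids u : ℕ))]
      exact he
    rw [tableLabels_eq hi fun u => (ids u).2, listCorrect_iff]
    obtain ⟨out, h1, h2⟩ := hA _ hi (fun u => (ids u).2) inp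
    refine ⟨out, fun v => ?_, h2⟩
    have hmem := view_mem_allViews (cyc := cyc) (c := c) (t := A.rounds n) hi
      (fun u => (ids u).2) inp v
    have hlt := List.idxOf_lt_length_of_mem hmem
    rw [tableOutput, List.getD_eq_getElem?_getD, List.getElem?_map, List.getElem?_eq_getElem hlt,
      List.getElem_idxOf, Option.map_some, Option.getD_some, ← h1, min_eq_left (out v).2.le]

open Classical in
/-- The tables that solve `P`. -/
noncomputable def goodTables (cyc : Bool) (c : ℕ) (P : LCL) (n t : ℕ) : List (List ℕ) :=
  (tuples (P.numOut + 1) (allViews cyc c P.numIn n t).length).filter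
    fun tab => TableSolves cyc c P n t tab

theorem goodTables_ne_nil_iff {cyc : Bool} {c : ℕ} {P : LCL} {n t : ℕ} :
    goodTables cyc c P n t ≠ [] ↔ SolvableIn cyc c P n t := by
  rw [goodTables, ne_eq, List.filter_eq_nil_iff]
  push Not
  simp only [decide_eq_true_eq]
  constructor
  · rintro ⟨tab, -, h⟩
    exact ⟨⟨fun _ => t, fun w => tableOutput cyc c P.numIn n t tab w⟩, rfl,
      h.solves rfl fun _ _ => rfl⟩
  · exact exists_tableSolves

open Classical in
/-- The least number of rounds, up to `n`, in which `P` can be solved. -/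
noncomputable def searchRounds (cyc : Bool) (c : ℕ) (P : LCL) (n : ℕ) : ℕ :=
  (List.range (n + 1)).findIdx fun t => goodTables cyc c P n t ≠ []

/-- The output label of a node with view `w` according to the first table that solves `P`. -/
noncomputable def searchOutput (cyc : Bool) (c : ℕ) (P : LCL) (w : View) : ℕ :=
  tableOutput cyc c P.numIn w.1 (searchRounds cyc c P w.1)
    (goodTables cyc c P w.1 (searchRounds cyc c P w.1)).headI w

/-- The search returns `n + 1` if it fails, so a solution in `t ≤ n` rounds is what guarantees that
the selected table exists and is good. -/
theorem search_spec {cyc : Bool} {c : ℕ} {P : LCL} {n t : ℕ} (ht : t ≤ n)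
    (h : SolvableIn cyc c P n t) : searchRounds cyc c P n ≤ t ∧
      LocalAlgorithm.Solves ⟨searchRounds cyc c P, searchOutput cyc c P⟩ P c (hostGraph cyc n) := by
  classical
  have hle : searchRounds cyc c P n ≤ t := by
    by_contra hlt
    have := List.not_of_lt_findIdx (not_le.1 hlt)
    simp only [List.getElem_range, decide_eq_false_iff_not] at this
    exact this (goodTables_ne_nil_iff.2 h)
  refine ⟨hle, ?_⟩
  have hlt : searchRounds cyc c P n < (List.range (n + 1)).length := by
    rw [List.length_range]; omega
  have hs : goodTables cyc c P n (searchRounds cyc c P n) ≠ [] := by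
    unfold searchRounds at hlt ⊢
    have := List.findIdx_getElem (w := hlt)
    rw [decide_eq_true_eq, List.getElem_range] at this
    exact this
  have hmem : (goodTables cyc c P n (searchRounds cyc c P n)).headI ∈
      goodTables cyc c P n (searchRounds cyc c P n) := by
    cases hg : goodTables cyc c P n (searchRounds cyc c P n) with
    | nil => exact absurd hg hs
    | cons a l => simp
  have hgood : TableSolves cyc c P n (searchRounds cyc c P n)
      (goodTables cyc c P n (searchRounds cyc c P n)).headI := by
    have := List.of_mem_filter hmem
    simpa using this
  exact hgood.solves rfl fun w hw => by subst hw; rfl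

/-! ## Primitive recursiveness of the search -/

attribute [fun_prop] Primrec PrimrecPred Primrec.const Primrec.comp

section Primrec

variable {α β γ : Type*} [Primcodable α] [Primcodable β] [Primcodable γ]

@[fun_prop]
theorem Primrec.id_fun : Primrec fun a : α => a := Primrec.id

@[fun_prop]
theorem Primrec.prodMk {f : α → β} {g : α → γ} (hf : Primrec f) (hg : Primrec g) :
    Primrec fun a => (f a, g a) := hf.pair hg

@[fun_prop]
theorem Primrec.fst_fun {f : α → β × γ} (hf : Primrec f) : Primrec fun a => (f a).1 :=
  Primrec.fst.comp hf

@[fun_prop]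
theorem Primrec.snd_fun {f : α → β × γ} (hf : Primrec f) : Primrec fun a => (f a).2 :=
  Primrec.snd.comp hf

@[fun_prop]
theorem Primrec.add_fun {f g : α → ℕ} (hf : Primrec f) (hg : Primrec g) :
    Primrec fun a => f a + g a := Primrec.nat_add.comp hf hg

@[fun_prop]
theorem Primrec.mul_fun {f g : α → ℕ} (hf : Primrec f) (hg : Primrec g) :
    Primrec fun a => f a * g a := Primrec.nat_mul.comp hf hg

@[fun_prop]
theorem Primrec.mod_fun {f g : α → ℕ} (hf : Primrec f) (hg : Primrec g) :
    Primrec fun a => f a % g a := Primrec.nat_mod.comp hf hg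

@[fun_prop]
theorem Primrec.pow_fun {f g : α → ℕ} (hf : Primrec f) (hg : Primrec g) :
    Primrec fun a => f a ^ g a := (Primrec₂.unpaired'.1 Nat.Primrec.pow).comp hf hg

@[fun_prop]
theorem Primrec.range_fun {f : α → ℕ} (hf : Primrec f) : Primrec fun a => List.range (f a) :=
  Primrec.list_range.comp hf

@[fun_prop]
theorem Primrec.length_fun {f : α → List β} (hf : Primrec f) : Primrec fun a => (f a).length :=
  Primrec.list_length.comp hf

@[fun_prop]
theorem Primrec.cons_fun {f : α → β} {g : α → List β} (hf : Primrec f) (hg : Primrec g) :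
    Primrec fun a => f a :: g a := Primrec.list_cons.comp hf hg

@[fun_prop]
theorem Primrec.headI_fun [Inhabited β] {f : α → List β} (hf : Primrec f) :
    Primrec fun a => (f a).headI := Primrec.list_headI.comp hf

@[fun_prop]
theorem Primrec.getD_fun {f : α → List β} {g : α → ℕ} {d : β} (hf : Primrec f) (hg : Primrec g) :
    Primrec fun a => (f a).getD (g a) d := (Primrec.list_getD d).comp hf hg

@[fun_prop]
theorem Primrec.idxOf_fun [BEq β] [LawfulBEq β] {f : α → List β} {g : α → β} (hf : Primrec f)
    (hg : Primrec g) : Primrec fun a => (f a).idxOf (g a) := by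
  classical
  refine (Primrec.list_idxOf.comp hg hf).of_eq fun a => ?_
  congr 1
  exact lawful_beq_subsingleton _ _

@[fun_prop]
theorem Primrec.map_fun {f : α → List β} {g : α → β → γ} (hf : Primrec f)
    (hg : Primrec fun p : α × β => g p.1 p.2) : Primrec fun a => (f a).map (g a) :=
  Primrec.list_map hf hg

@[fun_prop]
theorem Primrec.flatMap_fun {f : α → List β} {g : α → β → List γ} (hf : Primrec f)
    (hg : Primrec fun p : α × β => g p.1 p.2) : Primrec fun a => (f a).flatMap (g a) :=
  Primrec.list_flatMap hf hg

@[fun_prop]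
theorem Primrec.filter_fun {f : α → List β} {p : α → β → Prop} [∀ a b, Decidable (p a b)]
    (hf : Primrec f) (hp : PrimrecPred fun x : α × β => p x.1 x.2) :
    Primrec fun a => (f a).filter fun b => decide (p a b) := by
  classical
  have h : PrimrecRel fun b a => p a b :=
    hp.comp (f := fun x : β × α => (x.2, x.1)) (Primrec.snd.pair Primrec.fst)
  exact (h.listFilter.comp hf Primrec.id).of_eq fun a => List.filter_congr fun b _ => by simp

@[fun_prop]
theorem PrimrecPred.and_fun {p q : α → Prop} (hp : PrimrecPred p) (hq : PrimrecPred q) :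
    PrimrecPred fun a => p a ∧ q a := hp.and hq

@[fun_prop]
theorem PrimrecPred.or_fun {p q : α → Prop} (hp : PrimrecPred p) (hq : PrimrecPred q) :
    PrimrecPred fun a => p a ∨ q a := hp.or hq

@[fun_prop]
theorem PrimrecPred.not_fun {p : α → Prop} (hp : PrimrecPred p) :
    PrimrecPred fun a => ¬ p a := hp.not

@[fun_prop]
theorem PrimrecPred.imp_fun {p q : α → Prop} (hp : PrimrecPred p) (hq : PrimrecPred q) :
    PrimrecPred fun a => p a → q a :=
  (hp.not.or hq).of_eq fun _ => by rw [imp_iff_not_or]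

@[fun_prop]
theorem PrimrecPred.iff_fun {p q : α → Prop} (hp : PrimrecPred p) (hq : PrimrecPred q) :
    PrimrecPred fun a => p a ↔ q a :=
  ((hp.imp_fun hq).and (hq.imp_fun hp)).of_eq fun _ => iff_iff_implies_and_implies.symm

@[fun_prop]
theorem PrimrecPred.const_fun (p : Prop) : PrimrecPred fun _ : α => p := by
  classical
  exact ⟨fun _ => inferInstance, Primrec.const (decide p)⟩

@[fun_prop]
theorem PrimrecPred.eq_fun {f g : α → β} (hf : Primrec f) (hg : Primrec g) :
    PrimrecPred fun a => f a = g a := Primrec.eq.comp hf hg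

@[fun_prop]
theorem PrimrecPred.lt_fun {f g : α → ℕ} (hf : Primrec f) (hg : Primrec g) :
    PrimrecPred fun a => f a < g a := Primrec.nat_lt.comp hf hg

@[fun_prop]
theorem PrimrecPred.le_fun {f g : α → ℕ} (hf : Primrec f) (hg : Primrec g) :
    PrimrecPred fun a => f a ≤ g a := Primrec.nat_le.comp hf hg

@[fun_prop]
theorem PrimrecPred.exists_mem_fun {f : α → List β} {p : α → β → Prop} (hf : Primrec f)
    (hp : PrimrecPred fun x : α × β => p x.1 x.2) : PrimrecPred fun a => ∃ b ∈ f a, p a b := by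
  have h : PrimrecRel fun b a => p a b :=
    hp.comp (f := fun x : β × α => (x.2, x.1)) (Primrec.snd.pair Primrec.fst)
  exact h.exists_mem_list.comp hf Primrec.id

@[fun_prop]
theorem PrimrecPred.forall_mem_fun {f : α → List β} {p : α → β → Prop} (hf : Primrec f)
    (hp : PrimrecPred fun x : α × β => p x.1 x.2) : PrimrecPred fun a => ∀ b ∈ f a, p a b := by
  have h : PrimrecRel fun b a => p a b :=
    hp.comp (f := fun x : β × α => (x.2, x.1)) (Primrec.snd.pair Primrec.fst)
  exact h.forall_mem_list.comp hf Primrec.id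

@[fun_prop]
theorem PrimrecPred.exists_lt_fun {f : α → ℕ} {p : α → ℕ → Prop} (hf : Primrec f)
    (hp : PrimrecPred fun x : α × ℕ => p x.1 x.2) : PrimrecPred fun a => ∃ b < f a, p a b :=
  (PrimrecPred.exists_mem_fun (Primrec.list_range.comp hf) hp).of_eq fun a => by simp

@[fun_prop]
theorem PrimrecPred.forall_lt_fun {f : α → ℕ} {p : α → ℕ → Prop} (hf : Primrec f)
    (hp : PrimrecPred fun x : α × ℕ => p x.1 x.2) : PrimrecPred fun a => ∀ b < f a, p a b :=
  (PrimrecPred.forall_mem_fun (Primrec.list_range.comp hf) hp).of_eq fun a => by simp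

@[fun_prop]
theorem PrimrecPred.mem_fun {f : α → β} {g : α → List β} (hf : Primrec f) (hg : Primrec g) :
    PrimrecPred fun a => f a ∈ g a :=
  (PrimrecPred.exists_mem_fun (p := fun a b => b = f a) hg (by fun_prop)).of_eq fun a => by simp

@[fun_prop]
theorem Primrec.findIdx_fun {f : α → List β} {p : α → β → Prop} [∀ a b, Decidable (p a b)]
    (hf : Primrec f) (hp : PrimrecPred fun x : α × β => p x.1 x.2) :
    Primrec fun a => (f a).findIdx fun b => decide (p a b) :=
  Primrec.list_findIdx hf hp.decide

@[fun_prop]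
theorem Primrec.lclNumIn {f : α → LCL} (hf : Primrec f) : Primrec fun a => (f a).numIn :=
  (Primrec.fst.comp (Primrec.of_equiv (e := LCL.equivProd))).comp hf

@[fun_prop]
theorem Primrec.lclNumOut {f : α → LCL} (hf : Primrec f) : Primrec fun a => (f a).numOut :=
  ((Primrec.fst.comp Primrec.snd).comp (Primrec.of_equiv (e := LCL.equivProd))).comp hf

@[fun_prop]
theorem Primrec.lclRadius {f : α → LCL} (hf : Primrec f) : Primrec fun a => (f a).radius :=
  ((Primrec.fst.comp (Primrec.snd.comp Primrec.snd)).comp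
    (Primrec.of_equiv (e := LCL.equivProd))).comp hf

@[fun_prop]
theorem Primrec.lclAccepted {f : α → LCL} (hf : Primrec f) : Primrec fun a => (f a).accepted :=
  ((Primrec.snd.comp (Primrec.snd.comp Primrec.snd)).comp
    (Primrec.of_equiv (e := LCL.equivProd))).comp hf

@[fun_prop]
theorem Primrec.graphNodes {f : α → CenteredGraph} (hf : Primrec f) :
    Primrec fun a => (f a).nodes :=
  (Primrec.fst.comp (Primrec.of_equiv (e := CenteredGraph.equivProd))).comp hf

@[fun_prop]
theorem Primrec.graphEdges {f : α → CenteredGraph} (hf : Primrec f) :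
    Primrec fun a => (f a).edges :=
  ((Primrec.fst.comp Primrec.snd).comp (Primrec.of_equiv (e := CenteredGraph.equivProd))).comp hf

@[fun_prop]
theorem Primrec.graphCenter {f : α → CenteredGraph} (hf : Primrec f) :
    Primrec fun a => (f a).center :=
  ((Primrec.snd.comp Primrec.snd).comp (Primrec.of_equiv (e := CenteredGraph.equivProd))).comp hf

/-! ### Primitive recursiveness of tuples, views and tables -/

@[fun_prop]
theorem primrec_tuples {f g : α → ℕ} (hf : Primrec f) (hg : Primrec g) :
    Primrec fun a => tuples (f a) (g a) := by
  have h := Primrec.nat_rec' (f := g) (g := fun _ => [([] : List ℕ)])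
    (h := fun a x => x.2.flatMap fun l => (List.range (f a)).map fun y => y :: l) hg
    (Primrec.const _) (by unfold Primrec₂; fun_prop)
  refine h.of_eq fun a => ?_
  induction g a with
  | zero => rfl
  | succ k ih => simp only [tuples, ih]

variable {n k t u v w b r m : α → ℕ} {ids inp out tab l : α → List ℕ} {H : α → CenteredGraph}
  {P : α → LCL} (cyc : Bool) (c : ℕ)

@[fun_prop]
theorem primrecPred_stepsTo (hn : Primrec n) (hk : Primrec k) (hv : Primrec v) (hu : Primrec u) :
    PrimrecPred fun a => StepsTo cyc (n a) (k a) (v a) (u a) := by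
  unfold StepsTo
  fun_prop

@[fun_prop]
theorem primrecPred_near (hn : Primrec n) (ht : Primrec t) (hv : Primrec v) (hu : Primrec u) :
    PrimrecPred fun a => Near cyc (n a) (t a) (v a) (u a) := by
  unfold Near
  fun_prop

@[fun_prop]
theorem primrecPred_adjacent (hn : Primrec n) (hu : Primrec u) (hw : Primrec w) :
    PrimrecPred fun a => Adjacent cyc (n a) (u a) (w a) := by
  unfold Adjacent
  fun_prop

@[fun_prop]
theorem primrec_sortedNodes {S : α → ℕ → Prop} (hn : Primrec n) (hb : Primrec b)
    (hids : Primrec ids) (hS : PrimrecPred fun p : α × ℕ => S p.1 p.2) :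
    Primrec fun a => sortedNodes (n a) (b a) (ids a) (S a) := by
  classical
  unfold sortedNodes
  have : PrimrecPred fun p : (α × ℕ) × ℕ => S p.1.1 p.2 :=
    hS.comp (f := fun p : (α × ℕ) × ℕ => (p.1.1, p.2)) (by fun_prop)
  refine .flatMap_fun (by fun_prop) ?_
  convert Primrec.filter_fun (f := fun p : α × ℕ => List.range (n p.1))
    (p := fun p u => (ids p.1).getD u 0 = p.2 ∧ S p.1 u) (by fun_prop)
    (PrimrecPred.and_fun (p := fun p : (α × ℕ) × ℕ => (ids p.1.1).getD p.2 0 = p.1.2)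
      (by fun_prop) this)

@[fun_prop]
theorem primrec_listView (hn : Primrec n) (hb : Primrec b) (ht : Primrec t) (hids : Primrec ids)
    (hinp : Primrec inp) (hv : Primrec v) :
    Primrec fun a => listView cyc (n a) (b a) (t a) (ids a) (inp a) (v a) := by
  unfold listView
  fun_prop

@[fun_prop]
theorem primrec_allViews (hm : Primrec m) (hn : Primrec n) (ht : Primrec t) :
    Primrec fun a => allViews cyc c (m a) (n a) (t a) := by
  unfold allViews
  fun_prop

@[fun_prop]
theorem primrec_tableOutput {x : α → View} (hm : Primrec m) (hn : Primrec n) (ht : Primrec t)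
    (htab : Primrec tab) (hx : Primrec x) :
    Primrec fun a => tableOutput cyc c (m a) (n a) (t a) (tab a) (x a) := by
  unfold tableOutput
  fun_prop

@[fun_prop]
theorem primrec_tableLabels (hm : Primrec m) (hn : Primrec n) (ht : Primrec t)
    (htab : Primrec tab) (hids : Primrec ids) (hinp : Primrec inp) :
    Primrec fun a => tableLabels cyc c (m a) (n a) (t a) (tab a) (ids a) (inp a) := by
  unfold tableLabels
  fun_prop

@[fun_prop]
theorem primrecPred_listMatches (hH : Primrec H) (hn : Primrec n) (hr : Primrec r)
    (hinp : Primrec inp) (hout : Primrec out) (hv : Primrec v) (hl : Primrec l) :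
    PrimrecPred fun a => ListMatches cyc (H a) (n a) (r a) (inp a) (out a) (v a) (l a) := by
  unfold ListMatches
  fun_prop

@[fun_prop]
theorem primrecPred_listCorrect (hP : Primrec P) (hn : Primrec n) (hinp : Primrec inp)
    (hout : Primrec out) :
    PrimrecPred fun a => ListCorrect cyc (P a) (n a) (inp a) (out a) := by
  unfold ListCorrect
  fun_prop

@[fun_prop]
theorem primrecPred_tableSolves (hP : Primrec P) (hn : Primrec n) (ht : Primrec t)
    (htab : Primrec tab) :
    PrimrecPred fun a => TableSolves cyc c (P a) (n a) (t a) (tab a) := by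
  unfold TableSolves
  fun_prop

@[fun_prop]
theorem primrec_goodTables (hP : Primrec P) (hn : Primrec n) (ht : Primrec t) :
    Primrec fun a => goodTables cyc c (P a) (n a) (t a) := by
  unfold goodTables
  fun_prop

@[fun_prop]
theorem primrec_searchRounds (hP : Primrec P) (hn : Primrec n) :
    Primrec fun a => searchRounds cyc c (P a) (n a) := by
  unfold searchRounds
  fun_prop

@[fun_prop]
theorem primrec_searchOutput {x : α → View} (hP : Primrec P) (hx : Primrec x) :
    Primrec fun a => searchOutput cyc c (P a) (x a) := by
  unfold searchOutput
  fun_prop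

@[fun_prop]
theorem primrec_testSize (hP : Primrec P) : Primrec fun a => testSize c (P a) := by
  unfold testSize roundFactor finalBits LCL.pumpLength
  fun_prop

end Primrec

/-- The s-m-n theorem: one code serves all problems, and currying it with the encoding of `P`
produces the program for `P` computably. -/
theorem exists_code_of_primrec {α : Type*} [Primcodable α] {f : LCL → α → ℕ}
    (hf : Primrec fun p : LCL × α => f p.1 p.2) : ∃ e : Nat.Partrec.Code, ∀ P x,
      f P x ∈ (e.curry (Encodable.encode P)).eval (Encodable.encode x) := by
  obtain ⟨e, he⟩ := Nat.Partrec.Code.exists_code.1 hf.to_comp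
  refine ⟨e, fun P x => ?_⟩
  rw [Nat.Partrec.Code.eval_curry, he]
  simp

theorem exists_computable_decider (cyc : Bool) (c : ℕ) :
    ∃ D : LCL → Option AlgorithmDescription, Computable D ∧ ∀ P : LCL,
      (D P ≠ none ↔ ∃ t, 4 * (t + P.radius) + 10 ≤ testSize c P ∧
        SolvableIn cyc c P (testSize c P) t) ∧
      ∀ d, D P = some d → ∃ A : LocalAlgorithm, Describes d A ∧
        ∀ n t, t ≤ n → SolvableIn cyc c P n t → A.rounds n ≤ t ∧ A.Solves P c (hostGraph cyc n) := by
  classical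
  obtain ⟨e₁, h₁⟩ := exists_code_of_primrec (f := searchRounds cyc c) (by fun_prop)
  obtain ⟨e₂, h₂⟩ := exists_code_of_primrec (f := searchOutput cyc c) (by fun_prop)
  -- The bound `t < testSize c P` follows from the next condition; it is stated to make the
  -- quantifier bounded, hence the test primitive recursive.
  let test : LCL → Prop := fun P => ∃ t < testSize c P, 4 * (t + P.radius) + 10 ≤ testSize c P ∧
    ¬ goodTables cyc c P (testSize c P) t = []
  have htest : PrimrecPred test := by fun_prop
  have htest_iff : ∀ P, test P ↔ ∃ t, 4 * (t + P.radius) + 10 ≤ testSize c P ∧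
      SolvableIn cyc c P (testSize c P) t := fun P =>
    ⟨fun ⟨t, _, h1, h2⟩ => ⟨t, h1, goodTables_ne_nil_iff.1 h2⟩,
      fun ⟨t, h1, h2⟩ => ⟨t, by omega, h1, goodTables_ne_nil_iff.2 h2⟩⟩
  refine ⟨fun P => if test P then
    some (e₁.curry (Encodable.encode P), e₂.curry (Encodable.encode P)) else none, ?_,
    fun P => ⟨?_, fun d hd => ?_⟩⟩
  · have hcurry : ∀ e : Nat.Partrec.Code, Primrec fun P : LCL => e.curry (Encodable.encode P) :=
      fun e => Nat.Partrec.Code.primrec₂_curry.comp (Primrec.const e) Primrec.encode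
    exact (Primrec.ite htest (Primrec.option_some.comp ((hcurry e₁).pair (hcurry e₂)))
      (Primrec.const none)).to_comp
  · rw [← htest_iff]
    by_cases h : test P <;> simp [h]
  · refine ⟨⟨searchRounds cyc c P, searchOutput cyc c P⟩, ?_, fun n t ht h => search_spec ht h⟩
    by_cases h : test P
    · simp only [h, if_true, Option.some.injEq] at hd
      subst hd
      exact ⟨fun n => h₁ P n, fun w => h₂ P w⟩
    · simp [h] at hd

/-- Feasibility is equivalent to `O(log* n)` and its negation to `Ω(n)`: each implies the
corresponding bound, and the two bounds exclude each other. -/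
theorem dichotomy_and_decision (c : ℕ) (hc : 1 ≤ c) (cyc : Bool) :
    (∀ P : LCL,
      IsBigOmegaLinear (fun n => P.complexity c (hostGraph cyc n)) ∨
        IsBigOLogStar (fun n => P.complexity c (hostGraph cyc n))) ∧
    ∃ D : LCL → Option AlgorithmDescription, Computable D ∧ ∀ P : LCL,
      (D P = none ↔ IsBigOmegaLinear (fun n => P.complexity c (hostGraph cyc n))) ∧
      ((∃ d, D P = some d) ↔ IsBigOLogStar (fun n => P.complexity c (hostGraph cyc n))) ∧
      ∀ d, D P = some d → ∃ A : LocalAlgorithm, Describes d A ∧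
        IsBigOLogStar (fun n => (A.rounds n : ℕ∞)) ∧
        ∀ n, P.complexity c (hostGraph cyc n) ≠ ⊤ → A.Solves P c (hostGraph cyc n) := by
  have hO : ∀ P : LCL, (∃ f, P.IsFeasible cyc f) ↔
      IsBigOLogStar (fun n => P.complexity c (hostGraph cyc n)) := fun P =>
    ⟨isBigOLogStar_of_isFeasible hc, fun h => by
      by_contra hf
      exact not_isBigOmegaLinear_of_isBigOLogStar h (isBigOmegaLinear_of_not_isFeasible hc hf)⟩
  have hΩ : ∀ P : LCL, ¬ (∃ f, P.IsFeasible cyc f) ↔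
      IsBigOmegaLinear (fun n => P.complexity c (hostGraph cyc n)) := fun P =>
    ⟨isBigOmegaLinear_of_not_isFeasible hc, fun h hf =>
      not_isBigOmegaLinear_of_isBigOLogStar (isBigOLogStar_of_isFeasible hc hf) h⟩
  refine ⟨fun P => ?_, ?_⟩
  · rw [← hΩ, ← hO]
    exact (em _).symm
  · obtain ⟨D, hD, hspec⟩ := exists_computable_decider cyc c
    -- A fast algorithm at the single size `testSize c P` already implies feasibility; conversely,
    -- feasibility gives the `log*` algorithm, which is fast enough at this size.
    have hfeas : ∀ P, D P ≠ none ↔ ∃ f, P.IsFeasible cyc f := fun P => by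
      rw [(hspec P).1]
      constructor
      · rintro ⟨t, ht, hs⟩
        exact isFeasible_of_solvableIn hc hs ht
      · intro hf
        exact ⟨_, le_trans (Nat.le_add_right _ _) (lookRadius_le le_rfl),
          solvableIn_of_isFeasible hc hf le_rfl⟩
    refine ⟨D, hD, fun P => ⟨?_, ?_, fun d hd => ?_⟩⟩
    · rw [← hΩ, ← hfeas, not_not]
    · rw [← hO, ← hfeas, Option.ne_none_iff_exists']
    · obtain ⟨A, hA, h⟩ := (hspec P).2 d hd
      have hf := (hfeas P).1 (by rw [hd]; simp)
      refine ⟨A, hA, isBigOLogStar_of_le_lookRadius (N := testSize c P)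
        (K := 2 * P.pumpLength) (c := c) fun n hn => ?_, fun n hn => ?_⟩
      · have h1 := lookRadius_le hn
        exact_mod_cast (h n _ (by omega) (solvableIn_of_isFeasible hc hf hn)).1
      · obtain ⟨t, ht, hs⟩ := exists_solvableIn_of_complexity_ne_top hn
        exact (h n t ht hs).2

theorem mainTheorem1 (c : ℕ) (hc : 1 ≤ c) (G : (n : ℕ) → SimpleGraph (Fin n))
    (hG : G = SimpleGraph.cycleGraph ∨ G = SimpleGraph.pathGraph) :
    (∀ P : LCL,
      IsBigOmegaLinear (fun n => P.complexity c (G n)) ∨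
        IsBigOLogStar (fun n => P.complexity c (G n))) ∧
    ∃ D : LCL → Option AlgorithmDescription, Computable D ∧ ∀ P : LCL,
      (D P = none ↔ IsBigOmegaLinear (fun n => P.complexity c (G n))) ∧
      ((∃ d, D P = some d) ↔ IsBigOLogStar (fun n => P.complexity c (G n))) ∧
      ∀ d, D P = some d → ∃ A : LocalAlgorithm, Describes d A ∧
        IsBigOLogStar (fun n => (A.rounds n : ℕ∞)) ∧
        ∀ n, P.complexity c (G n) ≠ ⊤ → A.Solves P c (G n) := by
  rcases hG with rfl | rfl
  · exact dichotomy_and_decision c hc true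
  · exact dichotomy_and_decision c hc false
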